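/- Let $d\in\mathbb N$ and let $p_1,p_2,q_1,q_2\in[1,\infty]$ and $q\in[2,\infty]$ satisfy $p_1,p_2,q_1,q_2\le q$, $$\frac1{p_1}+\frac1{p_2}\ge 1\qquad\text{and}\qquad \frac1{q_1}+\frac1{q_2}\ge 1 ,$$ where $1/\infty=0$. For a non-zero window $g\in\mathcal S(\mathbb R^d)$, $f\in\mathcal S'(\mathbb R^d)$ and $1\le p,r\le\infty$ put $$V_gf(x,\xi)=\langle f,M_\xi T_xg\rangle=\int_{\mathbb R^d} f(t)\,\overline{g(t-x)}\,e^{-2\pi i t\cdot\xi}\,dt,\qquad \|f\|_{M^{p,r}(\mathbb R^d)}=\Big(\int_{\mathbb R^d}\Big(\int_{\mathbb R^d}|V_gf(x,\xi)|^p\,dx\Big)^{r/p}d\xi\Big)^{1/r}$$ (with the usual changes if $p=\infty$ or $r=\infty$), and let $M^{p,r}(\mathbb R^d)$ be the set of $f\in\mathcal S'(\mathbb R^d)$ for which this norm is finite. The (cross-)ambiguity function $$A(f_1,f_2)(x,\xi)=\int_{\mathbb R^d}e^{-2\pi i t\cdot\xi}f_1\big(t+\tfrac x2\big)\overline{f_2\big(t-\tfrac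 x2\big)}\,dt$$ is extended to $f_1,f_2\in\mathcal S'(\mathbb R^d)$ as a tempered distribution on $\mathbb R^{2d}$: it is the partial Fourier transform in $t$ of the tensor product $f_1\otimes\overline{f_2}$ in the coordinates $(x,t)$ given by $u=t+\frac x2$, $v=t-\frac x2$. Then, for any non-zero windows $g_1,g_2\in\mathcal S(\mathbb R^d)$ used to define the norms of $M^{p_1,q_1}(\mathbb R^d)$ and $M^{p_2,q_2}(\mathbb R^d)$ respectively, there is a constant $C<\infty$, depending only on $d,p_1,p_2,q_1,q_2,q,g_1,g_2$, such that for all $f_1\in M^{p_1,q_1}(\mathbb R^d)$ and $f_2\in M^{p_2,q_2}(\mathbb R^d)$ the ambiguity function $A(f_1,f_2)$ belongs to $L^q(\mathbb R^{2d})$ and $$\|A(f_1,f_2)\|_{L^q(\mathbb R^{2d})}\le C\,\|f_1\|_{M^{p_1,q_1}(\mathbb R^d)}\,\|f_2\|_{M^{p_2,q_2}(\mathbb R^d)} .$$ -/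

import Mathlib

open MeasureTheory SchwartzMap LineDeriv FourierTransform
open scoped ENNReal NNReal ContDiff

noncomputable section
namespace TimeFreq

section General
variable {X Y E F V : Type} [NormedAddCommGroup X] [NormedSpace ℝ X]
  [NormedAddCommGroup Y] [NormedSpace ℝ Y] [FiniteDimensional ℝ Y]
  [NormedAddCommGroup E] [NormedSpace ℝ E]
  [NormedAddCommGroup F] [NormedSpace ℝ F]

theorem smooth_of_closed (A : 𝓢(X, ℂ) → Y → ℂ) (D : Y → 𝓢(X, ℂ) →L[ℂ] 𝓢(X, ℂ))
    (hD : ∀ Φ y, ∃ L : Y →L[ℝ] ℂ, HasFDerivAt (A Φ) L y ∧ ∀ v, L v = A (D v Φ) y) (n : ℕ) :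
    ∀ Φ, ContDiff ℝ n (A Φ) := by
  have hd : ∀ Φ, Differentiable ℝ (A Φ) := fun Φ y => by
    obtain ⟨L, h, -⟩ := hD Φ y
    exact h.differentiableAt
  have hf : ∀ Φ v, (fun y => fderiv ℝ (A Φ) y v) = A (D v Φ) := fun Φ v => by
    ext y
    obtain ⟨L, h, h'⟩ := hD Φ y
    rw [h.fderiv, h']
  induction n with
  | zero => exact fun Φ => contDiff_zero.2 (hd Φ).continuous
  | succ n ih =>
    intro Φ
    push_cast
    rw [contDiff_succ_iff_fderiv_apply]
    refine ⟨hd Φ, by simp, fun v => ?_⟩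
    rw [hf]
    exact ih _

theorem decay_of_closed (A : 𝓢(X, ℂ) → Y → ℂ) (D : Y → 𝓢(X, ℂ) →L[ℂ] 𝓢(X, ℂ))
    (hD : ∀ Φ y, ∃ L : Y →L[ℝ] ℂ, HasFDerivAt (A Φ) L y ∧ ∀ v, L v = A (D v Φ) y)
    (hb : ∀ k : ℕ, ∃ q : Seminorm ℂ 𝓢(X, ℂ), Continuous q ∧ ∀ Φ y, ‖y‖ ^ k * ‖A Φ y‖ ≤ q Φ)
    (k n : ℕ) : ∃ q : Seminorm ℂ 𝓢(X, ℂ), Continuous q ∧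
      ∀ Φ y, ‖y‖ ^ k * ‖iteratedFDeriv ℝ n (A Φ) y‖ ≤ q Φ := by
  induction n with
  | zero => simpa using hb k
  | succ n ih =>
    obtain ⟨q, hq, h⟩ := ih
    let b := Module.finBasis ℝ Y
    let c : Fin (Module.finrank ℝ Y) → (Y →L[ℝ] ℝ) := fun i => (b.coord i).toContinuousLinearMap
    let ι : Fin (Module.finrank ℝ Y) → (ℂ →L[ℝ] (Y →L[ℝ] ℂ)) := fun i =>
      ContinuousLinearMap.smulRightL ℝ Y ℂ (c i)
    have hfd : ∀ Φ, fderiv ℝ (A Φ) = fun y => ∑ i, ι i (A (D (b i) Φ) y) := by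
      intro Φ
      ext y v
      obtain ⟨L, h1, h2⟩ := hD Φ y
      rw [h1.fderiv]
      conv_lhs => rw [← b.sum_repr v, map_sum]
      simp only [map_smul, h2 (b _)]
      simp [ι, c]
    refine ⟨∑ i, ‖ι i‖₊ • q.comp (D (b i)).toLinearMap, ?_, ?_⟩
    · have : (⇑(∑ i, ‖ι i‖₊ • q.comp (D (b i)).toLinearMap)
          : 𝓢(X, ℂ) → ℝ) = fun Φ => ∑ i, ‖ι i‖ * q (D (b i) Φ) := by
        ext Φ
        simp [NNReal.smul_def]
      rw [this]
      exact continuous_finsetSum _ fun i _ => continuous_const.mul (hq.comp (D (b i)).continuous)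
    · intro Φ y
      have hs : ∀ i, ContDiff ℝ n (fun y => ι i (A (D (b i) Φ) y)) := fun i =>
        (ι i).contDiff.comp (smooth_of_closed A D hD n _)
      rw [← norm_iteratedFDeriv_fderiv, hfd, iteratedFDeriv_fun_sum_apply (fun i _ => (hs i).contDiffAt)]
      have : (∑ i, ‖ι i‖₊ • q.comp (D (b i)).toLinearMap) Φ
          = ∑ i, ‖ι i‖ * q (D (b i) Φ) := by
        simp [NNReal.smul_def]
      rw [this]
      calc _ ≤ ‖y‖ ^ k * ∑ i, ‖ι i‖ * ‖iteratedFDeriv ℝ n (A (D (b i) Φ)) y‖ := by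
            gcongr
            refine (norm_sum_le _ _).trans (Finset.sum_le_sum fun i _ => ?_)
            exact (ι i).norm_iteratedFDeriv_comp_left
              (smooth_of_closed A D hD n _).contDiffAt le_rfl
        _ ≤ _ := by
            rw [Finset.mul_sum]
            refine Finset.sum_le_sum fun i _ => ?_
            have := h (D (b i) Φ) y
            calc _ = ‖ι i‖ * (‖y‖ ^ k * ‖iteratedFDeriv ℝ n (A (D (b i) Φ)) y‖) := by ring
              _ ≤ _ := by gcongr

/-- Assemble a continuous linear map between Schwartz spaces from a family that is closed under
differentiation. -/
def mkClosed (A : 𝓢(X, ℂ) → Y → ℂ) (hadd : ∀ f g y, A (f + g) y = A f y + A g y)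
    (hsmul : ∀ (a : ℂ) f y, A (a • f) y = a • A f y) (D : Y → 𝓢(X, ℂ) →L[ℂ] 𝓢(X, ℂ))
    (hD : ∀ Φ y, ∃ L : Y →L[ℝ] ℂ, HasFDerivAt (A Φ) L y ∧ ∀ v, L v = A (D v Φ) y)
    (hb : ∀ k : ℕ, ∃ q : Seminorm ℂ 𝓢(X, ℂ), Continuous q ∧ ∀ Φ y, ‖y‖ ^ k * ‖A Φ y‖ ≤ q Φ) :
    𝓢(X, ℂ) →L[ℂ] 𝓢(Y, ℂ) :=
  SchwartzMap.mkCLM (σ := RingHom.id ℂ) A hadd hsmul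
    (fun Φ => contDiff_infty.2 fun n => smooth_of_closed A D hD n Φ) (by
      rintro ⟨k, n⟩
      obtain ⟨q, hq, h⟩ := decay_of_closed A D hD hb k n
      obtain ⟨s, C, -, hC⟩ := Seminorm.bound_of_continuous (schwartz_withSeminorms ℂ X ℂ) q hq
      exact ⟨s, C, C.2, fun f x => (h f x).trans (hC f)⟩)


/-- The slice `y ↦ Φ (x, y)` of a Schwartz function on a product. -/
def slice (x : E) : 𝓢(E × F, ℂ) →L[ℂ] 𝓢(F, ℂ) :=
  SchwartzMap.compCLM ℂ (g := fun y : F => (x, y))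
    ((Function.HasTemperateGrowth.const (x, (0 : F))).add
      (ContinuousLinearMap.inr ℝ E F).hasTemperateGrowth |> fun h => by
        convert h using 1
        ext y <;> simp)
    ⟨1, 1, fun y => by
      have := norm_snd_le (x, y)
      simp only [one_mul, pow_one]
      linarith⟩

@[simp] theorem slice_apply (x : E) (Φ : 𝓢(E × F, ℂ)) (y : F) : slice x Φ y = Φ (x, y) := rfl

theorem norm_iteratedFDeriv_slice (x : E) (Φ : 𝓢(E × F, ℂ)) (n : ℕ) (y : F) :
    ‖iteratedFDeriv ℝ n (slice x Φ) y‖ ≤ ‖iteratedFDeriv ℝ n Φ (x, y)‖ := by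
  have h1 : (slice x Φ : F → ℂ) =
      (fun w => Φ ((x, 0) + w)) ∘ (ContinuousLinearMap.inr ℝ E F) := by
    ext y
    simp
  have hs : ContDiff ℝ n (fun w : E × F => Φ ((x, 0) + w)) :=
    (Φ.smooth n).comp (contDiff_const.add contDiff_id)
  rw [h1, ContinuousLinearMap.iteratedFDeriv_comp_right _ hs _ le_rfl]
  refine (ContinuousMultilinearMap.norm_compContinuousLinearMap_le _ _).trans ?_
  rw [iteratedFDeriv_comp_add_left]
  have h2 : (x, (0 : F)) + ContinuousLinearMap.inr ℝ E F y = (x, y) := by simp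
  rw [h2]
  refine mul_le_of_le_one_right (norm_nonneg _) ?_
  exact Finset.prod_le_one (fun _ _ => norm_nonneg _)
    fun _ _ => ContinuousLinearMap.norm_inr_le_one ℝ E F

theorem slice_bound (k : ℕ) (q : Seminorm ℂ 𝓢(F, ℂ)) (hq : Continuous q) :
    ∃ q' : Seminorm ℂ 𝓢(E × F, ℂ), Continuous q' ∧ ∀ x Φ, ‖x‖ ^ k * q (slice x Φ) ≤ q' Φ := by
  obtain ⟨s, C, -, hC⟩ := Seminorm.bound_of_continuous (schwartz_withSeminorms ℂ F ℂ) q hq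
  refine ⟨C • ∑ i ∈ s, schwartzSeminormFamily ℂ (E × F) ℂ (k + i.1, i.2), ?_, ?_⟩
  · have : (⇑(C • ∑ i ∈ s, schwartzSeminormFamily ℂ (E × F) ℂ (k + i.1, i.2))
          : 𝓢(E × F, ℂ) → ℝ) = fun Φ => C * ∑ i ∈ s, schwartzSeminormFamily ℂ (E × F) ℂ (k + i.1, i.2) Φ := by
      ext Φ
      simp [NNReal.smul_def]
    rw [this]
    exact continuous_const.mul (continuous_finsetSum _ fun i _ =>
      (schwartz_withSeminorms ℂ (E × F) ℂ).continuous_seminorm _)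
  · intro x Φ
    have h0 : (C • ∑ i ∈ s, schwartzSeminormFamily ℂ (E × F) ℂ (k + i.1, i.2)) Φ
        = C * ∑ i ∈ s, schwartzSeminormFamily ℂ (E × F) ℂ (k + i.1, i.2) Φ := by
      simp [NNReal.smul_def]
    rw [h0]
    have h1 : ∀ i : ℕ × ℕ, ‖x‖ ^ k * schwartzSeminormFamily ℂ F ℂ i (slice x Φ) ≤
        schwartzSeminormFamily ℂ (E × F) ℂ (k + i.1, i.2) Φ := by
      rintro ⟨a, b⟩
      rcases eq_or_ne (‖x‖ ^ k) 0 with h | h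
      · rw [h, zero_mul]
        positivity
      have hp : 0 < ‖x‖ ^ k := lt_of_le_of_ne (by positivity) h.symm
      rw [mul_comm, ← le_div_iff₀ hp]
      refine SchwartzMap.seminorm_le_bound ℂ a b _ (by positivity) fun y => ?_
      rw [le_div_iff₀ hp]
      calc _ ≤ ‖(x, y)‖ ^ a * ‖iteratedFDeriv ℝ b Φ (x, y)‖ * ‖(x, y)‖ ^ k := by
            gcongr
            · exact norm_snd_le (x, y)
            · exact norm_iteratedFDeriv_slice x Φ b y
            · exact norm_fst_le (x, y)
        _ = ‖(x, y)‖ ^ (k + a) * ‖iteratedFDeriv ℝ b Φ (x, y)‖ := by ring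
        _ ≤ _ := SchwartzMap.le_seminorm ℂ (k + a) b Φ (x, y)
    calc _ ≤ ‖x‖ ^ k * (C * ∑ i ∈ s, schwartzSeminormFamily ℂ F ℂ i (slice x Φ)) := by
          gcongr
          refine (hC _).trans ?_
          simp only [smul_apply, NNReal.smul_def, smul_eq_mul]
          gcongr
          simpa using
            Seminorm.le_def.1 (Seminorm.finset_sup_le_sum (schwartzSeminormFamily ℂ F ℂ) s) (slice x Φ)
      _ = C * ∑ i ∈ s, ‖x‖ ^ k * schwartzSeminormFamily ℂ F ℂ i (slice x Φ) := by
          rw [Finset.mul_sum, Finset.mul_sum, Finset.mul_sum]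
          exact Finset.sum_congr rfl fun i _ => by ring
      _ ≤ _ := by
          gcongr with i
          exact h1 i

/-- The first order Taylor remainder of a Schwartz function. -/
def taylorRem [NormedAddCommGroup V] [NormedSpace ℝ V] (w : X) (Φ : 𝓢(X, V)) : 𝓢(X, V) :=
  SchwartzMap.compSubConstCLM ℝ (-w) Φ - Φ - ∂_{w} Φ

theorem taylorRem_apply [NormedAddCommGroup V] [NormedSpace ℝ V] (w : X) (Φ : 𝓢(X, V)) (z : X) :
    taylorRem w Φ z = Φ (z + w) - Φ z - fderiv ℝ Φ z w := by
  simp [taylorRem, SchwartzMap.lineDerivOp_apply_eq_fderiv]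

theorem fderivCLM_taylorRem [NormedAddCommGroup V] [NormedSpace ℝ V] (w : X) (Φ : 𝓢(X, V)) :
    fderivCLM ℝ X V (taylorRem w Φ) = taylorRem w (fderivCLM ℝ X V Φ) := by
  ext z v
  have h1 : fderiv ℝ (SchwartzMap.compSubConstCLM ℝ (-w) Φ) z = fderiv ℝ Φ (z + w) := by
    have : (SchwartzMap.compSubConstCLM ℝ (-w) Φ : X → V) = fun y => Φ (y + w) := by
      ext y
      simp
    rw [this, fderiv_comp_add_right]
  have hd : DifferentiableAt ℝ (fderiv ℝ Φ) z :=
    ((fderivCLM ℝ X V Φ).hasFDerivAt z).differentiableAt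
  have h2 : fderiv ℝ (∂_{w} Φ : 𝓢(X, V)) z v = fderiv ℝ (fderiv ℝ Φ) z w v := by
    have : ((∂_{w} Φ : 𝓢(X, V)) : X → V) = fun y => fderiv ℝ Φ y w := by
      ext y
      rw [SchwartzMap.lineDerivOp_apply_eq_fderiv]
    rw [this, fderiv_clm_apply hd (differentiableAt_const w)]
    have hsym : IsSymmSndFDerivAt ℝ Φ z :=
      (Φ.smooth 2).contDiffAt.isSymmSndFDerivAt (by simp)
    simpa using hsym.eq v w
  rw [taylorRem_apply]
  simp only [taylorRem, map_sub, sub_apply, fderivCLM_apply, h1, h2]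
  rfl

theorem taylor_two [NormedAddCommGroup V] [NormedSpace ℝ V] (Φ : 𝓢(X, V)) (z w : X) (M : ℝ)
    (hM : ∀ u ∈ Metric.closedBall z ‖w‖, ‖fderiv ℝ (fderivCLM ℝ X V Φ) u‖ ≤ M) :
    ‖Φ (z + w) - Φ z - fderiv ℝ Φ z w‖ ≤ M * ‖w‖ ^ 2 := by
  have hz : z ∈ Metric.closedBall z ‖w‖ := by simp
  have hw : z + w ∈ Metric.closedBall z ‖w‖ := by simp
  have hc : Convex ℝ (Metric.closedBall z ‖w‖) := convex_closedBall z _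
  have hM0 : 0 ≤ M := le_trans (by positivity) (hM z hz)
  have h1 : ∀ u ∈ Metric.closedBall z ‖w‖, ‖fderiv ℝ Φ u - fderiv ℝ Φ z‖ ≤ M * ‖w‖ := by
    intro u hu
    refine (hc.norm_image_sub_le_of_norm_hasFDerivWithin_le
      (fun y _ => ((fderivCLM ℝ X V Φ).hasFDerivAt y).hasFDerivWithinAt) hM hz hu).trans ?_
    gcongr
    simpa [dist_eq_norm] using hu
  have := hc.norm_image_sub_le_of_norm_hasFDerivWithin_le'
    (fun y _ => (Φ.hasFDerivAt y).hasFDerivWithinAt) h1 hz hw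
  simp only [add_sub_cancel_left] at this
  linarith [this, show M * ‖w‖ * ‖w‖ = M * ‖w‖ ^ 2 by ring]

theorem taylorRem_bound (k n : ℕ) : ∀ (V : Type) [NormedAddCommGroup V] [NormedSpace ℝ V]
    (Φ : 𝓢(X, V)), ∃ C, 0 ≤ C ∧ ∀ w, ‖w‖ ≤ 1 → ∀ z,
      ‖z‖ ^ k * ‖iteratedFDeriv ℝ n (taylorRem w Φ) z‖ ≤ C * ‖w‖ ^ 2 := by
  induction n with
  | zero =>
    intro V _ _ Φ
    let K : ℝ := 2 ^ k * (Finset.Iic (k, 1)).sup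
      (fun m => SchwartzMap.seminorm ℝ m.1 m.2) (fderivCLM ℝ X V Φ)
    have hK : 0 ≤ K := by positivity
    refine ⟨K, hK, fun w hw z => ?_⟩
    rw [norm_iteratedFDeriv_zero, taylorRem_apply]
    rcases eq_or_ne (‖z‖ ^ k) 0 with h | h
    · rw [h, zero_mul]
      positivity
    have hp : 0 < ‖z‖ ^ k := lt_of_le_of_ne (by positivity) h.symm
    have := taylor_two Φ z w (K / ‖z‖ ^ k) fun u hu => by
      rw [le_div_iff₀' hp]
      have hzu : ‖z‖ ≤ 1 + ‖u‖ := by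
        have h1 : ‖u - z‖ ≤ 1 := by
          rw [← dist_eq_norm]
          exact (Metric.mem_closedBall.1 hu).trans hw
        have h2 : ‖z‖ ≤ ‖u - z‖ + ‖u‖ := by
          have := norm_sub_le u (u - z)
          simp only [sub_sub_cancel] at this
          linarith
        linarith
      calc _ ≤ (1 + ‖u‖) ^ k * ‖fderiv ℝ (fderivCLM ℝ X V Φ) u‖ := by gcongr
        _ ≤ K := by
          rw [← norm_iteratedFDeriv_one]
          exact SchwartzMap.one_add_le_sup_seminorm_apply (𝕜 := ℝ) (m := (k, 1)) le_rfl le_rfl _ u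
    calc _ ≤ ‖z‖ ^ k * (K / ‖z‖ ^ k * ‖w‖ ^ 2) := by gcongr
      _ = _ := by field_simp
  | succ n ih =>
    intro V _ _ Φ
    obtain ⟨C, hC, h⟩ := ih _ (fderivCLM ℝ X V Φ)
    refine ⟨C, hC, fun w hw z => ?_⟩
    rw [← norm_iteratedFDeriv_fderiv]
    have := h w hw z
    rw [← fderivCLM_taylorRem] at this
    exact this

theorem taylorRem_seminorm (q : Seminorm ℂ 𝓢(X, ℂ)) (hq : Continuous q) (Φ : 𝓢(X, ℂ)) :
    ∃ C, 0 ≤ C ∧ ∀ w, ‖w‖ ≤ 1 → q (taylorRem w Φ) ≤ C * ‖w‖ ^ 2 := by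
  obtain ⟨s, C, -, hC⟩ := Seminorm.bound_of_continuous (schwartz_withSeminorms ℂ X ℂ) q hq
  choose c hc h using fun i : ℕ × ℕ => taylorRem_bound i.1 i.2 ℂ Φ
  refine ⟨C * ∑ i ∈ s, c i, mul_nonneg C.2 (Finset.sum_nonneg fun i _ => hc i), fun w hw => ?_⟩
  calc q (taylorRem w Φ) ≤ C * ∑ i ∈ s, schwartzSeminormFamily ℂ X ℂ i (taylorRem w Φ) := by
        refine (hC _).trans ?_
        simp only [smul_apply, NNReal.smul_def, smul_eq_mul]
        gcongr
        simpa using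
          Seminorm.le_def.1 (Seminorm.finset_sup_le_sum (schwartzSeminormFamily ℂ X ℂ) s) _
    _ ≤ C * ∑ i ∈ s, c i * ‖w‖ ^ 2 := by
        gcongr with i
        exact SchwartzMap.seminorm_le_bound ℂ _ _ _ (mul_nonneg (hc i) (by positivity)) (h i w hw)
    _ = _ := by rw [← Finset.sum_mul, mul_assoc]

/-- The partial pairing `x ↦ T (Φ (x, ·))` of a tempered distribution `T` with a Schwartz function
of two variables. -/
def partialPairing [FiniteDimensional ℝ E] (T : 𝓢(F, ℂ) →L[ℂ] ℂ) : 𝓢(E × F, ℂ) →L[ℂ] 𝓢(E, ℂ) :=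
  mkClosed (fun Φ x => T (slice x Φ)) (fun f g x => by simp) (fun a f x => by simp)
    (fun v => LineDeriv.lineDerivOpCLM ℂ 𝓢(E × F, ℂ) (v, (0 : F)))
    (fun Φ x => by
      let L : E →ₗ[ℝ] ℂ :=
        { toFun := fun v => T (slice x (∂_{(v, (0 : F))} Φ))
          map_add' := fun v w => by
            have : ((v + w, 0) : E × F) = (v, 0) + (w, 0) := by simp
            rw [this, LineDeriv.lineDerivOp_left_add]
            simp
          map_smul' := fun a v => by
            have : ((a • v, 0) : E × F) = a • (v, 0) := by simp
            rw [this, LineDeriv.lineDerivOp_left_smul]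
            simp [← Complex.coe_smul] }
      refine ⟨L.toContinuousLinearMap, ?_, fun v => rfl⟩
      let q : Seminorm ℂ 𝓢(E × F, ℂ) := (normSeminorm ℂ ℂ).comp (T ∘L slice x).toLinearMap
      have hq : Continuous q := continuous_norm.comp (T ∘L slice x).continuous
      obtain ⟨C, hC, h⟩ := taylorRem_seminorm q hq Φ
      rw [hasFDerivAt_iff_isLittleO_nhds_zero]
      refine Asymptotics.IsBigO.trans_isLittleO (g := fun v : E => ‖v‖ ^ 2) ?_ ?_
      · refine Asymptotics.IsBigO.of_bound C ?_
        filter_upwards [Metric.closedBall_mem_nhds (0 : E) one_pos] with v hv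
        have hv1 : ‖((v, 0) : E × F)‖ = ‖v‖ := by simp
        have := h (v, 0) (by rw [hv1]; simpa using hv)
        rw [hv1] at this
        simp only [norm_pow, norm_norm]
        have hs : slice x (SchwartzMap.compSubConstCLM ℝ (-(v, (0 : F))) Φ) = slice (x + v) Φ := by
          ext y
          simp
        have hr : T (slice x (taylorRem (v, 0) Φ)) = T (slice (x + v) Φ) - T (slice x Φ) -
            T (slice x (∂_{(v, (0 : F))} Φ)) := by
          rw [taylorRem, map_sub, map_sub, map_sub, map_sub, hs]
        change ‖T (slice (x + v) Φ) - T (slice x Φ) - T (slice x (∂_{(v, (0 : F))} Φ))‖ ≤ _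
        rw [← hr]
        exact this
      · simpa using Asymptotics.isLittleO_norm_pow_id one_lt_two (E' := E))
    (fun k => by
      obtain ⟨q, hq, h⟩ := slice_bound (E := E) k ((normSeminorm ℂ ℂ).comp T.toLinearMap)
        (continuous_norm.comp T.continuous)
      exact ⟨q, hq, fun Φ x => h x Φ⟩)

@[simp] theorem partialPairing_apply [FiniteDimensional ℝ E] (T : 𝓢(F, ℂ) →L[ℂ] ℂ) (Φ : 𝓢(E × F, ℂ)) (x : E) :
    partialPairing T Φ x = T (slice x Φ) := rfl

end General
section PartialFourier
variable {E F : Type} [NormedAddCommGroup E] [NormedSpace ℝ E]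
  [NormedAddCommGroup F] [InnerProductSpace ℝ F] [FiniteDimensional ℝ F]
  [MeasurableSpace F] [BorelSpace F]
  {X : Type} [NormedAddCommGroup X] [NormedSpace ℝ X]

/-- The derivative of `(x, t) ↦ exp (-2 π i ξ · t) Φ (x, ξ)` -/
def pfDeriv (p : X →L[ℝ] E) (r : X →L[ℝ] F) (Φ : 𝓢(E × F, ℂ)) (z : X) (ξ : F) : X →L[ℝ] ℂ :=
  Complex.exp (↑(-2 * Real.pi * inner ℝ ξ (r z)) * Complex.I) •
    ((fderiv ℝ Φ (p z, ξ)).comp ((ContinuousLinearMap.inl ℝ E F).comp p)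
      + (ContinuousLinearMap.smulRight ((innerSL ℝ ξ).comp r)
          (-2 * Real.pi * Complex.I * Φ (p z, ξ))))

theorem hasFDerivAt_pf (p : X →L[ℝ] E) (r : X →L[ℝ] F) (Φ : 𝓢(E × F, ℂ)) (z : X) (ξ : F) :
    HasFDerivAt (fun w : X => Complex.exp (↑(-2 * Real.pi * inner ℝ ξ (r w)) * Complex.I) •
      Φ (p w, ξ)) (pfDeriv p r Φ z ξ) z := by
  have h1 : HasFDerivAt (fun w : X => Φ (p w, ξ)) ((fderiv ℝ Φ (p z, ξ)).comp
      ((ContinuousLinearMap.inl ℝ E F).comp p)) z := by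
    refine (Φ.hasFDerivAt (p z, ξ)).comp z ?_
    have := (p.hasFDerivAt (x := z)).prodMk (hasFDerivAt_const ξ z)
    convert! this using 1
  have h2 : HasFDerivAt (fun w : X => ((inner ℝ ξ (r w) : ℝ) : ℂ))
      (Complex.ofRealCLM.comp ((innerSL ℝ ξ).comp r)) z :=
    (Complex.ofRealCLM.comp ((innerSL ℝ ξ).comp r)).hasFDerivAt
  have h3 := ((h2.const_mul (-2 * Real.pi : ℂ)).mul_const Complex.I).cexp
  have h4 := h3.smul h1
  convert! h4 using 1
  · ext w
    simp
  · ext w <;> simp [pfDeriv] <;> ring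

theorem integrable_bound (p : X →L[ℝ] E) (r : X →L[ℝ] F) (Φ : 𝓢(E × F, ℂ)) : ∃ bound : F → ℝ, Integrable bound ∧
    ∀ z ξ, ‖pfDeriv p r Φ z ξ‖ ≤ bound ξ := by
  let N := (volume : Measure F).integrablePower
  let K : ℝ := 2 ^ (N + 1) * (Finset.Iic (N + 1, 1)).sup
      (fun m => SchwartzMap.seminorm ℝ m.1 m.2) Φ
  refine ⟨fun ξ => (‖p‖ + 2 * Real.pi * ‖r‖) * K * (1 + ‖ξ‖) ^ (-(N : ℝ)),
    (Measure.integrable_pow_neg_integrablePower volume).const_mul _, fun z ξ => ?_⟩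
  have hz : ‖ξ‖ ≤ ‖(p z, ξ)‖ := norm_snd_le (p z, ξ)
  have hp : 0 < (1 + ‖ξ‖) ^ N := by positivity
  have e1 : (1 + ‖ξ‖) ^ N * ‖fderiv ℝ Φ (p z, ξ)‖ ≤ K := by
    rw [← norm_iteratedFDeriv_one]
    calc _ ≤ (1 + ‖(p z, ξ)‖) ^ (N + 1) * ‖iteratedFDeriv ℝ 1 Φ (p z, ξ)‖ := by
          gcongr
          calc (1 + ‖ξ‖) ^ N ≤ (1 + ‖(p z, ξ)‖) ^ N := by gcongr
            _ ≤ _ := pow_le_pow_right₀ (by linarith [norm_nonneg (p z, ξ)]) (by simp)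
      _ ≤ K := SchwartzMap.one_add_le_sup_seminorm_apply (𝕜 := ℝ) (m := (N + 1, 1)) le_rfl le_rfl _ _
  have e2 : (1 + ‖ξ‖) ^ N * (‖ξ‖ * ‖Φ (p z, ξ)‖) ≤ K := by
    calc _ ≤ (1 + ‖(p z, ξ)‖) ^ N * ((1 + ‖(p z, ξ)‖) * ‖iteratedFDeriv ℝ 0 Φ (p z, ξ)‖) := by
          rw [norm_iteratedFDeriv_zero]
          gcongr
          linarith
      _ = (1 + ‖(p z, ξ)‖) ^ (N + 1) * ‖iteratedFDeriv ℝ 0 Φ (p z, ξ)‖ := by ring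
      _ ≤ K := SchwartzMap.one_add_le_sup_seminorm_apply (𝕜 := ℝ) (m := (N + 1, 1)) le_rfl
        zero_le_one _ _
  have e3 : ‖pfDeriv p r Φ z ξ‖ ≤ ‖fderiv ℝ Φ (p z, ξ)‖ * ‖p‖ +
      2 * Real.pi * ((‖ξ‖ * ‖Φ (p z, ξ)‖) * ‖r‖) := by
    rw [pfDeriv, norm_smul, Complex.norm_exp_ofReal_mul_I, one_mul]
    refine (norm_add_le _ _).trans (add_le_add ?_ ?_)
    · refine (ContinuousLinearMap.opNorm_comp_le _ _).trans ?_
      gcongr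
      refine (ContinuousLinearMap.opNorm_comp_le _ _).trans ?_
      exact mul_le_of_le_one_left (norm_nonneg _) (ContinuousLinearMap.norm_inl_le_one ℝ E F)
    · rw [ContinuousLinearMap.norm_smulRight_apply]
      have h1 : ‖(innerSL ℝ ξ).comp r‖ ≤ ‖ξ‖ * ‖r‖ := by
        refine (ContinuousLinearMap.opNorm_comp_le _ _).trans ?_
        rw [innerSL_apply_norm]
      have h2 : ‖(-2 * Real.pi * Complex.I * Φ (p z, ξ) : ℂ)‖ = 2 * Real.pi * ‖Φ (p z, ξ)‖ := by
        simp [abs_of_pos Real.pi_pos]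
      rw [h2]
      calc _ ≤ ‖ξ‖ * ‖r‖ * (2 * Real.pi * ‖Φ (p z, ξ)‖) := by gcongr
        _ = _ := by ring
  refine e3.trans ?_
  beta_reduce
  rw [Real.rpow_neg (by positivity), Real.rpow_natCast, ← div_eq_mul_inv, le_div_iff₀ hp]
  calc _ = (1 + ‖ξ‖) ^ N * ‖fderiv ℝ Φ (p z, ξ)‖ * ‖p‖ +
        2 * Real.pi * ((1 + ‖ξ‖) ^ N * (‖ξ‖ * ‖Φ (p z, ξ)‖) * ‖r‖) := by ring
    _ ≤ K * ‖p‖ + 2 * Real.pi * (K * ‖r‖) := by gcongr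
    _ = _ := by ring

theorem hasFDerivAt_partialFourier (p : X →L[ℝ] E) (r : X →L[ℝ] F) (Φ : 𝓢(E × F, ℂ)) (z : X) :
    HasFDerivAt (fun w : X => 𝓕 (slice (p w) Φ) (r w)) (∫ ξ, pfDeriv p r Φ z ξ) z ∧
      ∀ v, (∫ ξ, pfDeriv p r Φ z ξ) v = ∫ ξ, pfDeriv p r Φ z ξ v := by
  obtain ⟨b, hb, h⟩ := integrable_bound p r Φ
  have hcont : Continuous (pfDeriv p r Φ z) := by
    have hf : Continuous (fderiv ℝ Φ) := (fderivCLM ℝ (E × F) ℂ Φ).continuous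
    have hΦ := Φ.continuous
    unfold pfDeriv
    have h1 : Continuous fun ξ : F => ContinuousLinearMap.smulRight
      ((innerSL ℝ ξ).comp r) (-2 * Real.pi * Complex.I * Φ (p z, ξ)) := by
      have := (ContinuousLinearMap.smulRightL ℝ X ℂ).continuous₂
      refine this.comp (f := fun ξ : F => ((innerSL ℝ ξ).comp r,
        (-2 * Real.pi * Complex.I * Φ (p z, ξ)))) ?_
      fun_prop
    have h2 : Continuous fun ξ : F => (fderiv ℝ Φ (p z, ξ)).comp
        ((ContinuousLinearMap.inl ℝ E F).comp p) := by
      fun_prop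
    have h3 : Continuous fun ξ : F =>
        Complex.exp (↑(-2 * Real.pi * inner ℝ ξ (r z)) * Complex.I) := by fun_prop
    exact h3.smul (h2.add h1)
  refine ⟨?_, fun v => (ContinuousLinearMap.integral_apply
    (hb.mono' hcont.aestronglyMeasurable (Filter.Eventually.of_forall (h z))) v).symm ▸ rfl⟩
  have key := hasFDerivAt_integral_of_dominated_of_fderiv_le (μ := (volume : Measure F)) (𝕜 := ℝ)
    (F := fun (w : X) ξ => Complex.exp (↑(-2 * Real.pi * inner ℝ ξ (r w)) * Complex.I) •
      Φ (p w, ξ)) (F' := pfDeriv p r Φ) (x₀ := z) (s := Set.univ) (bound := b) Filter.univ_mem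
    (Filter.Eventually.of_forall fun w => by
      have hΦ := Φ.continuous
      exact Continuous.aestronglyMeasurable (by fun_prop))
    (by
      have h1 : Integrable (slice (p z) Φ) := (slice (p z) Φ).integrable
      refine h1.mono ?_ (Filter.Eventually.of_forall fun ξ => ?_)
      · have hΦ := Φ.continuous
        exact Continuous.aestronglyMeasurable (by fun_prop)
      · rw [norm_smul, Complex.norm_exp_ofReal_mul_I, one_mul, slice_apply])
    hcont.aestronglyMeasurable
    (Filter.Eventually.of_forall fun ξ w _ => h w ξ) hb
    (Filter.Eventually.of_forall fun ξ w _ => hasFDerivAt_pf p r Φ w ξ)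
  convert! key using 1
  ext w
  rw [SchwartzMap.fourier_coe, Real.fourier_eq']
  simp

/-- The partial Fourier transform `(x, t) ↦ ∫ exp (-2 π i t · ξ) Φ (x, ξ) dξ` of a Schwartz
function in its second variable. -/
def partialFourier [FiniteDimensional ℝ E] : 𝓢(E × F, ℂ) →L[ℂ] 𝓢(E × F, ℂ) :=
  mkClosed (fun Φ z => 𝓕 (slice z.1 Φ) z.2) (fun f g z => by simp [FourierAdd.fourier_add])
    (fun a f z => by simp [FourierSMul.fourier_smul])
    (fun v => LineDeriv.lineDerivOpCLM ℂ 𝓢(E × F, ℂ) (v.1, (0 : F)) +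
      (-2 * Real.pi * Complex.I : ℂ) • SchwartzMap.smulLeftCLM ℂ
        (fun z : E × F => ((inner ℝ v.2 z.2 : ℝ) : ℂ)))
    (fun Φ z => by
      obtain ⟨h1, h2⟩ := hasFDerivAt_partialFourier (ContinuousLinearMap.fst ℝ E F)
        (ContinuousLinearMap.snd ℝ E F) Φ z
      refine ⟨_, h1, fun v => ?_⟩
      rw [h2, SchwartzMap.fourier_coe, Real.fourier_eq']
      congr 1
      ext ξ
      have hg : Function.HasTemperateGrowth (fun z : E × F => ((inner ℝ v.2 z.2 : ℝ) : ℂ)) :=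
        (Complex.ofRealCLM.comp ((innerSL ℝ v.2).comp
          (ContinuousLinearMap.snd ℝ E F))).hasTemperateGrowth
      simp [pfDeriv, SchwartzMap.smulLeftCLM_apply_apply hg,
        SchwartzMap.lineDerivOp_apply_eq_fderiv, real_inner_comm ξ v.2]
      ring)
    (fun k => by
      have hc : Continuous ((SchwartzMap.seminorm ℂ k 0).comp
          (SchwartzMap.fourierTransformCLM ℂ (V := F) (E := ℂ)).toLinearMap) :=
        ((schwartz_withSeminorms ℂ F ℂ).continuous_seminorm (k, 0)).comp
          (SchwartzMap.fourierTransformCLM ℂ (V := F) (E := ℂ)).continuous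
      have hc0 : Continuous ((SchwartzMap.seminorm ℂ 0 0).comp
          (SchwartzMap.fourierTransformCLM ℂ (V := F) (E := ℂ)).toLinearMap) :=
        ((schwartz_withSeminorms ℂ F ℂ).continuous_seminorm (0, 0)).comp
          (SchwartzMap.fourierTransformCLM ℂ (V := F) (E := ℂ)).continuous
      obtain ⟨q1, hq1, h1⟩ := slice_bound (E := E) 0 _ hc
      obtain ⟨q2, hq2, h2⟩ := slice_bound (E := E) k _ hc0
      refine ⟨q1 + q2, hq1.add hq2, fun Φ z => ?_⟩
      have e1 : ‖z.2‖ ^ k * ‖𝓕 (slice z.1 Φ) z.2‖ ≤ q1 Φ := by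
        have := h1 z.1 Φ
        rw [pow_zero, one_mul] at this
        refine le_trans ?_ this
        exact SchwartzMap.norm_pow_mul_le_seminorm ℂ (𝓕 (slice z.1 Φ)) k z.2
      have e2 : ‖z.1‖ ^ k * ‖𝓕 (slice z.1 Φ) z.2‖ ≤ q2 Φ := by
        refine le_trans ?_ (h2 z.1 Φ)
        gcongr
        exact SchwartzMap.norm_le_seminorm ℂ (𝓕 (slice z.1 Φ)) z.2
      have e3 : ‖z‖ ^ k ≤ ‖z.2‖ ^ k + ‖z.1‖ ^ k := by
        rcases max_choice ‖z.1‖ ‖z.2‖ with h | h <;> rw [Prod.norm_def, h]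
        · linarith [pow_nonneg (norm_nonneg z.2) k]
        · linarith [pow_nonneg (norm_nonneg z.1) k]
      calc _ ≤ (‖z.2‖ ^ k + ‖z.1‖ ^ k) * ‖𝓕 (slice z.1 Φ) z.2‖ := by gcongr
        _ ≤ q1 Φ + q2 Φ := by linarith
        _ = (q1 + q2) Φ := rfl)

@[simp] theorem partialFourier_apply [FiniteDimensional ℝ E] (Φ : 𝓢(E × F, ℂ)) (z : E × F) :
    partialFourier Φ z = 𝓕 (slice z.1 Φ) z.2 := rfl

end PartialFourier

/-- The Euclidean space `ℝᵈ`. -/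
abbrev Rd (d : ℕ) : Type := EuclideanSpace ℝ (Fin d)

variable {d : ℕ}

/-- Complex conjugation of Schwartz functions. -/
def conjS {E : Type} [NormedAddCommGroup E] [NormedSpace ℝ E] : 𝓢(E, ℂ) →L[ℝ] 𝓢(E, ℂ) :=
  SchwartzMap.postcompCLM (Complex.conjCLE : ℂ →L[ℝ] ℂ)

@[simp] theorem conjS_apply {E : Type} [NormedAddCommGroup E] [NormedSpace ℝ E] (φ : 𝓢(E, ℂ))
    (x : E) : conjS φ x = starRingEnd ℂ (φ x) := rfl

/-- The complex conjugate of a tempered distribution, `φ ↦ conj (f (conj φ))`. -/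
def conjDist (f : 𝓢'(Rd d, ℂ)) : 𝓢(Rd d, ℂ) →L[ℂ] ℂ where
  toFun φ := starRingEnd ℂ (f (conjS φ))
  map_add' φ ψ := by simp
  map_smul' a φ := by
    have : conjS (a • φ) = starRingEnd ℂ a • conjS φ := by
      ext x
      simp
    simp [this]
  cont := Complex.continuous_conj.comp (f.continuous.comp conjS.continuous)

theorem hasTemperateGrowth_cexp :
    Function.HasTemperateGrowth (fun s : ℝ => Complex.exp (s * Complex.I)) := by
  have h1 : ContDiff ℝ ∞ (fun s : ℝ => Complex.exp (s * Complex.I)) :=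
    (Complex.ofRealCLM.contDiff.mul contDiff_const).cexp
  have h2 : ∀ n : ℕ, iteratedDeriv n (fun s : ℝ => Complex.exp (s * Complex.I)) =
      fun s : ℝ => Complex.I ^ n * Complex.exp (s * Complex.I) := by
    intro n
    induction n with
    | zero => simp
    | succ n ih =>
      rw [iteratedDeriv_succ, ih]
      ext s
      have h3 : HasDerivAt (fun s : ℝ => Complex.exp (s * Complex.I))
          (Complex.exp (s * Complex.I) * (1 * Complex.I)) s :=
        (Complex.ofRealCLM.hasDerivAt.mul_const Complex.I).cexp
      rw [(h3.const_mul _).deriv]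
      ring
  refine ⟨h1, fun n => ⟨0, 1, fun s => ?_⟩⟩
  rw [norm_iteratedFDeriv_eq_norm_iteratedDeriv, h2]
  simp [Complex.norm_exp_ofReal_mul_I]

/-- The modulation `M_ξ g (t) = exp (2 π i t · ξ) g (t)` of a Schwartz function. -/
def modulation (ξ : Rd d) : 𝓢(Rd d, ℂ) →L[ℂ] 𝓢(Rd d, ℂ) :=
  SchwartzMap.smulLeftCLM ℂ
    (fun t : Rd d => Complex.exp (↑(2 * Real.pi * inner ℝ t ξ) * Complex.I))

theorem modulation_apply (ξ : Rd d) (g : 𝓢(Rd d, ℂ)) (t : Rd d) :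
    modulation ξ g t = Complex.exp (↑(2 * Real.pi * inner ℝ t ξ) * Complex.I) * g t := by
  have h : Function.HasTemperateGrowth
      (fun t : Rd d => Complex.exp (↑(2 * Real.pi * inner ℝ t ξ) * Complex.I)) :=
    hasTemperateGrowth_cexp.comp ((2 * Real.pi) • (innerSL ℝ).flip ξ).hasTemperateGrowth
  rw [modulation, SchwartzMap.smulLeftCLM_apply_apply h, smul_eq_mul]

/-- The short-time Fourier transform `V_g f (x, ξ) = ⟨f, M_ξ T_x g⟩` of a tempered distribution
`f` with Schwartz window `g`. The bracket extends the inner product of `L²`, so that it is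
antilinear in its second entry. -/
def stft (g : 𝓢(Rd d, ℂ)) (f : 𝓢'(Rd d, ℂ)) (x ξ : Rd d) : ℂ :=
  f (conjS (modulation ξ (SchwartzMap.compSubConstCLM ℂ x g)))

/-- The norm of `M^{p,q}(ℝᵈ)` with window `g`: the mixed norm of `V_g f`, namely the `L^p` norm in
`x` followed by the `L^q` norm in `ξ`. It is `∞` when `f` is not in `M^{p,q}(ℝᵈ)`. -/
def modulationNorm (g : 𝓢(Rd d, ℂ)) (p q : ℝ≥0∞) (f : 𝓢'(Rd d, ℂ)) : ℝ≥0∞ :=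
  eLpNorm (fun ξ : Rd d => eLpNorm (fun x : Rd d => stft g f x ξ) p volume) q volume

/-- The modulation space `M^{p,q}(ℝᵈ)` (described with the window `g`). -/
def modulationSpace (g : 𝓢(Rd d, ℂ)) (p q : ℝ≥0∞) : Set 𝓢'(Rd d, ℂ) :=
  {f | modulationNorm g p q f < ⊤}

/-- The linear change of variables `(u, v) ↦ (u - v, (u + v) / 2)`, with inverse
`(x, t) ↦ (t + x / 2, t - x / 2)`. -/
def changeVar : (Rd d × Rd d) ≃L[ℝ] (Rd d × Rd d) :=
  LinearEquiv.toContinuousLinearEquiv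
    { toFun := fun w => (w.1 - w.2, (1 / 2 : ℝ) • (w.1 + w.2))
      invFun := fun z => (z.2 + (1 / 2 : ℝ) • z.1, z.2 - (1 / 2 : ℝ) • z.1)
      map_add' := fun w w' => by ext <;> simp <;> ring
      map_smul' := fun a w => by ext <;> simp <;> ring
      left_inv := fun w => by ext <;> simp <;> ring
      right_inv := fun z => by ext <;> simp <;> ring }

/-- The cross-ambiguity function
`A(f₁, f₂)(x, ξ) = ∫ exp (-2 π i t · ξ) f₁ (t + x / 2) conj (f₂ (t - x / 2)) dt`
of two tempered distributions, as a tempered distribution on `ℝ²ᵈ`. Moving the partial Fourier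
transform and the change of variables `u = t + x / 2`, `v = t - x / 2` to the test function `Φ`,
it is the tensor product `f₁(u) ⊗ conj f₂(v)` evaluated at
`(u, v) ↦ ∫ exp (-2 π i ((u + v) / 2) · ξ) Φ (u - v, ξ) dξ`. -/
def ambiguity (f₁ f₂ : 𝓢'(Rd d, ℂ)) : 𝓢'(Rd d × Rd d, ℂ) :=
  PointwiseConvergenceCLM.precomp ℂ
    (partialPairing (conjDist f₂) ∘L SchwartzMap.compCLMOfContinuousLinearEquiv ℂ changeVar
      ∘L partialFourier) f₁

theorem ambiguity_apply (f₁ f₂ : 𝓢'(Rd d, ℂ)) (Φ : 𝓢(Rd d × Rd d, ℂ)) :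
    ambiguity f₁ f₂ Φ = f₁ (partialPairing (conjDist f₂)
      (SchwartzMap.compCLMOfContinuousLinearEquiv ℂ changeVar (partialFourier Φ))) := rfl

/-- For a Schwartz function, the short-time Fourier transform is the usual integral. -/
theorem stft_coe (g h : 𝓢(Rd d, ℂ)) (x ξ : Rd d) :
    stft g (h : 𝓢'(Rd d, ℂ)) x ξ =
      ∫ t, h t * starRingEnd ℂ (g (t - x)) * Complex.exp (-2 * Real.pi * Complex.I * inner ℝ t ξ) := by
  rw [stft, SchwartzMap.coe_apply]
  congr 1
  ext t
  simp only [conjS_apply, modulation_apply, map_mul, ← Complex.exp_conj, Complex.conj_ofReal,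
    Complex.conj_I, smul_eq_mul, compSubConstCLM_apply]
  rw [show (↑(2 * Real.pi * inner ℝ t ξ) * -Complex.I : ℂ) =
    -2 * Real.pi * Complex.I * inner ℝ t ξ by push_cast; ring]
  ring

/-- The integral formula for the cross-ambiguity function of two functions. -/
def ambiguityFun (h₁ h₂ : Rd d → ℂ) (z : Rd d × Rd d) : ℂ :=
  ∫ t, Complex.exp (-2 * Real.pi * Complex.I * inner ℝ t z.2) *
    (h₁ (t + (1 / 2 : ℝ) • z.1) * starRingEnd ℂ (h₂ (t - (1 / 2 : ℝ) • z.1)))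

theorem measurePreserving_changeVar : MeasurePreserving (changeVar (d := d)) volume volume := by
  have h1 : MeasurePreserving (fun z : Rd d × Rd d => (z.2, z.1 - z.2)) volume volume :=
    measurePreserving_prod_sub_swap volume volume
  have h2 : MeasurePreserving (Prod.swap : Rd d × Rd d → Rd d × Rd d) volume volume :=
    Measure.measurePreserving_swap
  have h3 : MeasurePreserving (fun z : Rd d × Rd d => (z.1, z.2 + (1 / 2 : ℝ) • z.1))
      volume volume := by
    refine (MeasurePreserving.id volume).skew_product
      (g := fun (x v : Rd d) => v + (1 / 2 : ℝ) • x) (by fun_prop) ?_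
    exact Filter.Eventually.of_forall fun x => (measurePreserving_add_right volume _).map_eq
  have h4 := h3.comp (h2.comp h1)
  convert h4 using 1
  ext z <;> simp [changeVar] <;> ring

theorem conjDist_coe (h φ : 𝓢(Rd d, ℂ)) :
    conjDist (h : 𝓢'(Rd d, ℂ)) φ = ∫ t, φ t * starRingEnd ℂ (h t) := by
  change starRingEnd ℂ ((h : 𝓢'(Rd d, ℂ)) (conjS φ)) = _
  rw [SchwartzMap.coe_apply, ← integral_conj]
  simp

/-- For Schwartz functions, the distributional cross-ambiguity function is given by the integral
formula. -/
theorem ambiguity_coe (h₁ h₂ : 𝓢(Rd d, ℂ)) (Φ : 𝓢(Rd d × Rd d, ℂ)) :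
    ambiguity (h₁ : 𝓢'(Rd d, ℂ)) (h₂ : 𝓢'(Rd d, ℂ)) Φ = ∫ z, Φ z * ambiguityFun h₁ h₂ z := by
  have hV : (volume : Measure (Rd d × Rd d)).IsAddHaarMeasure :=
    inferInstanceAs ((volume : Measure (Rd d)).prod (volume : Measure (Rd d))).IsAddHaarMeasure
  have hT : (volume : Measure (Rd d × Rd d)).HasTemperateGrowth :=
    Measure.IsAddHaarMeasure.instHasTemperateGrowth
  rw [ambiguity_apply, SchwartzMap.coe_apply]
  simp only [partialPairing_apply, conjDist_coe, slice_apply, smul_eq_mul,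
    compCLMOfContinuousLinearEquiv_apply, Function.comp_apply]
  have hb1 : ∀ t, ‖h₁ t‖ ≤ SchwartzMap.seminorm ℝ 0 0 h₁ := norm_le_seminorm ℝ h₁
  have hb2 : ∀ t, ‖h₂ t‖ ≤ SchwartzMap.seminorm ℝ 0 0 h₂ := norm_le_seminorm ℝ h₂
  have c1 := h₁.continuous
  have c2 := h₂.continuous
  let H : Rd d × Rd d → ℂ := fun z =>
    h₁ (z.2 + (1 / 2 : ℝ) • z.1) * starRingEnd ℂ (h₂ (z.2 - (1 / 2 : ℝ) • z.1))
  have cH : Continuous H := by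
    have := Complex.continuous_conj
    fun_prop
  have bH : ∀ z, ‖H z‖ ≤ SchwartzMap.seminorm ℝ 0 0 h₁ * SchwartzMap.seminorm ℝ 0 0 h₂ := by
    intro z
    simp only [H, norm_mul, RCLike.norm_conj]
    gcongr
    · exact hb1 _
    · exact hb2 _
  have iG : Integrable (fun z => partialFourier Φ z * H z) (volume : Measure (Rd d × Rd d)) :=
    (SchwartzMap.integrable _).mul_bdd cH.aestronglyMeasurable (Filter.Eventually.of_forall bH)
  have hcv : ∀ w : Rd d × Rd d, H (changeVar w) = h₁ w.1 * starRingEnd ℂ (h₂ w.2) := by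
    intro w
    have e1 : (1 / 2 : ℝ) • (w.1 + w.2) + (1 / 2 : ℝ) • (w.1 - w.2) = w.1 := by module
    have e2 : (1 / 2 : ℝ) • (w.1 + w.2) - (1 / 2 : ℝ) • (w.1 - w.2) = w.2 := by module
    change h₁ ((1 / 2 : ℝ) • (w.1 + w.2) + (1 / 2 : ℝ) • (w.1 - w.2)) *
      starRingEnd ℂ (h₂ ((1 / 2 : ℝ) • (w.1 + w.2) - (1 / 2 : ℝ) • (w.1 - w.2))) = _
    rw [e1, e2]
  have me : MeasurableEmbedding (changeVar (d := d)) :=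
    (changeVar (d := d)).toHomeomorph.measurableEmbedding
  have iW : Integrable (fun w => partialFourier Φ (changeVar w) * H (changeVar w))
      (volume : Measure (Rd d × Rd d)) :=
    (measurePreserving_changeVar.integrable_comp_emb me).2 iG
  have s1 : ∫ u, (∫ v, partialFourier Φ (changeVar (u, v)) * starRingEnd ℂ (h₂ v)) * h₁ u =
      ∫ w : Rd d × Rd d, partialFourier Φ (changeVar w) * H (changeVar w) := by
    rw [Measure.volume_eq_prod, integral_prod _ iW]
    congr 1
    ext u
    rw [← integral_mul_const]
    congr 1
    ext v
    rw [hcv]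
    ring
  rw [s1, measurePreserving_changeVar.integral_comp me (fun z => partialFourier Φ z * H z),
    show ∫ z, partialFourier Φ z * H z = ∫ x, ∫ t, partialFourier Φ (x, t) * H (x, t) from
      integral_prod _ iG]
  have iH : ∀ x, Integrable (fun t => H (x, t)) := by
    intro x
    have e : Integrable (fun t => h₁ (t + (1 / 2 : ℝ) • x)) :=
      (h₁.integrable (μ := volume)).comp_add_right _
    refine e.mul_bdd (c := SchwartzMap.seminorm ℝ 0 0 h₂) ?_ (Filter.Eventually.of_forall fun t => ?_)
    · have := Complex.continuous_conj
      exact Continuous.aestronglyMeasurable (by fun_prop)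
    · rw [RCLike.norm_conj]
      exact hb2 _
  have hA : ∀ x ξ, ambiguityFun h₁ h₂ (x, ξ) = 𝓕 (fun t => H (x, t)) ξ := by
    intro x ξ
    rw [Real.fourier_eq', ambiguityFun]
    congr 1
    ext t
    rw [smul_eq_mul]
    congr 2
    push_cast
    ring
  have iA : Integrable (fun z => Φ z * ambiguityFun h₁ h₂ z) (volume : Measure (Rd d × Rd d)) := by
    have cA : StronglyMeasurable (ambiguityFun (h₁ : Rd d → ℂ) h₂) := by
      have : Continuous fun y : (Rd d × Rd d) × Rd d =>
          Complex.exp (-2 * Real.pi * Complex.I * inner ℝ y.2 y.1.2) *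
          (h₁ (y.2 + (1 / 2 : ℝ) • y.1.1) * starRingEnd ℂ (h₂ (y.2 - (1 / 2 : ℝ) • y.1.1))) := by
        have := Complex.continuous_conj
        fun_prop
      exact this.stronglyMeasurable.integral_prod_right'
    refine (SchwartzMap.integrable Φ).mul_bdd
      (c := (∫ t, ‖h₁ t‖) * SchwartzMap.seminorm ℝ 0 0 h₂) cA.aestronglyMeasurable
      (Filter.Eventually.of_forall ?_)
    rintro ⟨x, ξ⟩
    rw [hA, Real.fourier_eq']
    refine (norm_integral_le_integral_norm _).trans ?_
    rw [← integral_add_right_eq_self (fun t => ‖h₁ t‖) ((1 / 2 : ℝ) • x), ← integral_mul_const]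
    refine integral_mono_of_nonneg (Filter.Eventually.of_forall fun t => norm_nonneg _)
      (((h₁.integrable (μ := volume)).comp_add_right _).norm.mul_const _)
      (Filter.Eventually.of_forall fun t => ?_)
    simp only [norm_smul, Complex.norm_exp_ofReal_mul_I, one_mul, H, norm_mul, RCLike.norm_conj]
    gcongr
    exact hb2 _
  have hr := integral_prod _ iA
  rw [← Measure.volume_eq_prod] at hr
  rw [hr]
  congr 1
  ext x
  have key := VectorFourier.integral_fourierIntegral_smul_eq_flip (L := innerₗ (Rd d))
    (μ := volume) (ν := volume) Real.continuous_fourierChar continuous_inner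
    ((slice x Φ).integrable (μ := volume)) (iH x)
  simp only [hA, partialFourier_apply, SchwartzMap.fourier_coe]
  rw [flip_innerₗ] at key
  exact key

end TimeFreq
end

open TimeFreq

/-!
Tested against Gaussian time-frequency atoms centred at `(z, ζ)`, the ambiguity function `A(f₁, f₂)`
factors, up to a unimodular factor, into a product of two Gaussian windowed transforms,
`V f₁ (w) * conj (V f₂ (w - z))`, where `(z, w)` is obtained from `(z, ζ)` by a linear change of
variables. With `s` the exponent conjugate to `q`, its `L^s` norm in `ζ` is therefore the `1/s`-th
power of a convolution, and Young's inequality for mixed norms, combined with the inclusions between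
modulation spaces, bounds the `L^q` norm in `z` of this `L^s` norm. As `s ≤ 2`, the Hausdorff–Young
inequality turns the inner `L^s` norms into `L^q` bounds for the localizations of `A(f₁, f₂)` by
translates of a Gaussian, and averaging over the translates glues these to a function in `L^q`.
-/

noncomputable section

namespace TimeFreq

section LpNorm

variable {α β : Type*} [MeasurableSpace α] [MeasurableSpace β] {μ : Measure α} {ν : Measure β}

theorem eLpNorm_top_eq_essSup (f : α → ℝ≥0∞) : eLpNorm f ⊤ μ = essSup f μ := by
  simp only [eLpNorm_exponent_top, eLpNormEssSup, enorm_eq_self]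

theorem eLpNorm_eq_lintegral_rpow {p : ℝ≥0∞} (h0 : p ≠ 0) (ht : p ≠ ⊤) (f : α → ℝ≥0∞) :
    eLpNorm f p μ = (∫⁻ x, f x ^ p.toReal ∂μ) ^ p.toReal⁻¹ := by
  simp only [eLpNorm_eq_lintegral_rpow_enorm_toReal h0 ht, enorm_eq_self, one_div]

theorem eLpNorm_rpow_toReal {p : ℝ≥0∞} (h0 : p ≠ 0) (ht : p ≠ ⊤) (f : α → ℝ≥0∞) :
    eLpNorm f p μ ^ p.toReal = ∫⁻ x, f x ^ p.toReal ∂μ := by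
  rw [eLpNorm_eq_lintegral_rpow h0 ht, ENNReal.rpow_inv_rpow (ENNReal.toReal_pos h0 ht).ne']

theorem eLpNorm_rpow (f : α → ℝ≥0∞) (p : ℝ≥0∞) {r : ℝ} (hr : 0 < r) :
    eLpNorm (fun x => f x ^ r) p μ = eLpNorm f (p * ENNReal.ofReal r) μ ^ r := by
  simpa only [enorm_eq_self] using eLpNorm_enorm_rpow (p := p) (μ := μ) f hr

theorem eLpNorm_const_mul {c : ℝ≥0∞} (hc : c ≠ ⊤) (f : α → ℝ≥0∞) (p : ℝ≥0∞) :
    eLpNorm (fun x => c * f x) p μ = c * eLpNorm f p μ := by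
  rcases eq_or_ne p 0 with rfl | h0
  · simp
  rcases eq_or_ne p ⊤ with rfl | ht
  · simp only [eLpNorm_top_eq_essSup, ENNReal.essSup_const_mul]
  have hp := ENNReal.toReal_pos h0 ht
  simp only [eLpNorm_eq_lintegral_rpow h0 ht, ENNReal.mul_rpow_of_nonneg _ _ hp.le]
  rw [lintegral_const_mul' _ _ (ENNReal.rpow_ne_top_of_nonneg hp.le hc),
    ENNReal.mul_rpow_of_nonneg _ _ (inv_nonneg.2 hp.le), ENNReal.rpow_rpow_inv hp.ne']

theorem eLpNorm_mono_ennreal {f g : α → ℝ≥0∞} (h : ∀ x, f x ≤ g x) (p : ℝ≥0∞) :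
    eLpNorm f p μ ≤ eLpNorm g p μ :=
  eLpNorm_mono_enorm fun x => by simpa only [enorm_eq_self] using h x

theorem eLpNorm_ne_zero_of_continuous {X F : Type*} [TopologicalSpace X] [MeasurableSpace X]
    [OpensMeasurableSpace X] {μ : Measure X} [μ.IsOpenPosMeasure] [NormedAddCommGroup F]
    [SecondCountableTopologyEither X F] {f : X → F} (hf : Continuous f) {x : X} (hx : f x ≠ 0)
    {p : ℝ≥0∞} (hp : p ≠ 0) : eLpNorm f p μ ≠ 0 := fun h =>
  hx (congrFun ((hf.ae_eq_iff_eq μ continuous_zero).1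
    ((eLpNorm_eq_zero_iff hf.aestronglyMeasurable hp).1 h)) x)

theorem essSup_le_iff {f : α → ℝ≥0∞} {c : ℝ≥0∞} : essSup f μ ≤ c ↔ ∀ᵐ x ∂μ, f x ≤ c :=
  ⟨fun h => (ENNReal.ae_le_essSup f).mono fun _ hx => hx.trans h, essSup_le_of_ae_le c⟩

theorem ae_lt_top_of_eLpNorm_ne_top {f : α → ℝ≥0∞} (hf : Measurable f) {p : ℝ≥0∞} (hp : p ≠ 0)
    (h : eLpNorm f p μ ≠ ⊤) : ∀ᵐ x ∂μ, f x < ⊤ := by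
  rcases eq_or_ne p ⊤ with rfl | ht
  · rw [eLpNorm_top_eq_essSup] at h
    filter_upwards [ENNReal.ae_le_essSup f] with x hx using hx.trans_lt h.lt_top
  · have hr := ENNReal.toReal_pos hp ht
    have hint : ∫⁻ x, f x ^ p.toReal ∂μ ≠ ⊤ :=
      eLpNorm_rpow_toReal hp ht f ▸ ENNReal.rpow_ne_top_of_nonneg hr.le h
    filter_upwards [ae_lt_top (hf.pow_const _) hint] with x hx
    exact (ENNReal.rpow_lt_top_iff_of_pos hr).1 hx

theorem lintegral_mul_le_essSup_mul (f : α → ℝ≥0∞) {g : α → ℝ≥0∞} (hg : AEMeasurable g μ) :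
    ∫⁻ x, f x * g x ∂μ ≤ essSup f μ * ∫⁻ x, g x ∂μ := by
  rw [← lintegral_const_mul'' _ hg]
  refine lintegral_mono_ae ?_
  filter_upwards [ENNReal.ae_le_essSup f] with x hx using mul_le_mul_left hx _

theorem lintegral_mul_le_eLpNorm_mul_eLpNorm {f g : α → ℝ≥0∞} (hf : AEMeasurable f μ)
    (hg : AEMeasurable g μ) (p q : ℝ≥0∞) [hpq : p.HolderConjugate q] :
    ∫⁻ x, f x * g x ∂μ ≤ eLpNorm f p μ * eLpNorm g q μ := by
  rcases eq_or_ne p ⊤ with rfl | hp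
  · obtain rfl : q = 1 := (ENNReal.HolderConjugate.eq_top_iff_eq_one ⊤ q).1 rfl
    rw [eLpNorm_one_eq_lintegral_enorm, eLpNorm_top_eq_essSup]
    exact lintegral_mul_le_essSup_mul f hg
  rcases eq_or_ne q ⊤ with rfl | hq
  · obtain rfl : p = 1 := (ENNReal.HolderConjugate.eq_top_iff_eq_one ⊤ p).1 rfl
    rw [eLpNorm_one_eq_lintegral_enorm, eLpNorm_top_eq_essSup, mul_comm]
    simp only [mul_comm (f _)]
    exact lintegral_mul_le_essSup_mul g hf
  have hp0 := ENNReal.HolderConjugate.ne_zero p q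
  have hq0 := ENNReal.HolderConjugate.ne_zero q p
  have hreal : p.toReal.HolderConjugate q.toReal := by
    refine ⟨?_, ENNReal.toReal_pos hp0 hp, ENNReal.toReal_pos hq0 hq⟩
    rw [← ENNReal.toReal_inv, ← ENNReal.toReal_inv, ← ENNReal.toReal_add
      (ENNReal.inv_ne_top.2 hp0) (ENNReal.inv_ne_top.2 hq0),
      ENNReal.HolderConjugate.inv_add_inv_eq_one p q, ENNReal.toReal_one, inv_one]
  rw [eLpNorm_eq_lintegral_rpow hp0 hp, eLpNorm_eq_lintegral_rpow hq0 hq, ← one_div, ← one_div]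
  exact ENNReal.lintegral_mul_le_Lp_mul_Lq μ hreal hf hg

theorem measurable_essSup_prodMk_left [SFinite μ] {f : β × α → ℝ≥0∞} (hf : Measurable f) :
    Measurable fun y => essSup (fun x => f (y, x)) μ := by
  refine measurable_of_Iic fun a => ?_
  have h : (fun y => essSup (fun x => f (y, x)) μ) ⁻¹' Set.Iic a =
      (fun y => μ (Prod.mk y ⁻¹' {w | a < f w})) ⁻¹' {0} := by
    ext y
    simp only [Set.mem_preimage, Set.mem_Iic, essSup_le_iff, ae_iff, not_le]
    rfl
  rw [h]
  exact measurable_measure_prodMk_left (measurableSet_lt measurable_const hf)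
    (measurableSet_singleton 0)

theorem measurable_eLpNorm_prodMk_left [SFinite μ] {f : β × α → ℝ≥0∞} (hf : Measurable f)
    (p : ℝ≥0∞) : Measurable fun y => eLpNorm (fun x => f (y, x)) p μ := by
  rcases eq_or_ne p 0 with rfl | h0
  · simp only [eLpNorm_exponent_zero, measurable_const]
  rcases eq_or_ne p ⊤ with rfl | ht
  · simpa only [eLpNorm_top_eq_essSup] using measurable_essSup_prodMk_left hf
  · simp only [eLpNorm_eq_lintegral_rpow h0 ht]
    exact (hf.pow_const _).lintegral_prod_right'.pow_const _

theorem measurable_eLpNorm_prodMk_right [SFinite μ] {f : α × β → ℝ≥0∞} (hf : Measurable f)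
    (p : ℝ≥0∞) : Measurable fun y => eLpNorm (fun x => f (x, y)) p μ :=
  measurable_eLpNorm_prodMk_left (hf.comp measurable_swap) p

theorem eLpNorm_prod_symm [SFinite μ] [SFinite ν] {f : α × β → ℝ≥0∞} (hf : Measurable f)
    {p : ℝ≥0∞} (hp : p ≠ 0) :
    eLpNorm f p (μ.prod ν) = eLpNorm (fun y => eLpNorm (fun x => f (x, y)) p μ) p ν := by
  rcases eq_or_ne p ⊤ with rfl | ht
  · simp only [eLpNorm_top_eq_essSup]
    refine eq_of_forall_ge_iff fun c => ?_
    have hm : MeasurableSet {z | f z ≤ c} := hf measurableSet_Iic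
    simp only [essSup_le_iff]
    rw [Measure.ae_prod_iff_ae_ae (p := fun z => f z ≤ c) hm]
    exact Measure.ae_ae_comm (p := fun x y => f (x, y) ≤ c) hm
  · have hr := ENNReal.toReal_pos hp ht
    simp only [eLpNorm_eq_lintegral_rpow hp ht, ENNReal.rpow_inv_rpow hr.ne']
    rw [lintegral_prod_symm' _ (hf.pow_const _)]

theorem eLpNorm_eLpNorm_comm [SFinite μ] [SFinite ν] {f : α × β → ℝ≥0∞} (hf : Measurable f)
    {p : ℝ≥0∞} (hp : p ≠ 0) :
    eLpNorm (fun x => eLpNorm (fun y => f (x, y)) p ν) p μ =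
      eLpNorm (fun y => eLpNorm (fun x => f (x, y)) p μ) p ν := by
  rw [← eLpNorm_prod_symm hf hp, ← eLpNorm_comp_measurePreserving hf.aestronglyMeasurable
    Measure.measurePreserving_swap]
  exact (eLpNorm_prod_symm (hf.comp measurable_swap) hp).symm

end LpNorm

section Minkowski

variable {α β : Type*} [MeasurableSpace α] [MeasurableSpace β] {μ : Measure α} {ν : Measure β}

/- Hölder's inequality for the factorization
`f = (f ^ r * c ^ (1 - r)) ^ (1 / r) * c ^ (1 - 1 / r)`. -/
theorem lintegral_rpow_le_lintegral_rpow_mul_weight {f c : β → ℝ≥0∞} (hf : Measurable f)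
    (hc : Measurable c) (hc0 : ∀ y, c y ≠ 0) (hct : ∀ᵐ y ∂ν, c y ≠ ⊤) {r : ℝ} (hr : 1 ≤ r) :
    (∫⁻ y, f y ∂ν) ^ r ≤ (∫⁻ y, f y ^ r * c y ^ (1 - r) ∂ν) * (∫⁻ y, c y ∂ν) ^ (r - 1) := by
  have hr0 : 0 < r := one_pos.trans_le hr
  have hfactor : ∫⁻ y, f y ∂ν = ∫⁻ y, (f y ^ r * c y ^ (1 - r)) ^ r⁻¹ * c y ^ (1 - r⁻¹) ∂ν := by
    refine lintegral_congr_ae ?_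
    filter_upwards [hct] with y hy
    have hexp : (1 - r) * r⁻¹ + (1 - r⁻¹) = 0 := by field_simp; ring
    rw [ENNReal.mul_rpow_of_nonneg _ _ (by positivity), ENNReal.rpow_rpow_inv hr0.ne',
      ← ENNReal.rpow_mul, mul_assoc, ← ENNReal.rpow_add _ _ (hc0 y) hy, hexp, ENNReal.rpow_zero,
      mul_one]
  calc (∫⁻ y, f y ∂ν) ^ r
      ≤ ((∫⁻ y, f y ^ r * c y ^ (1 - r) ∂ν) ^ r⁻¹ * (∫⁻ y, c y ∂ν) ^ (1 - r⁻¹)) ^ r := by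
        rw [hfactor]
        gcongr
        exact ENNReal.lintegral_mul_norm_pow_le ((hf.pow_const r).mul (hc.pow_const _)).aemeasurable
          hc.aemeasurable (by positivity) (sub_nonneg.2 (inv_le_one_of_one_le₀ hr)) (by ring)
    _ = _ := by
        have hexp : (1 - r⁻¹) * r = r - 1 := by field_simp
        rw [ENNReal.mul_rpow_of_nonneg _ _ hr0.le, ENNReal.rpow_inv_rpow hr0.ne',
          ← ENNReal.rpow_mul, hexp]

theorem lintegral_lintegral_rpow_le [SFinite μ] [SFinite ν] {f : β × α → ℝ≥0∞}
    (hf : Measurable f) {c : β → ℝ≥0∞} (hc : Measurable c) (hc0 : ∀ y, c y ≠ 0)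
    (hct : ∫⁻ y, c y ∂ν ≠ ⊤) {r : ℝ} (hr : 1 ≤ r)
    (hfc : ∀ y, ∫⁻ x, f (y, x) ^ r ∂μ ≤ c y ^ r) :
    ∫⁻ x, (∫⁻ y, f (y, x) ∂ν) ^ r ∂μ ≤ (∫⁻ y, c y ∂ν) ^ r := by
  have hfin : ∀ᵐ y ∂ν, c y ≠ ⊤ := (ae_lt_top hc hct).mono fun _ h => h.ne
  have hweight : Measurable fun z : β × α => f z ^ r * c z.1 ^ (1 - r) := by fun_prop
  have hdouble : ∫⁻ x, ∫⁻ y, f (y, x) ^ r * c y ^ (1 - r) ∂ν ∂μ ≤ ∫⁻ y, c y ∂ν := by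
    rw [lintegral_lintegral_swap (f := fun x y => f (y, x) ^ r * c y ^ (1 - r))
      (hweight.comp measurable_swap).aemeasurable]
    refine lintegral_mono_ae ?_
    filter_upwards [hfin] with y hy
    calc ∫⁻ x, f (y, x) ^ r * c y ^ (1 - r) ∂μ = (∫⁻ x, f (y, x) ^ r ∂μ) * c y ^ (1 - r) :=
          lintegral_mul_const _ (by fun_prop)
      _ ≤ c y ^ r * c y ^ (1 - r) := by gcongr; exact hfc y
      _ = c y := by rw [← ENNReal.rpow_add _ _ (hc0 y) hy, add_sub_cancel, ENNReal.rpow_one]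
  calc ∫⁻ x, (∫⁻ y, f (y, x) ∂ν) ^ r ∂μ
      ≤ ∫⁻ x, (∫⁻ y, f (y, x) ^ r * c y ^ (1 - r) ∂ν) * (∫⁻ y, c y ∂ν) ^ (r - 1) ∂μ :=
        lintegral_mono fun x => lintegral_rpow_le_lintegral_rpow_mul_weight
          (hf.comp measurable_prodMk_right) hc hc0 hfin hr
    _ = (∫⁻ x, ∫⁻ y, f (y, x) ^ r * c y ^ (1 - r) ∂ν ∂μ) * (∫⁻ y, c y ∂ν) ^ (r - 1) :=
        lintegral_mul_const _ (hweight.comp measurable_swap).lintegral_prod_right'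
    _ ≤ (∫⁻ y, c y ∂ν) ^ (1 : ℝ) * (∫⁻ y, c y ∂ν) ^ (r - 1) := by
        rw [ENNReal.rpow_one]
        gcongr
    _ = (∫⁻ y, c y ∂ν) ^ r := by
        rw [← ENNReal.rpow_add_of_nonneg _ _ one_pos.le (by linarith), add_sub_cancel]

theorem essSup_lintegral_le [SFinite μ] [SFinite ν] {f : β × α → ℝ≥0∞} (hf : Measurable f) :
    essSup (fun x => ∫⁻ y, f (y, x) ∂ν) μ ≤ ∫⁻ y, essSup (fun x => f (y, x)) μ ∂ν := by
  have hm := measurable_essSup_prodMk_left (μ := μ) hf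
  have hae : ∀ᵐ x ∂μ, ∀ᵐ y ∂ν, f (y, x) ≤ essSup (fun x => f (y, x)) μ := by
    rw [Measure.ae_ae_comm (p := fun x y => f (y, x) ≤ essSup (fun x => f (y, x)) μ)
      (measurableSet_le (hf.comp measurable_swap) (hm.comp measurable_snd))]
    exact .of_forall fun y => ENNReal.ae_le_essSup _
  exact essSup_le_of_ae_le _ (hae.mono fun x hx => lintegral_mono_ae hx)

theorem eLpNorm_lintegral_le [SFinite μ] [SigmaFinite ν] {f : β × α → ℝ≥0∞} (hf : Measurable f)
    {p : ℝ≥0∞} (hp : 1 ≤ p) :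
    eLpNorm (fun x => ∫⁻ y, f (y, x) ∂ν) p μ ≤ ∫⁻ y, eLpNorm (fun x => f (y, x)) p μ ∂ν := by
  rcases eq_or_ne p ⊤ with rfl | ht
  · simpa only [eLpNorm_top_eq_essSup] using essSup_lintegral_le hf
  have h0 : p ≠ 0 := (one_pos.trans_le hp).ne'
  have hr := ENNReal.toReal_pos h0 ht
  have hN := measurable_eLpNorm_prodMk_left (μ := μ) hf p
  rcases eq_or_ne (∫⁻ y, eLpNorm (fun x => f (y, x)) p μ ∂ν) ⊤ with hI | hI
  · exact hI ▸ le_top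
  refine ENNReal.le_of_forall_pos_le_add fun ε hε _ => ?_
  -- A small positive perturbation turns the norms of the sections into an admissible weight.
  obtain ⟨w, hw0, hwm, hw⟩ := exists_pos_lintegral_lt_of_sigmaFinite ν (ε := ε)
    (ENNReal.coe_ne_zero.2 hε.ne')
  let c : β → ℝ≥0∞ := fun y => eLpNorm (fun x => f (y, x)) p μ + w y
  have hc : ∫⁻ y, c y ∂ν ≤ ∫⁻ y, eLpNorm (fun x => f (y, x)) p μ ∂ν + ε := by
    rw [lintegral_add_left hN]
    gcongr
  have hcm : Measurable c := hN.add hwm.coe_nnreal_ennreal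
  refine le_trans ?_ hc
  rw [eLpNorm_eq_lintegral_rpow h0 ht, ENNReal.rpow_inv_le_iff hr]
  refine lintegral_lintegral_rpow_le hf hcm (fun y => ?_)
    (hc.trans_lt (ENNReal.add_lt_top.2 ⟨hI.lt_top, ENNReal.coe_lt_top⟩)).ne
    (ENNReal.toReal_one ▸ ENNReal.toReal_mono ht hp) fun y => ?_
  · simp only [c, ne_eq, add_eq_zero, ENNReal.coe_eq_zero, (hw0 y).ne', and_false,
      not_false_eq_true]
  · rw [← eLpNorm_rpow_toReal h0 ht]
    exact ENNReal.rpow_le_rpow le_self_add hr.le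

end Minkowski

section Young

variable {α : Type*} [MeasurableSpace α] {μ : Measure α}

theorem lintegral_mul_mul_rpow_le {u v w : α → ℝ≥0∞} (hu : AEMeasurable u μ)
    (hv : AEMeasurable v μ) (hw : AEMeasurable w μ) {a b c : ℝ} (ha : 0 ≤ a) (hb : 0 ≤ b)
    (hc : 0 ≤ c) (h : a + b + c = 1) :
    ∫⁻ x, u x ^ a * v x ^ b * w x ^ c ∂μ ≤
      (∫⁻ x, u x ∂μ) ^ a * (∫⁻ x, v x ∂μ) ^ b * (∫⁻ x, w x ∂μ) ^ c := by
  have key := ENNReal.lintegral_prod_norm_pow_le (μ := μ) Finset.univ (f := ![u, v, w])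
    (p := ![a, b, c]) (by simp [Fin.forall_fin_succ, hu, hv, hw])
    (by simp [Fin.sum_univ_three, h]) (by simp [Fin.forall_fin_succ, ha, hb, hc])
  simpa only [Fin.prod_univ_three, Matrix.cons_val] using key

theorem rpow_inv_mul_rpow_sub (u : ℝ≥0∞) {P R : ℝ} (hP : 0 < P) (hR : 0 < R) (hPR : R⁻¹ ≤ P⁻¹) :
    (u ^ P) ^ R⁻¹ * (u ^ P) ^ (P⁻¹ - R⁻¹) = u := by
  rw [← ENNReal.rpow_add_of_nonneg _ _ (inv_nonneg.2 hR.le) (sub_nonneg.2 hPR), add_sub_cancel,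
    ENNReal.rpow_rpow_inv hP.ne']

theorem mul_rpow_mul_sub (u : ℝ≥0∞) {P R : ℝ} (hR : 0 < R) (hPR : R⁻¹ ≤ P⁻¹) :
    u * u ^ ((P⁻¹ - R⁻¹) * R) = (u ^ P⁻¹) ^ R := by
  have hexp : 1 + (P⁻¹ - R⁻¹) * R = P⁻¹ * R := by field_simp; ring
  rw [← ENNReal.rpow_mul, ← hexp, ENNReal.rpow_add_of_nonneg _ _ one_pos.le
    (mul_nonneg (sub_nonneg.2 hPR) hR.le), ENNReal.rpow_one]

/- Hölder's inequality for the factorization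
`f * g = (f ^ P * g ^ Q) ^ (1 / R) * (f ^ P) ^ (1 / P - 1 / R) * (g ^ Q) ^ (1 / Q - 1 / R)`. -/
theorem rpow_lintegral_mul_le {f g : α → ℝ≥0∞} (hf : Measurable f) (hg : Measurable g)
    {P Q R : ℝ} (hP : 1 ≤ P) (hQ : 1 ≤ Q) (hR : 0 < R) (h : P⁻¹ + Q⁻¹ = 1 + R⁻¹) :
    (∫⁻ x, f x * g x ∂μ) ^ R ≤ (∫⁻ x, f x ^ P * g x ^ Q ∂μ) *
      ((∫⁻ x, f x ^ P ∂μ) ^ ((P⁻¹ - R⁻¹) * R) * (∫⁻ x, g x ^ Q ∂μ) ^ ((Q⁻¹ - R⁻¹) * R)) := by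
  have hPR : R⁻¹ ≤ P⁻¹ := by linarith [inv_le_one_of_one_le₀ hQ]
  have hQR : R⁻¹ ≤ Q⁻¹ := by linarith [inv_le_one_of_one_le₀ hP]
  have hfactor : ∀ x, f x * g x =
      (f x ^ P * g x ^ Q) ^ R⁻¹ * (f x ^ P) ^ (P⁻¹ - R⁻¹) * (g x ^ Q) ^ (Q⁻¹ - R⁻¹) := fun x => by
    conv_lhs => rw [← rpow_inv_mul_rpow_sub (f x) (by positivity) hR hPR,
      ← rpow_inv_mul_rpow_sub (g x) (by positivity) hR hQR]
    rw [ENNReal.mul_rpow_of_nonneg _ _ (inv_nonneg.2 hR.le)]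
    ring
  calc (∫⁻ x, f x * g x ∂μ) ^ R
      ≤ ((∫⁻ x, f x ^ P * g x ^ Q ∂μ) ^ R⁻¹ * (∫⁻ x, f x ^ P ∂μ) ^ (P⁻¹ - R⁻¹) *
          (∫⁻ x, g x ^ Q ∂μ) ^ (Q⁻¹ - R⁻¹)) ^ R := by
        simp only [hfactor]
        gcongr
        exact lintegral_mul_mul_rpow_le (by fun_prop) (by fun_prop) (by fun_prop)
          (inv_nonneg.2 hR.le) (sub_nonneg.2 hPR) (sub_nonneg.2 hQR) (by linarith)
    _ = _ := by
        simp only [ENNReal.mul_rpow_of_nonneg _ _ hR.le, ENNReal.rpow_inv_rpow hR.ne',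
          ← ENNReal.rpow_mul, mul_assoc]

variable {G : Type*} [AddCommGroup G] [MeasurableSpace G] [MeasurableAdd₂ G] [MeasurableNeg G]
  {κ : Measure G} [κ.IsAddLeftInvariant]

theorem measurePreserving_neg_add_const [κ.IsNegInvariant] (x : G) :
    MeasurePreserving (fun y => -y + x) κ κ := by
  simpa only [sub_eq_neg_add] using Measure.measurePreserving_sub_left κ x

variable [SFinite κ]

theorem lintegral_lconvolution {f g : G → ℝ≥0∞} (hf : Measurable f) (hg : Measurable g) :
    ∫⁻ x, (f ⋆ₗ[κ] g) x ∂κ = (∫⁻ x, f x ∂κ) * ∫⁻ x, g x ∂κ := by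
  simp only [lconvolution_def]
  rw [lintegral_lintegral_swap (by fun_prop), ← lintegral_mul_const _ hf]
  refine lintegral_congr fun y => ?_
  rw [lintegral_const_mul _ (by fun_prop), lintegral_add_left_eq_self g (-y)]

variable [κ.IsNegInvariant]

theorem lintegral_lconvolution_rpow_le {f g : G → ℝ≥0∞} (hf : Measurable f) (hg : Measurable g)
    {P Q R : ℝ} (hP : 1 ≤ P) (hQ : 1 ≤ Q) (hR : 0 < R) (h : P⁻¹ + Q⁻¹ = 1 + R⁻¹) :
    ∫⁻ x, (f ⋆ₗ[κ] g) x ^ R ∂κ ≤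
      ((∫⁻ x, f x ^ P ∂κ) ^ P⁻¹ * (∫⁻ x, g x ^ Q ∂κ) ^ Q⁻¹) ^ R := by
  have hPR : R⁻¹ ≤ P⁻¹ := by linarith [inv_le_one_of_one_le₀ hQ]
  have hQR : R⁻¹ ≤ Q⁻¹ := by linarith [inv_le_one_of_one_le₀ hP]
  set A := ∫⁻ x, f x ^ P ∂κ
  set B := ∫⁻ x, g x ^ Q ∂κ
  have htranslate : ∀ x, ∫⁻ y, g (-y + x) ^ Q ∂κ = B := fun x =>
    (measurePreserving_neg_add_const x).lintegral_comp (hg.pow_const Q)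
  have hpointwise : ∀ x, (f ⋆ₗ[κ] g) x ^ R ≤ ((fun y => f y ^ P) ⋆ₗ[κ] fun y => g y ^ Q) x *
      (A ^ ((P⁻¹ - R⁻¹) * R) * B ^ ((Q⁻¹ - R⁻¹) * R)) := fun x => by
    have := rpow_lintegral_mul_le (μ := κ) hf (g := fun y => g (-y + x)) (by fun_prop) hP hQ hR h
    rwa [htranslate] at this
  calc ∫⁻ x, (f ⋆ₗ[κ] g) x ^ R ∂κ
      ≤ A * B * (A ^ ((P⁻¹ - R⁻¹) * R) * B ^ ((Q⁻¹ - R⁻¹) * R)) := by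
        refine (lintegral_mono hpointwise).trans_eq ?_
        rw [lintegral_mul_const _ (measurable_lconvolution κ (hf.pow_const P) (hg.pow_const Q)),
          lintegral_lconvolution (hf.pow_const P) (hg.pow_const Q)]
    _ = (A * A ^ ((P⁻¹ - R⁻¹) * R)) * (B * B ^ ((Q⁻¹ - R⁻¹) * R)) := by ring
    _ = (A ^ P⁻¹ * B ^ Q⁻¹) ^ R := by
        rw [mul_rpow_mul_sub A hR hPR, mul_rpow_mul_sub B hR hQR,
          ← ENNReal.mul_rpow_of_nonneg _ _ hR.le]

theorem ne_top_of_inv_add_inv_eq {p q r : ℝ≥0∞} (hp : 1 ≤ p) (hr : r ≠ ⊤)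
    (h : p⁻¹ + q⁻¹ = 1 + r⁻¹) : q ≠ ⊤ := by
  rintro rfl
  rw [ENNReal.inv_top, add_zero] at h
  exact (ENNReal.inv_le_one.2 hp).not_gt
    (h ▸ ENNReal.lt_add_right ENNReal.one_ne_top (ENNReal.inv_ne_zero.2 hr))

theorem eLpNorm_lconvolution_le {f g : G → ℝ≥0∞} (hf : Measurable f) (hg : Measurable g)
    {p q r : ℝ≥0∞} (hp : 1 ≤ p) (hq : 1 ≤ q) (h : p⁻¹ + q⁻¹ = 1 + r⁻¹) :
    eLpNorm (f ⋆ₗ[κ] g) r κ ≤ eLpNorm f p κ * eLpNorm g q κ := by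
  have hp0 : p ≠ 0 := (one_pos.trans_le hp).ne'
  have hq0 : q ≠ 0 := (one_pos.trans_le hq).ne'
  rcases eq_or_ne r ⊤ with rfl | hr
  · have : p.HolderConjugate q := ENNReal.holderConjugate_iff.2 (by simpa using h)
    rw [eLpNorm_top_eq_essSup]
    refine essSup_le_of_ae_le _ (.of_forall fun x => ?_)
    refine (lintegral_mul_le_eLpNorm_mul_eLpNorm hf.aemeasurable (g := fun y => g (-y + x))
      (by fun_prop) p q).trans_eq ?_
    rw [← eLpNorm_comp_measurePreserving hg.aestronglyMeasurable
      (measurePreserving_neg_add_const x)]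
    rfl
  have hpt : p ≠ ⊤ := ne_top_of_inv_add_inv_eq hq hr (add_comm p⁻¹ _ ▸ h)
  have hqt : q ≠ ⊤ := ne_top_of_inv_add_inv_eq hp hr h
  have hpi : p⁻¹ ≠ ⊤ := ENNReal.inv_ne_top.2 hp0
  have hqi : q⁻¹ ≠ ⊤ := ENNReal.inv_ne_top.2 hq0
  have hr0 : r ≠ 0 := by
    rintro rfl
    rw [ENNReal.inv_zero, add_top] at h
    exact ENNReal.add_ne_top.2 ⟨hpi, hqi⟩ h
  have hreal : p.toReal⁻¹ + q.toReal⁻¹ = 1 + r.toReal⁻¹ := by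
    rw [← ENNReal.toReal_inv, ← ENNReal.toReal_inv, ← ENNReal.toReal_inv, ← ENNReal.toReal_one,
      ← ENNReal.toReal_add hpi hqi, h,
      ENNReal.toReal_add ENNReal.one_ne_top (ENNReal.inv_ne_top.2 hr0)]
  have hR := ENNReal.toReal_pos hr0 hr
  rw [eLpNorm_eq_lintegral_rpow hr0 hr, eLpNorm_eq_lintegral_rpow hp0 hpt,
    eLpNorm_eq_lintegral_rpow hq0 hqt, ENNReal.rpow_inv_le_iff hR]
  exact lintegral_lconvolution_rpow_le hf hg (ENNReal.toReal_one ▸ ENNReal.toReal_mono hpt hp)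
    (ENNReal.toReal_one ▸ ENNReal.toReal_mono hqt hq) hR hreal

end Young

section MixedNorm

variable {α β : Type*} [MeasurableSpace α] [MeasurableSpace β] {μ : Measure α} {ν : Measure β}

/-- The mixed norm `L^q_y L^p_x` of a nonnegative function of `(x, y)`: the `L^p` norm in the
first variable, followed by the `L^q` norm in the second one. -/
def mixedNorm (μ : Measure α) (ν : Measure β) (p q : ℝ≥0∞) (F : α × β → ℝ≥0∞) : ℝ≥0∞ :=
  eLpNorm (fun y => eLpNorm (fun x => F (x, y)) p μ) q ν

theorem mixedNorm_mono {F H : α × β → ℝ≥0∞} (h : ∀ z, F z ≤ H z) (p q : ℝ≥0∞) :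
    mixedNorm μ ν p q F ≤ mixedNorm μ ν p q H :=
  eLpNorm_mono_ennreal (fun y => eLpNorm_mono_ennreal (fun x => h (x, y)) p) q

theorem mixedNorm_const_mul {c : ℝ≥0∞} (hc : c ≠ ⊤) (F : α × β → ℝ≥0∞) (p q : ℝ≥0∞) :
    mixedNorm μ ν p q (fun z => c * F z) = c * mixedNorm μ ν p q F := by
  simp only [mixedNorm, eLpNorm_const_mul hc]

theorem mixedNorm_rpow (F : α × β → ℝ≥0∞) (p q : ℝ≥0∞) {r : ℝ} (hr : 0 < r) :
    mixedNorm μ ν p q (fun z => F z ^ r) =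
      mixedNorm μ ν (p * ENNReal.ofReal r) (q * ENNReal.ofReal r) F ^ r := by
  simp only [mixedNorm, eLpNorm_rpow _ _ hr]

theorem eLpNorm_prod_eq_mixedNorm [SFinite μ] [SFinite ν] {F : α × β → ℝ≥0∞} (hF : Measurable F)
    {p : ℝ≥0∞} (hp : p ≠ 0) : eLpNorm F p (μ.prod ν) = mixedNorm μ ν p p F :=
  eLpNorm_prod_symm hF hp

variable {G H : Type*} [AddCommGroup G] [MeasurableSpace G] [MeasurableNeg G]
  [AddCommGroup H] [MeasurableSpace H] [MeasurableNeg H]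
  {κ : Measure G} [SFinite κ] [κ.IsNegInvariant] {η : Measure H} [η.IsNegInvariant]

theorem mixedNorm_comp_neg {F : G × H → ℝ≥0∞} (hF : Measurable F) (p q : ℝ≥0∞) :
    mixedNorm κ η p q (fun z => F (-z)) = mixedNorm κ η p q F := by
  have hfst : ∀ y, eLpNorm (fun x => F (-x, y)) p κ = eLpNorm (fun x => F (x, y)) p κ := fun y =>
    eLpNorm_comp_measurePreserving (hF.comp measurable_prodMk_right).aestronglyMeasurable
      (Measure.measurePreserving_neg κ)
  have hsnd := eLpNorm_comp_measurePreserving (p := q)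
    (measurable_eLpNorm_prodMk_right (μ := κ) hF p).aestronglyMeasurable
    (Measure.measurePreserving_neg η)
  simpa only [mixedNorm, Prod.neg_mk, hfst, Function.comp_def] using hsnd

variable [MeasurableAdd₂ G] [MeasurableAdd₂ H] [κ.IsAddLeftInvariant] [SigmaFinite η]
  [η.IsAddLeftInvariant]

theorem mixedNorm_lconvolution_le {E F : G × H → ℝ≥0∞} (hE : Measurable E) (hF : Measurable F)
    {p₁ q₁ r₁ p₂ q₂ r₂ : ℝ≥0∞} (hp₁ : 1 ≤ p₁) (hq₁ : 1 ≤ q₁) (hr₁ : 1 ≤ r₁)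
    (h₁ : p₁⁻¹ + q₁⁻¹ = 1 + r₁⁻¹) (hp₂ : 1 ≤ p₂) (hq₂ : 1 ≤ q₂) (h₂ : p₂⁻¹ + q₂⁻¹ = 1 + r₂⁻¹) :
    mixedNorm κ η r₁ r₂ (E ⋆ₗ[κ.prod η] F) ≤ mixedNorm κ η p₁ p₂ E * mixedNorm κ η q₁ q₂ F := by
  let a : H → ℝ≥0∞ := fun y => eLpNorm (fun x => E (x, y)) p₁ κ
  let b : H → ℝ≥0∞ := fun y => eLpNorm (fun x => F (x, y)) q₁ κ
  have hsection : ∀ y, eLpNorm (fun x => (E ⋆ₗ[κ.prod η] F) (x, y)) r₁ κ ≤ (a ⋆ₗ[η] b) y := by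
    intro y
    have hfubini : ∀ x, (E ⋆ₗ[κ.prod η] F) (x, y) =
        ∫⁻ v, ∫⁻ u, E (u, v) * F (-u + x, -v + y) ∂κ ∂η := fun x =>
      lintegral_prod_symm' _ (hE.mul (hF.comp
        (by fun_prop : Measurable fun z : G × H => (-z.1 + x, -z.2 + y))))
    have hm : Measurable fun z : H × G =>
        ∫⁻ u, E (u, z.1) * F (-u + z.2, -z.1 + y) ∂κ :=
      Measurable.lintegral_prod_right' (f := fun w : (H × G) × G =>
        E (w.2, w.1.1) * F (-w.2 + w.1.2, -w.1.1 + y)) (by fun_prop)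
    calc eLpNorm (fun x => (E ⋆ₗ[κ.prod η] F) (x, y)) r₁ κ
        = eLpNorm (fun x => ∫⁻ v, ∫⁻ u, E (u, v) * F (-u + x, -v + y) ∂κ ∂η) r₁ κ := by
          simp only [hfubini]
      _ ≤ ∫⁻ v, eLpNorm (fun x => ∫⁻ u, E (u, v) * F (-u + x, -v + y) ∂κ) r₁ κ ∂η :=
          eLpNorm_lintegral_le hm hr₁
      _ ≤ ∫⁻ v, a v * b (-v + y) ∂η := lintegral_mono fun v =>
          eLpNorm_lconvolution_le (f := fun u => E (u, v)) (g := fun u => F (u, -v + y))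
            (by fun_prop) (by fun_prop) hp₁ hq₁ h₁
  exact (eLpNorm_mono_ennreal hsection r₂).trans
    (eLpNorm_lconvolution_le (measurable_eLpNorm_prodMk_right hE p₁)
      (measurable_eLpNorm_prodMk_right hF q₁) hp₂ hq₂ h₂)

end MixedNorm

section Translation

variable {X : Type} [NormedAddCommGroup X] [NormedSpace ℝ X]

theorem compSubConstCLM_neg_eq (w : X) (Φ : 𝓢(X, ℂ)) :
    compSubConstCLM ℝ (-w) Φ = Φ + ∂_{w} Φ + taylorRem w Φ := by
  rw [taylorRem]
  abel

theorem tendsto_taylorRem (Φ : 𝓢(X, ℂ)) :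
    Filter.Tendsto (fun w => taylorRem w Φ) (nhds 0) (nhds 0) := by
  rw [(schwartz_withSeminorms ℂ X ℂ).tendsto_nhds]
  intro i ε hε
  obtain ⟨C, -, hC⟩ := taylorRem_seminorm (schwartzSeminormFamily ℂ X ℂ i)
    ((schwartz_withSeminorms ℂ X ℂ).continuous_seminorm i) Φ
  have hlim : Filter.Tendsto (fun w : X => C * ‖w‖ ^ 2) (nhds 0) (nhds 0) := by
    simpa using (by fun_prop : Continuous fun w : X => C * ‖w‖ ^ 2).tendsto 0
  filter_upwards [Metric.closedBall_mem_nhds (0 : X) one_pos, hlim.eventually_lt_const hε]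
    with w hw hlt
  rw [sub_zero]
  exact (hC w (mem_closedBall_zero_iff.1 hw)).trans_lt hlt

theorem continuous_compSubConstCLM [FiniteDimensional ℝ X] (Φ : 𝓢(X, ℂ)) :
    Continuous fun w : X => compSubConstCLM ℝ w Φ := by
  have hzero : ∀ Ψ : 𝓢(X, ℂ), ContinuousAt (fun w : X => compSubConstCLM ℝ (-w) Ψ) 0 := by
    intro Ψ
    let D : X →ₗ[ℝ] 𝓢(X, ℂ) :=
      { toFun := fun w => ∂_{w} Ψ
        map_add' := fun v w => LineDeriv.lineDerivOp_left_add v w Ψ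
        map_smul' := fun a w => LineDeriv.lineDerivOp_left_smul a w Ψ }
    have hD : Filter.Tendsto (fun w : X => ∂_{w} Ψ) (nhds 0) (nhds 0) :=
      map_zero D ▸ D.continuous_of_finiteDimensional.tendsto 0
    have hlim := (tendsto_const_nhds (x := Ψ)).add hD |>.add (tendsto_taylorRem Ψ)
    simp only [ContinuousAt, neg_zero, compSubConstCLM_zero, ContinuousLinearMap.id_apply]
    simpa only [compSubConstCLM_neg_eq, add_zero] using hlim
  refine continuous_iff_continuousAt.2 fun w₀ => ?_
  have hcomp : (fun w => compSubConstCLM ℝ w Φ) =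
      (fun w => compSubConstCLM ℝ (-w) (compSubConstCLM ℝ w₀ Φ)) ∘ fun w => w₀ - w := by
    funext w
    rw [Function.comp_apply, compSubConstCLM_comp, neg_sub, add_sub_cancel]
  rw [hcomp]
  refine ContinuousAt.comp ?_ (by fun_prop)
  rw [sub_self]
  exact hzero _

theorem hasDerivAt_apply_compSubConstCLM (S : 𝓢(X, ℂ) →L[ℂ] ℂ) (Φ : 𝓢(X, ℂ)) (w : X) :
    HasDerivAt (fun t : ℝ => S (compSubConstCLM ℝ (-(t • w)) Φ)) (S (∂_{w} Φ)) 0 := by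
  obtain ⟨C, -, hC⟩ := taylorRem_seminorm ((normSeminorm ℂ ℂ).comp S.toLinearMap)
    (continuous_norm.comp S.continuous) Φ
  rw [hasDerivAt_iff_isLittleO_nhds_zero]
  refine Asymptotics.IsBigO.trans_isLittleO (g := fun t : ℝ => ‖t‖ ^ 2)
    (.of_bound (C * ‖w‖ ^ 2) ?_)
    (Asymptotics.isLittleO_norm_pow_id (E' := ℝ) one_lt_two)
  have hsmall : ∀ᶠ t : ℝ in nhds 0, ‖t • w‖ ≤ 1 :=
    ((by fun_prop : Continuous fun t : ℝ => ‖t • w‖).tendsto 0).eventually_le_const (by simp)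
  filter_upwards [hsmall] with t ht
  have hrem : S (compSubConstCLM ℝ (-((0 + t) • w)) Φ) - S (compSubConstCLM ℝ (-((0 : ℝ) • w)) Φ)
      - t • S (∂_{w} Φ) = S (taylorRem (t • w) Φ) := by
    rw [zero_add, zero_smul, neg_zero, compSubConstCLM_zero, ContinuousLinearMap.id_apply,
      compSubConstCLM_neg_eq, LineDeriv.lineDerivOp_left_smul, map_add, map_add,
      ← Complex.coe_smul t (∂_{w} Φ), map_smul, Complex.coe_smul]
    abel
  calc _ = ‖S (taylorRem (t • w) Φ)‖ := by rw [hrem]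
    _ ≤ C * ‖t • w‖ ^ 2 := hC _ ht
    _ = C * ‖w‖ ^ 2 * ‖‖t‖ ^ 2‖ := by rw [norm_smul, norm_pow, norm_norm]; ring

end Translation

section WeightedJet

variable {F : Type} [NormedAddCommGroup F] [NormedSpace ℝ F]

/-- The Banach space of bounded continuous functions on `F` with values in the `n`-linear forms,
a type synonym so that its normed structure is found directly. -/
def JetSpace (F : Type) [NormedAddCommGroup F] [NormedSpace ℝ F] (n : ℕ) : Type :=
  BoundedContinuousFunction F (F [×n]→L[ℝ] ℂ)

instance (n : ℕ) : NormedAddCommGroup (JetSpace F n) :=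
  inferInstanceAs (NormedAddCommGroup (BoundedContinuousFunction F (F [×n]→L[ℝ] ℂ)))

instance (n : ℕ) : NormedSpace ℂ (JetSpace F n) :=
  inferInstanceAs (NormedSpace ℂ (BoundedContinuousFunction F (F [×n]→L[ℝ] ℂ)))

instance (n : ℕ) : CompleteSpace (JetSpace F n) :=
  inferInstanceAs (CompleteSpace (BoundedContinuousFunction F (F [×n]→L[ℝ] ℂ)))

theorem JetSpace.norm_le {n : ℕ} {J : JetSpace F n} {C : ℝ} (hC : 0 ≤ C) :
    ‖J‖ ≤ C ↔ ∀ y, ‖J.toFun y‖ ≤ C :=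
  BoundedContinuousFunction.norm_le (f := (J : BoundedContinuousFunction F _)) hC

/-- Evaluation of a function in `JetSpace F n` at a point and at `n` vectors. -/
def JetSpace.eval {n : ℕ} (y : F) (m : Fin n → F) : JetSpace F n →L[ℂ] ℂ :=
  LinearMap.mkContinuous
    { toFun := fun J => J.toFun y m
      map_add' := fun _ _ => rfl
      map_smul' := fun _ _ => rfl }
    (∏ i, ‖m i‖) fun J => by
      calc ‖J.toFun y m‖ ≤ ‖J.toFun y‖ * ∏ i, ‖m i‖ := (J.toFun y).le_opNorm m
        _ ≤ ‖J‖ * ∏ i, ‖m i‖ := by gcongr; exact (JetSpace.norm_le (norm_nonneg J)).1 le_rfl y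
        _ = (∏ i, ‖m i‖) * ‖J‖ := mul_comm _ _

theorem JetSpace.ext {n : ℕ} {J K : JetSpace F n}
    (h : ∀ y m, JetSpace.eval y m J = JetSpace.eval y m K) : J = K :=
  BoundedContinuousFunction.ext fun y => ContinuousMultilinearMap.ext fun m => h y m

/-- The bounded continuous function `y ↦ ‖y‖ ^ k • Dⁿ φ y` attached to a Schwartz function `φ`; its
norm is the Schwartz seminorm of index `(k, n)`, so that Schwartz functions embed into a product of
Banach spaces of jets. -/
def weightedJet (k n : ℕ) : 𝓢(F, ℂ) →L[ℂ] JetSpace F n :=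
  mkCLMtoNormedSpace
    (fun φ => BoundedContinuousFunction.ofNormedAddCommGroup
      (fun y => (‖y‖ ^ k : ℝ) • iteratedFDeriv ℝ n φ y)
      ((continuous_norm.pow _).smul ((φ.smooth n).continuous_iteratedFDeriv le_rfl))
      (SchwartzMap.seminorm ℂ k n φ) fun y => by
        rw [norm_smul, norm_pow, norm_norm]
        exact SchwartzMap.le_seminorm ℂ k n φ y)
    (fun φ ψ => JetSpace.ext fun y m => by
      change ((‖y‖ ^ k : ℝ) • iteratedFDeriv ℝ n (φ + ψ : 𝓢(F, ℂ)) y) m =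
        ((‖y‖ ^ k : ℝ) • iteratedFDeriv ℝ n φ y + (‖y‖ ^ k : ℝ) • iteratedFDeriv ℝ n ψ y) m
      rw [FunLike.coe_add, iteratedFDeriv_add_apply (φ.smooth n).contDiffAt
        (ψ.smooth n).contDiffAt, smul_add])
    (fun a φ => JetSpace.ext fun y m => by
      change ((‖y‖ ^ k : ℝ) • iteratedFDeriv ℝ n (a • ⇑φ) y) m =
        (a • ((‖y‖ ^ k : ℝ) • iteratedFDeriv ℝ n φ y)) m
      rw [iteratedFDeriv_const_smul_apply (φ.smooth n).contDiffAt,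
        smul_comm])
    ⟨{(k, n)}, 1, zero_le_one, fun φ => by
      rw [one_mul, Finset.sup_singleton]
      exact BoundedContinuousFunction.norm_ofNormedAddCommGroup_le _ (apply_nonneg _ _) _⟩

theorem toFun_weightedJet (k n : ℕ) (φ : 𝓢(F, ℂ)) (y : F) :
    (weightedJet k n φ).toFun y = (‖y‖ ^ k : ℝ) • iteratedFDeriv ℝ n φ y := rfl

theorem norm_weightedJet (k n : ℕ) (φ : 𝓢(F, ℂ)) :
    ‖weightedJet k n φ‖ = SchwartzMap.seminorm ℂ k n φ := by
  refine le_antisymm ((JetSpace.norm_le (apply_nonneg _ _)).2 fun y => ?_)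
    (SchwartzMap.seminorm_le_bound ℂ k n φ (norm_nonneg (weightedJet k n φ)) fun y => ?_)
  · rw [toFun_weightedJet, norm_smul, norm_pow, norm_norm]
    exact SchwartzMap.le_seminorm ℂ k n φ y
  · have h := (JetSpace.norm_le (norm_nonneg (weightedJet k n φ))).1 le_rfl y
    rwa [toFun_weightedJet, norm_smul, norm_pow, norm_norm] at h

theorem weightedJet_zero_zero_injective :
    Function.Injective (weightedJet 0 0 : 𝓢(F, ℂ) → JetSpace F 0) := by
  refine (injective_iff_map_eq_zero _).2 fun φ hφ => ?_
  ext y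
  simpa [← norm_weightedJet, hφ] using SchwartzMap.norm_le_seminorm ℂ φ y

/- The Hahn–Banach theorem extends `T` from the image of the Schwartz space under finitely many
jets. -/
theorem exists_weightedJet_factor (T : 𝓢(F, ℂ) →L[ℂ] ℂ) : ∃ (s : Finset (ℕ × ℕ))
    (L : (∀ i : s, JetSpace F i.1.2) →L[ℂ] ℂ),
    ∀ φ, T φ = L fun i => weightedJet i.1.1 i.1.2 φ := by
  classical
  obtain ⟨s₀, C, -, hC⟩ := Seminorm.bound_of_continuous (schwartz_withSeminorms ℂ F ℂ)
    ((normSeminorm ℂ ℂ).comp T.toLinearMap) (continuous_norm.comp T.continuous)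
  let s := insert (0, 0) s₀
  let ι : 𝓢(F, ℂ) →ₗ[ℂ] (∀ i : s, JetSpace F i.1.2) :=
    LinearMap.pi fun i => (weightedJet i.1.1 i.1.2).toLinearMap
  have hι : Function.Injective ι := fun φ ψ h =>
    weightedJet_zero_zero_injective (congrFun h ⟨(0, 0), Finset.mem_insert_self _ _⟩)
  let e := LinearEquiv.ofInjective ι hι
  have hbound : ∀ w, ‖(T.toLinearMap ∘ₗ e.symm.toLinearMap) w‖ ≤ C * ‖w‖ := by
    intro w
    obtain ⟨φ, rfl⟩ := e.surjective w
    have hsup : s₀.sup (schwartzSeminormFamily ℂ F ℂ) φ ≤ ‖e φ‖ :=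
      Seminorm.finset_sup_apply_le (norm_nonneg _) fun i hi => (norm_weightedJet i.1 i.2 φ).ge.trans
        (norm_le_pi_norm (ι φ) ⟨i, Finset.mem_insert_of_mem hi⟩)
    calc ‖(T.toLinearMap ∘ₗ e.symm.toLinearMap) (e φ)‖ = ‖T φ‖ := by
          simp only [LinearMap.comp_apply, LinearEquiv.coe_coe, LinearEquiv.symm_apply_apply,
            ContinuousLinearMap.coe_coe]
      _ ≤ C * s₀.sup (schwartzSeminormFamily ℂ F ℂ) φ := hC φ
      _ ≤ C * ‖e φ‖ := by gcongr
  obtain ⟨L, hL, -⟩ := exists_extension_norm_eq (LinearMap.range ι)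
    (LinearMap.mkContinuous _ C hbound)
  refine ⟨s, L, fun φ => ?_⟩
  calc T φ = LinearMap.mkContinuous _ C hbound (e φ) := by
        simp only [LinearMap.mkContinuous_apply, LinearMap.comp_apply, LinearEquiv.coe_coe,
          LinearEquiv.symm_apply_apply, ContinuousLinearMap.coe_coe]
    _ = L (e φ) := (hL (e φ)).symm

end WeightedJet

section Fubini

variable {E F : Type} [NormedAddCommGroup E] [NormedSpace ℝ E] [NormedAddCommGroup F]
  [NormedSpace ℝ F]

theorem slice_add (x v : E) (Φ : 𝓢(E × F, ℂ)) :
    slice (x + v) Φ = slice x (compSubConstCLM ℝ (-(v, (0 : F))) Φ) := by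
  ext y
  simp

theorem lineDeriv_slice (Φ : 𝓢(E × F, ℂ)) (x : E) (v : F) :
    ∂_{v} (slice x Φ) = slice x (∂_{((0 : E), v)} Φ) := by
  ext y
  have hchain : HasFDerivAt (slice x Φ) ((fderiv ℝ Φ (x, y)).comp
      (ContinuousLinearMap.inr ℝ E F)) y :=
    (Φ.hasFDerivAt (x, y)).comp y (hasFDerivAt_prodMk_right x y)
  rw [SchwartzMap.lineDerivOp_apply_eq_fderiv, hchain.fderiv, slice_apply,
    SchwartzMap.lineDerivOp_apply_eq_fderiv, ContinuousLinearMap.comp_apply,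
    ContinuousLinearMap.inr_apply]

variable [FiniteDimensional ℝ E]

theorem partialPairing_lineDeriv (T : 𝓢(F, ℂ) →L[ℂ] ℂ) (Φ : 𝓢(E × F, ℂ)) (v : E) :
    ∂_{v} (partialPairing T Φ) = partialPairing T (∂_{(v, (0 : F))} Φ) := by
  ext x
  rw [SchwartzMap.lineDerivOp_apply]
  have h := hasDerivAt_apply_compSubConstCLM (T ∘L slice x) Φ (v, (0 : F))
  refine HasLineDerivAt.lineDeriv ?_
  simpa only [HasLineDerivAt, partialPairing_apply, slice_add, Prod.smul_mk, smul_zero,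
    ContinuousLinearMap.comp_apply] using h

variable [FiniteDimensional ℝ F]

theorem continuous_slice (Φ : 𝓢(E × F, ℂ)) : Continuous fun x : E => slice x Φ := by
  have h : ∀ x, slice x Φ = slice (0 : E) (compSubConstCLM ℝ (-(x, (0 : F))) Φ) := fun x => by
    rw [← slice_add, zero_add]
  simp only [h]
  exact (slice (0 : E)).continuous.comp ((continuous_compSubConstCLM Φ).comp (by fun_prop))

variable [MeasurableSpace E] [BorelSpace E]

/-- Integration of a Schwartz function of two variables in its first variable. -/
def integralFst (μ : Measure E) [μ.HasTemperateGrowth] : 𝓢(E × F, ℂ) →L[ℂ] 𝓢(F, ℂ) :=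
  partialPairing (integralCLM ℂ μ) ∘L
    compCLMOfContinuousLinearEquiv ℂ (ContinuousLinearEquiv.prodComm ℝ F E)

variable (μ : Measure E) [μ.HasTemperateGrowth]

theorem integralFst_apply (Φ : 𝓢(E × F, ℂ)) (y : F) :
    integralFst μ Φ y = ∫ x, Φ (x, y) ∂μ := rfl

theorem lineDeriv_integralFst (Φ : 𝓢(E × F, ℂ)) (v : F) :
    ∂_{v} (integralFst μ Φ) = integralFst μ (∂_{((0 : E), v)} Φ) := by
  simp only [integralFst, ContinuousLinearMap.comp_apply]
  rw [partialPairing_lineDeriv, SchwartzMap.lineDerivOp_compCLMOfContinuousLinearEquiv]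
  rfl

theorem exists_iteratedLineDeriv_integralFst (Φ : 𝓢(E × F, ℂ)) {n : ℕ} (m : Fin n → F) :
    ∃ Ψ : 𝓢(E × F, ℂ), ∂^{m} (integralFst μ Φ) = integralFst μ Ψ ∧
      ∀ x, ∂^{m} (slice x Φ) = slice x Ψ := by
  induction n with
  | zero => exact ⟨Φ, by simp, fun x => by simp⟩
  | succ n ih =>
    obtain ⟨Ψ, hint, hslice⟩ := ih (Fin.tail m)
    refine ⟨∂_{((0 : E), m 0)} Ψ, ?_, fun x => ?_⟩
    · rw [LineDeriv.iteratedLineDerivOp_succ_left, hint, lineDeriv_integralFst]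
    · rw [LineDeriv.iteratedLineDerivOp_succ_left, hslice, lineDeriv_slice]

theorem iteratedFDeriv_integralFst (Φ : 𝓢(E × F, ℂ)) (y : F) {n : ℕ} (m : Fin n → F) :
    iteratedFDeriv ℝ n (integralFst μ Φ) y m = ∫ x, iteratedFDeriv ℝ n (slice x Φ) y m ∂μ := by
  obtain ⟨Ψ, hint, hslice⟩ := exists_iteratedLineDeriv_integralFst μ Φ m
  simp only [← SchwartzMap.iteratedLineDerivOp_eq_iteratedFDeriv, hint, hslice, integralFst_apply,
    slice_apply]

theorem integrable_weightedJet_slice (Φ : 𝓢(E × F, ℂ)) (k n : ℕ) :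
    Integrable (fun x => weightedJet k n (slice x Φ)) μ := by
  have hmeas : AEStronglyMeasurable (fun x => weightedJet k n (slice x Φ)) μ :=
    ((weightedJet k n).continuous.comp (continuous_slice Φ)).aestronglyMeasurable
  have hcont : Continuous (SchwartzMap.seminorm ℂ k n : Seminorm ℂ 𝓢(F, ℂ)) :=
    (schwartz_withSeminorms ℂ F ℂ).continuous_seminorm (k, n)
  obtain ⟨q₀, -, h₀⟩ := slice_bound (E := E) 0 (SchwartzMap.seminorm ℂ k n) hcont
  obtain ⟨q₁, -, h₁⟩ := slice_bound (E := E) μ.integrablePower (SchwartzMap.seminorm ℂ k n) hcont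
  have h := integrable_of_le_of_pow_mul_le (k := 0) (C₁ := q₀ Φ) (C₂ := q₁ Φ)
    (fun x => by simpa only [norm_weightedJet, pow_zero, one_mul] using h₀ x Φ)
    (fun x => by simpa only [norm_weightedJet, zero_add] using h₁ x Φ) hmeas
  simp only [pow_zero, one_mul] at h
  exact (integrable_norm_iff hmeas).1 h

theorem integral_weightedJet_slice (Φ : 𝓢(E × F, ℂ)) (k n : ℕ) :
    ∫ x, weightedJet k n (slice x Φ) ∂μ = weightedJet k n (integralFst μ Φ) := by
  refine JetSpace.ext fun y m => ?_
  calc JetSpace.eval y m (∫ x, weightedJet k n (slice x Φ) ∂μ)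
      = ∫ x, (‖y‖ ^ k : ℝ) • iteratedFDeriv ℝ n (slice x Φ) y m ∂μ :=
        ((JetSpace.eval y m).integral_comp_comm (integrable_weightedJet_slice μ Φ k n)).symm
    _ = (‖y‖ ^ k : ℝ) • iteratedFDeriv ℝ n (integralFst μ Φ) y m := by
        rw [integral_smul, iteratedFDeriv_integralFst]

theorem distribution_integralFst (T : 𝓢(F, ℂ) →L[ℂ] ℂ) (Φ : 𝓢(E × F, ℂ)) :
    T (integralFst μ Φ) = ∫ x, T (slice x Φ) ∂μ := by
  obtain ⟨s, L, hL⟩ := exists_weightedJet_factor T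
  have hint : ∀ i : s, Integrable (fun x => weightedJet i.1.1 i.1.2 (slice x Φ)) μ :=
    fun i => integrable_weightedJet_slice μ Φ _ _
  simp only [hL]
  rw [L.integral_comp_comm (Integrable.of_eval hint)]
  congr 1
  ext1 i
  rw [MeasureTheory.eval_integral hint, integral_weightedJet_slice]

end Fubini

section Tensor

variable {E F : Type} [NormedAddCommGroup E] [NormedSpace ℝ E] [NormedAddCommGroup F]
  [NormedSpace ℝ F]

theorem norm_iteratedFDeriv_comp_le_of_norm_le_one (φ : 𝓢(F, ℂ)) (L : E →L[ℝ] F) (hL : ‖L‖ ≤ 1)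
    (n : ℕ) (x : E) :
    ‖iteratedFDeriv ℝ n (fun x => φ (L x)) x‖ ≤ ‖iteratedFDeriv ℝ n φ (L x)‖ := by
  change ‖iteratedFDeriv ℝ n (φ ∘ L) x‖ ≤ _
  rw [L.iteratedFDeriv_comp_right (φ.smooth n) x (i := n) le_rfl]
  exact (ContinuousMultilinearMap.norm_compContinuousLinearMap_le _ _).trans <|
    mul_le_of_le_one_right (norm_nonneg _) (Finset.prod_le_one (fun _ _ => norm_nonneg _)
      fun _ _ => hL)

theorem norm_iteratedFDeriv_tensor_le (φ : 𝓢(E, ℂ)) (ψ : 𝓢(F, ℂ)) (n : ℕ) (z : E × F) :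
    ‖iteratedFDeriv ℝ n (fun z : E × F => φ z.1 * ψ z.2) z‖ ≤
      ∑ i ∈ Finset.range (n + 1), (n.choose i : ℝ) *
        ‖iteratedFDeriv ℝ i φ z.1‖ * ‖iteratedFDeriv ℝ (n - i) ψ z.2‖ := by
  refine (norm_iteratedFDeriv_mul_le ((φ.smooth n).comp contDiff_fst)
    ((ψ.smooth n).comp contDiff_snd) z le_rfl).trans ?_
  gcongr
  · exact norm_iteratedFDeriv_comp_le_of_norm_le_one φ (.fst ℝ E F)
      (ContinuousLinearMap.norm_fst_le ..) _ z
  · exact norm_iteratedFDeriv_comp_le_of_norm_le_one ψ (.snd ℝ E F)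
      (ContinuousLinearMap.norm_snd_le ..) _ z

/-- The tensor product `(x, y) ↦ φ x * ψ y` of two Schwartz functions. -/
def tensor (φ : 𝓢(E, ℂ)) (ψ : 𝓢(F, ℂ)) : 𝓢(E × F, ℂ) where
  toFun z := φ z.1 * ψ z.2
  smooth' := (φ.smooth'.comp contDiff_fst).mul (ψ.smooth'.comp contDiff_snd)
  decay' k n := by
    refine ⟨∑ i ∈ Finset.range (n + 1), (n.choose i : ℝ) *
      (SchwartzMap.seminorm ℝ k i φ * SchwartzMap.seminorm ℝ 0 (n - i) ψ +
        SchwartzMap.seminorm ℝ 0 i φ * SchwartzMap.seminorm ℝ k (n - i) ψ), fun z => ?_⟩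
    have hpow : ‖z‖ ^ k ≤ ‖z.1‖ ^ k + ‖z.2‖ ^ k := by
      rcases max_choice ‖z.1‖ ‖z.2‖ with h | h <;> rw [Prod.norm_def, h]
      · exact le_add_of_nonneg_right (by positivity)
      · exact le_add_of_nonneg_left (by positivity)
    calc _ ≤ (‖z.1‖ ^ k + ‖z.2‖ ^ k) * ∑ i ∈ Finset.range (n + 1), (n.choose i : ℝ) *
          ‖iteratedFDeriv ℝ i φ z.1‖ * ‖iteratedFDeriv ℝ (n - i) ψ z.2‖ :=
          mul_le_mul hpow (norm_iteratedFDeriv_tensor_le φ ψ n z) (norm_nonneg _) (by positivity)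
      _ = ∑ i ∈ Finset.range (n + 1), (n.choose i : ℝ) *
            ((‖z.1‖ ^ k * ‖iteratedFDeriv ℝ i φ z.1‖) * ‖iteratedFDeriv ℝ (n - i) ψ z.2‖ +
              ‖iteratedFDeriv ℝ i φ z.1‖ * (‖z.2‖ ^ k * ‖iteratedFDeriv ℝ (n - i) ψ z.2‖)) := by
          rw [Finset.mul_sum]
          exact Finset.sum_congr rfl fun i _ => by ring
      _ ≤ _ := by
          gcongr
          · exact SchwartzMap.le_seminorm ℝ k _ φ z.1
          · exact SchwartzMap.norm_iteratedFDeriv_le_seminorm ℝ ψ _ z.2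
          · exact SchwartzMap.norm_iteratedFDeriv_le_seminorm ℝ φ _ z.1
          · exact SchwartzMap.le_seminorm ℝ k _ ψ z.2

@[simp] theorem tensor_apply (φ : 𝓢(E, ℂ)) (ψ : 𝓢(F, ℂ)) (z : E × F) :
    tensor φ ψ z = φ z.1 * ψ z.2 := rfl

end Tensor

section Gaussian

variable {H : Type} [NormedAddCommGroup H] [InnerProductSpace ℝ H]

theorem one_add_pow_mul_exp_neg_mul_sq_le {a t : ℝ} (ha : 0 < a) (ht : 0 ≤ t) (n : ℕ) :
    (1 + t) ^ n * Real.exp (-a * t ^ 2) ≤ n.factorial * Real.exp (1 + 1 / (4 * a)) := by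
  have hpow : (1 + t) ^ n ≤ n.factorial * Real.exp (1 + t) := by
    have h := Real.pow_div_factorial_le_exp (1 + t) (by positivity) n
    rwa [div_le_iff₀' (by positivity)] at h
  have hsq : (1 + t) + -a * t ^ 2 ≤ 1 + 1 / (4 * a) := by
    have h : 1 / (4 * a) - (t + -a * t ^ 2) = a * (t - 1 / (2 * a)) ^ 2 := by
      field_simp
      ring
    linarith [mul_nonneg ha.le (sq_nonneg (t - 1 / (2 * a)))]
  calc (1 + t) ^ n * Real.exp (-a * t ^ 2)
      ≤ n.factorial * Real.exp (1 + t) * Real.exp (-a * t ^ 2) := by gcongr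
    _ = n.factorial * Real.exp ((1 + t) + -a * t ^ 2) := by rw [mul_assoc, ← Real.exp_add]
    _ ≤ _ := by gcongr

theorem exists_norm_iteratedFDeriv_exp_comp_le {X : Type} [NormedAddCommGroup X] [NormedSpace ℝ X]
    {f : X → ℝ} (hf : f.HasTemperateGrowth) (n : ℕ) :
    ∃ (k : ℕ) (C : ℝ), 0 ≤ C ∧ ∀ x, ‖iteratedFDeriv ℝ n (fun x => Real.exp (f x)) x‖ ≤
      C * (1 + ‖x‖) ^ k * Real.exp (f x) := by
  obtain ⟨k, C, hC, hbound⟩ := hf.norm_iteratedFDeriv_le_uniform n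
  refine ⟨k * n, n.factorial * (1 + C) ^ n, by positivity, fun x => ?_⟩
  have hexp : ∀ i ≤ n, ‖iteratedFDeriv ℝ i Real.exp (f x)‖ ≤ Real.exp (f x) := fun i _ => by
    rw [norm_iteratedFDeriv_eq_norm_iteratedDeriv, iteratedDeriv_eq_iterate, Real.iter_deriv_exp,
      Real.norm_of_nonneg (Real.exp_pos _).le]
  have hpow : ∀ i, 1 ≤ i → i ≤ n →
      ‖iteratedFDeriv ℝ i f x‖ ≤ ((1 + C) * (1 + ‖x‖) ^ k) ^ i := fun i hi hin =>
    calc ‖iteratedFDeriv ℝ i f x‖ ≤ C * (1 + ‖x‖) ^ k := hbound i hin x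
      _ ≤ (1 + C) * (1 + ‖x‖) ^ k := by gcongr; exact le_add_of_nonneg_left zero_le_one
      _ ≤ ((1 + C) * (1 + ‖x‖) ^ k) ^ i := le_self_pow₀
          (one_le_mul_of_one_le_of_one_le (le_add_of_nonneg_right hC)
            (one_le_pow₀ (le_add_of_nonneg_right (norm_nonneg x)))) (by lia)
  calc ‖iteratedFDeriv ℝ n (Real.exp ∘ f) x‖
      ≤ n.factorial * Real.exp (f x) * ((1 + C) * (1 + ‖x‖) ^ k) ^ n :=
        norm_iteratedFDeriv_comp_le (N := ∞) Real.contDiff_exp hf.1 (mod_cast le_top) x hexp hpow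
    _ = n.factorial * (1 + C) ^ n * (1 + ‖x‖) ^ (k * n) * Real.exp (f x) := by
        rw [mul_pow, pow_mul]
        ring

/-- The Gaussian `x ↦ exp (-a ‖x‖²)` as a complex-valued Schwartz function. -/
def gaussian (a : ℝ) (ha : 0 < a) : 𝓢(H, ℂ) :=
  postcompCLM Complex.ofRealCLM
    { toFun := fun x => Real.exp (-a * ‖x‖ ^ 2)
      smooth' := (contDiff_const.mul (contDiff_norm_sq ℝ)).exp
      decay' := fun k n => by
        obtain ⟨l, C, hC, hbound⟩ := exists_norm_iteratedFDeriv_exp_comp_le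
          ((Function.HasTemperateGrowth.const (-a)).mul (Function.hasTemperateGrowth_norm_sq H)) n
        refine ⟨C * ((k + l).factorial * Real.exp (1 + 1 / (4 * a))), fun x => ?_⟩
        calc _ ≤ (1 + ‖x‖) ^ k * (C * (1 + ‖x‖) ^ l * Real.exp (-a * ‖x‖ ^ 2)) := by
              gcongr
              · exact le_add_of_nonneg_left zero_le_one
              · exact hbound x
          _ = C * ((1 + ‖x‖) ^ (k + l) * Real.exp (-a * ‖x‖ ^ 2)) := by ring
          _ ≤ _ := by
              gcongr ?_ * ?_
              exact one_add_pow_mul_exp_neg_mul_sq_le ha (norm_nonneg x) _ }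

@[simp] theorem gaussian_apply (a : ℝ) (ha : 0 < a) (x : H) :
    gaussian a ha x = Complex.exp (↑(-a * ‖x‖ ^ 2)) :=
  Complex.ofReal_exp _

end Gaussian

section ShortTimeFourier

instance (d : ℕ) : (volume : Measure (Rd d × Rd d)).IsAddHaarMeasure :=
  inferInstanceAs ((volume : Measure (Rd d)).prod (volume : Measure (Rd d))).IsAddHaarMeasure

instance (d : ℕ) : (volume : Measure (Rd d × Rd d)).HasTemperateGrowth :=
  Measure.IsAddHaarMeasure.instHasTemperateGrowth

theorem hasTemperateGrowth_cexp_inner {X Y : Type} [NormedAddCommGroup X] [NormedSpace ℝ X]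
    [NormedAddCommGroup Y] [InnerProductSpace ℝ Y] (A B : X →L[ℝ] Y) (c : ℝ) :
    (fun w : X => Complex.exp (↑(c * inner ℝ (A w) (B w)) * Complex.I)).HasTemperateGrowth :=
  hasTemperateGrowth_cexp.comp ((Function.HasTemperateGrowth.const c).mul
    ((innerSL ℝ).bilinear_hasTemperateGrowth A.hasTemperateGrowth B.hasTemperateGrowth))

/-- A tempered distribution as a continuous linear functional. -/
def toCLM {E : Type} [NormedAddCommGroup E] [NormedSpace ℝ E] (f : 𝓢'(E, ℂ)) :
    𝓢(E, ℂ) →L[ℂ] ℂ where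
  toFun := f
  map_add' := map_add f
  map_smul' := map_smul f
  cont := f.continuous

@[simp] theorem toCLM_apply {E : Type} [NormedAddCommGroup E] [NormedSpace ℝ E] (f : 𝓢'(E, ℂ))
    (φ : 𝓢(E, ℂ)) : toCLM f φ = f φ := rfl

variable {d : ℕ}

/-- The conjugated time-frequency shift `t ↦ conj (g (t - x)) exp (-2 π i t · ξ)` of `g`, against
which a distribution is tested to compute its short-time Fourier transform at `z = (x, ξ)`. -/
def window (g : 𝓢(Rd d, ℂ)) (z : Rd d × Rd d) : 𝓢(Rd d, ℂ) :=
  conjS (modulation z.2 (compSubConstCLM ℂ z.1 g))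

theorem stft_eq_apply_window (g : 𝓢(Rd d, ℂ)) (f : 𝓢'(Rd d, ℂ)) (z : Rd d × Rd d) :
    stft g f z.1 z.2 = f (window g z) := rfl

theorem window_apply (g : 𝓢(Rd d, ℂ)) (z : Rd d × Rd d) (t : Rd d) :
    window g z t = starRingEnd ℂ (g (t - z.1)) *
      Complex.exp (↑(-2 * Real.pi * inner ℝ t z.2) * Complex.I) := by
  simp only [window, conjS_apply, modulation_apply, map_mul, ← Complex.exp_conj,
    Complex.conj_ofReal, Complex.conj_I, compSubConstCLM_apply]
  rw [mul_comm]
  congr 2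
  push_cast
  ring

/-- The Schwartz function `((x, ξ), t) ↦ H (x, ξ) conj (g (t - x)) exp (-2 π i t · ξ)`: a weighted
superposition of the windows `window g (x, ξ)`. -/
def windowKernel (H : 𝓢(Rd d × Rd d, ℂ)) (g : 𝓢(Rd d, ℂ)) : 𝓢((Rd d × Rd d) × Rd d, ℂ) :=
  let fst := ContinuousLinearMap.fst ℝ (Rd d × Rd d) (Rd d)
  let snd := ContinuousLinearMap.snd ℝ (Rd d × Rd d) (Rd d)
  smulLeftCLM ℂ
    (fun w => Complex.exp
      (↑(-2 * Real.pi * inner ℝ (snd w) ((.snd ℝ (Rd d) (Rd d) ∘L fst) w)) * Complex.I))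
    (compCLMOfContinuousLinearEquiv ℂ
      (ContinuousLinearEquiv.skewProd (.refl ℝ (Rd d × Rd d)) (.refl ℝ (Rd d))
        (-.fst ℝ (Rd d) (Rd d)))
      (tensor H (conjS g)))

theorem slice_windowKernel (H : 𝓢(Rd d × Rd d, ℂ)) (g : 𝓢(Rd d, ℂ)) (z : Rd d × Rd d) :
    slice z (windowKernel H g) = H z • window g z := by
  ext t
  rw [slice_apply, windowKernel, smulLeftCLM_apply_apply (hasTemperateGrowth_cexp_inner _ _ _),
    smul_apply, window_apply]
  simp [← sub_eq_add_neg]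
  ring

theorem windowKernel_apply (H : 𝓢(Rd d × Rd d, ℂ)) (g : 𝓢(Rd d, ℂ)) (z : Rd d × Rd d) (t : Rd d) :
    windowKernel H g (z, t) = H z * window g z t :=
  DFunLike.congr_fun (slice_windowKernel H g z) t

theorem continuous_stft (g : 𝓢(Rd d, ℂ)) (f : 𝓢'(Rd d, ℂ)) :
    Continuous fun z : Rd d × Rd d => stft g f z.1 z.2 := by
  let G : 𝓢(Rd d × Rd d, ℂ) := tensor (gaussian 1 one_pos) (gaussian 1 one_pos)
  have hG : ∀ z, G z ≠ 0 := fun z => by simp [G]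
  have hstft : (fun z : Rd d × Rd d => stft g f z.1 z.2) =
      fun z => partialPairing (toCLM f) (windowKernel G g) z / G z := by
    ext z
    rw [partialPairing_apply, slice_windowKernel, map_smul, smul_eq_mul,
      mul_div_cancel_left₀ _ (hG z), toCLM_apply, stft_eq_apply_window]
  rw [hstft]
  exact (SchwartzMap.continuous _).div G.continuous hG

/-- The Schwartz function `(x, s) ↦ ψ s * g (s - x)`. -/
def shiftedProduct (ψ g : 𝓢(Rd d, ℂ)) : 𝓢(Rd d × Rd d, ℂ) :=
  compCLMOfContinuousLinearEquiv ℂ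
    ((ContinuousLinearEquiv.prodComm ℝ (Rd d) (Rd d)).trans
      (ContinuousLinearEquiv.skewProd (.refl ℝ (Rd d)) (.neg ℝ) (.id ℝ (Rd d))))
    (tensor ψ g)

theorem shiftedProduct_apply (ψ g : 𝓢(Rd d, ℂ)) (x s : Rd d) :
    shiftedProduct ψ g (x, s) = ψ s * g (s - x) := by
  simp [shiftedProduct, neg_add_eq_sub]

/-- The Schwartz function `(x, ξ) ↦ ∫ ψ s * g (s - x) * exp (2 π i s · ξ) ds`: the coefficients with
which `ψ` is synthesized from the windows of `g`. -/
def windowCoeff (ψ g : 𝓢(Rd d, ℂ)) : 𝓢(Rd d × Rd d, ℂ) :=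
  compCLMOfContinuousLinearEquiv ℂ
    ((ContinuousLinearEquiv.refl ℝ (Rd d)).prodCongr (ContinuousLinearEquiv.neg ℝ))
    (partialFourier (shiftedProduct ψ g))

theorem windowCoeff_eq_fourier (ψ g : 𝓢(Rd d, ℂ)) (x ξ : Rd d) :
    windowCoeff ψ g (x, ξ) = 𝓕 (slice x (shiftedProduct ψ g)) (-ξ) := rfl

theorem windowCoeff_apply (ψ g : 𝓢(Rd d, ℂ)) (z : Rd d × Rd d) :
    windowCoeff ψ g z = ∫ s, ψ s * g (s - z.1) *
      Complex.exp (↑(2 * Real.pi * inner ℝ s z.2) * Complex.I) := by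
  obtain ⟨x, ξ⟩ := z
  rw [windowCoeff_eq_fourier, SchwartzMap.fourier_coe, Real.fourier_eq']
  congr with s
  rw [slice_apply, shiftedProduct_apply, smul_eq_mul, inner_neg_right, mul_neg, ← neg_mul,
    ← neg_mul, neg_neg, mul_comm]

theorem window_add_mul_cexp (φ : 𝓢(Rd d, ℂ)) (w : Rd d × Rd d) (s ξ : Rd d) :
    window φ w (s + w.1) * Complex.exp (↑(2 * Real.pi * inner ℝ (s + w.1) ξ) * Complex.I) =
      Complex.exp (↑(2 * Real.pi * inner ℝ w.1 (ξ - w.2)) * Complex.I) *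
        (window φ 0 s * Complex.exp (↑(2 * Real.pi * inner ℝ s (ξ - w.2)) * Complex.I)) := by
  simp only [window_apply, add_sub_cancel_right, Prod.fst_zero, sub_zero, Prod.snd_zero,
    inner_zero_right, mul_zero, Complex.ofReal_zero, zero_mul, Complex.exp_zero, mul_one,
    mul_assoc, mul_left_comm _ (starRingEnd ℂ (φ s)), ← Complex.exp_add]
  congr 2
  simp only [inner_add_left, inner_sub_right]
  push_cast
  ring

theorem norm_windowCoeff_window (φ g : 𝓢(Rd d, ℂ)) (w z : Rd d × Rd d) :
    ‖windowCoeff (window φ w) g z‖ = ‖windowCoeff (window φ 0) g (z - w)‖ := by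
  have hphase : windowCoeff (window φ w) g z =
      Complex.exp (↑(2 * Real.pi * inner ℝ w.1 (z.2 - w.2)) * Complex.I) *
        windowCoeff (window φ 0) g (z - w) := by
    rw [windowCoeff_apply, windowCoeff_apply, ← integral_add_right_eq_self _ w.1,
      ← integral_const_mul]
    congr with s
    rw [mul_right_comm, window_add_mul_cexp, Prod.fst_sub, Prod.snd_sub, sub_sub_eq_add_sub]
    ring
  rw [hphase, norm_mul, Complex.norm_exp_ofReal_mul_I, one_mul]

theorem integral_windowKernel_snd (ψ g : 𝓢(Rd d, ℂ)) (x t : Rd d) :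
    ∫ ξ, windowKernel (windowCoeff ψ g) g ((x, ξ), t) = ψ t * ((‖g (t - x)‖ ^ 2 : ℝ) : ℂ) := by
  have hfourierInv : ∫ ξ, windowKernel (windowCoeff ψ g) g ((x, ξ), t) =
      starRingEnd ℂ (g (t - x)) * 𝓕⁻ (𝓕 (slice x (shiftedProduct ψ g))) t := by
    rw [SchwartzMap.fourierInv_coe, Real.fourierInv_eq', ← integral_const_mul,
      ← integral_neg_eq_self]
    congr with ξ
    rw [windowKernel_apply, window_apply, windowCoeff_eq_fourier, neg_neg]
    simp only [smul_eq_mul, inner_neg_right, real_inner_comm]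
    ring_nf
  rw [hfourierInv, FourierTransform.fourierInv_fourier_eq, slice_apply, shiftedProduct_apply,
    Complex.ofReal_pow, ← Complex.conj_mul']
  ring

/-- Gabor reconstruction: `ψ` is a superposition of the windows of `g`. -/
theorem integralFst_windowKernel (ψ g : 𝓢(Rd d, ℂ)) :
    integralFst volume (windowKernel (windowCoeff ψ g) g) = ((∫ t, ‖g t‖ ^ 2 : ℝ) : ℂ) • ψ := by
  ext t
  have hint : Integrable (fun z => windowKernel (windowCoeff ψ g) g (z, t))
      (volume : Measure (Rd d × Rd d)) :=
    (slice t (compCLMOfContinuousLinearEquiv ℂ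
      (ContinuousLinearEquiv.prodComm ℝ (Rd d) (Rd d × Rd d))
      (windowKernel (windowCoeff ψ g) g))).integrable
  rw [Measure.volume_eq_prod] at hint
  calc ∫ z, windowKernel (windowCoeff ψ g) g (z, t)
      = ∫ x, ∫ ξ, windowKernel (windowCoeff ψ g) g ((x, ξ), t) := integral_prod _ hint
    _ = ψ t * ((∫ x, ‖g x‖ ^ 2 : ℝ) : ℂ) := by
        simp only [integral_windowKernel_snd]
        rw [integral_const_mul, integral_complex_ofReal,
          integral_sub_left_eq_self (fun x => ‖g x‖ ^ 2) volume t]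
    _ = _ := mul_comm _ _

theorem integral_norm_sq_pos {g : 𝓢(Rd d, ℂ)} (hg : g ≠ 0) : 0 < ∫ t, ‖g t‖ ^ 2 := by
  have hc : Continuous fun t => ‖g t‖ ^ 2 := by
    have := g.continuous
    fun_prop
  obtain ⟨t, ht⟩ : ∃ t, g t ≠ 0 := DFunLike.ne_iff.1 hg
  rw [integral_pos_iff_support_of_nonneg (fun t => by positivity)
    ((g.memLp 2 volume).integrable_norm_pow (by simp))]
  exact (isOpen_ne_fun hc continuous_const).measure_pos volume ⟨t, by simpa using ht⟩

theorem enorm_stft_le_lintegral (g φ : 𝓢(Rd d, ℂ)) (f : 𝓢'(Rd d, ℂ)) (w : Rd d × Rd d) :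
    ENNReal.ofReal (∫ t, ‖g t‖ ^ 2) * ‖stft φ f w.1 w.2‖ₑ ≤
      ∫⁻ z, ‖stft g f z.1 z.2‖ₑ * ‖windowCoeff (window φ 0) g (z - w)‖ₑ := by
  have hsuperposition : ((∫ t, ‖g t‖ ^ 2 : ℝ) : ℂ) * stft φ f w.1 w.2 =
      ∫ z : Rd d × Rd d, windowCoeff (window φ w) g z * stft g f z.1 z.2 := by
    have h := distribution_integralFst volume (toCLM f)
      (windowKernel (windowCoeff (window φ w) g) g)
    simpa only [integralFst_windowKernel, slice_windowKernel, map_smul, toCLM_apply, smul_eq_mul,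
      ← stft_eq_apply_window] using h
  calc _ = ‖((∫ t, ‖g t‖ ^ 2 : ℝ) : ℂ) * stft φ f w.1 w.2‖ₑ := by
        rw [enorm_mul]
        congr 1
        rw [← ofReal_norm, Complex.norm_of_nonneg (integral_nonneg fun _ => by positivity)]
    _ ≤ ∫⁻ z : Rd d × Rd d, ‖windowCoeff (window φ w) g z * stft g f z.1 z.2‖ₑ :=
        hsuperposition ▸ enorm_integral_le_lintegral_enorm _
    _ = _ := by
        congr with z
        rw [enorm_mul, mul_comm, ← ofReal_norm (windowCoeff _ _ _), norm_windowCoeff_window,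
          ofReal_norm]

end ShortTimeFourier

section ModulationSpace

theorem mixedNorm_mul {α β : Type*} [MeasurableSpace α] [MeasurableSpace β] {μ : Measure α}
    {ν : Measure β} {a : α → ℝ≥0∞} {b : β → ℝ≥0∞} {p : ℝ≥0∞} (ha : eLpNorm a p μ ≠ ⊤)
    (hb : ∀ y, b y ≠ ⊤) (q : ℝ≥0∞) :
    mixedNorm μ ν p q (fun z => a z.1 * b z.2) = eLpNorm a p μ * eLpNorm b q ν := by
  simp only [mixedNorm, mul_comm (a _), eLpNorm_const_mul (hb _)]
  simp only [mul_comm (b _), eLpNorm_const_mul ha]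

theorem exists_norm_apply_le_mul_weights {E F : Type} [NormedAddCommGroup E] [NormedSpace ℝ E]
    [NormedAddCommGroup F] [NormedSpace ℝ F] (Φ : 𝓢(E × F, ℂ)) (k l : ℕ) :
    ∃ C, ∀ z, ‖Φ z‖ ≤ C * ((1 + ‖z.1‖) ^ (-k : ℝ) * (1 + ‖z.2‖) ^ (-l : ℝ)) := by
  obtain ⟨C, hC⟩ : ∃ C, ∀ z, (1 + ‖z‖) ^ (k + l) * ‖Φ z‖ ≤ C := by
    have h := one_add_le_sup_seminorm_apply (𝕜 := ℝ) (m := (k + l, 0)) le_rfl le_rfl Φ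
    simp only [norm_iteratedFDeriv_zero] at h
    exact ⟨_, h⟩
  refine ⟨C, fun z => ?_⟩
  rw [Real.rpow_neg (by positivity), Real.rpow_neg (by positivity), Real.rpow_natCast,
    Real.rpow_natCast, ← mul_inv, ← div_eq_mul_inv, le_div_iff₀' (by positivity)]
  refine le_trans ?_ (hC z)
  rw [pow_add]
  gcongr
  · exact norm_fst_le z
  · exact norm_snd_le z

theorem mixedNorm_enorm_schwartz_ne_top {E F : Type} [NormedAddCommGroup E] [NormedSpace ℝ E]
    [NormedAddCommGroup F] [NormedSpace ℝ F] [MeasurableSpace E] [MeasurableSpace F]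
    (μ : Measure E) (ν : Measure F) [μ.HasTemperateGrowth] [ν.HasTemperateGrowth]
    (Φ : 𝓢(E × F, ℂ)) (p q : ℝ≥0∞) : mixedNorm μ ν p q (fun z => ‖Φ z‖ₑ) ≠ ⊤ := by
  obtain ⟨k, hk⟩ := Measure.HasTemperateGrowth.exists_eLpNorm_lt_top p (μ := μ) inferInstance
  obtain ⟨l, hl⟩ := Measure.HasTemperateGrowth.exists_eLpNorm_lt_top q (μ := ν) inferInstance
  obtain ⟨C, hC⟩ := exists_norm_apply_le_mul_weights Φ k l
  rw [← eLpNorm_enorm] at hk hl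
  have hle : ∀ z, ‖Φ z‖ₑ ≤
      ‖C‖ₑ * (‖(1 + ‖z.1‖) ^ (-k : ℝ)‖ₑ * ‖(1 + ‖z.2‖) ^ (-l : ℝ)‖ₑ) := fun z => by
    rw [← enorm_mul, ← enorm_mul]
    exact enorm_le_iff_norm_le.2 ((hC z).trans (le_abs_self _))
  refine ne_top_of_le_ne_top ?_ (mixedNorm_mono hle p q)
  rw [mixedNorm_const_mul enorm_ne_top, mixedNorm_mul (b := fun y => ‖(1 + ‖y‖) ^ (-l : ℝ)‖ₑ)
    hk.ne fun _ => enorm_ne_top]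
  exact ENNReal.mul_ne_top enorm_ne_top (ENNReal.mul_ne_top hk.ne hl.ne)

theorem exists_young_exponent {p P : ℝ≥0∞} (hp : 1 ≤ p) (hpP : p ≤ P) :
    ∃ ρ : ℝ≥0∞, 1 ≤ ρ ∧ p⁻¹ + ρ⁻¹ = 1 + P⁻¹ := by
  have hp' : p⁻¹ ≤ 1 := ENNReal.inv_le_one.2 hp
  refine ⟨(1 + P⁻¹ - p⁻¹)⁻¹, ?_, ?_⟩
  · rw [ENNReal.one_le_inv, tsub_le_iff_right]
    gcongr
  · rw [inv_inv, add_tsub_cancel_of_le (hp'.trans le_self_add)]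

variable {d : ℕ}

theorem modulationNorm_eq_mixedNorm (g : 𝓢(Rd d, ℂ)) (p q : ℝ≥0∞) (f : 𝓢'(Rd d, ℂ)) :
    modulationNorm g p q f =
      mixedNorm volume volume p q fun z : Rd d × Rd d => ‖stft g f z.1 z.2‖ₑ := by
  simp only [modulationNorm, mixedNorm, eLpNorm_enorm]

theorem enorm_stft_le_lconvolution {g : 𝓢(Rd d, ℂ)} (hg : g ≠ 0) (φ : 𝓢(Rd d, ℂ))
    (f : 𝓢'(Rd d, ℂ)) (w : Rd d × Rd d) :
    ‖stft φ f w.1 w.2‖ₑ ≤ (ENNReal.ofReal (∫ t, ‖g t‖ ^ 2))⁻¹ *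
      ((fun z => ‖stft g f z.1 z.2‖ₑ) ⋆ₗ[volume]
        fun z => ‖windowCoeff (window φ 0) g (-z)‖ₑ) w := by
  rw [mul_comm, ← div_eq_mul_inv, ENNReal.le_div_iff_mul_le
    (.inl (ENNReal.ofReal_pos.2 (integral_norm_sq_pos hg)).ne') (.inl ENNReal.ofReal_ne_top),
    mul_comm]
  refine (enorm_stft_le_lintegral g φ f w).trans_eq (lintegral_congr fun z => ?_)
  simp only [neg_add_eq_sub, neg_sub]

theorem exists_modulationNorm_le {g : 𝓢(Rd d, ℂ)} (hg : g ≠ 0) (φ : 𝓢(Rd d, ℂ))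
    {p q P Q : ℝ≥0∞} (hp : 1 ≤ p) (hq : 1 ≤ q) (hpP : p ≤ P) (hqQ : q ≤ Q) :
    ∃ C : ℝ≥0∞, C ≠ ⊤ ∧
      ∀ f : 𝓢'(Rd d, ℂ), modulationNorm φ P Q f ≤ C * modulationNorm g p q f := by
  obtain ⟨ρ, hρ, hpρ⟩ := exists_young_exponent hp hpP
  obtain ⟨σ, hσ, hqσ⟩ := exists_young_exponent hq hqQ
  let H : Rd d × Rd d → ℝ≥0∞ := fun z => ‖windowCoeff (window φ 0) g (-z)‖ₑ
  have hHm : Measurable H :=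
    ((SchwartzMap.continuous _).comp continuous_neg).enorm.measurable
  have hH : mixedNorm volume volume ρ σ H ≠ ⊤ := by
    have h := mixedNorm_comp_neg (κ := volume) (η := volume)
      (windowCoeff (window φ 0) g).continuous.enorm.measurable ρ σ
    exact h.symm ▸ mixedNorm_enorm_schwartz_ne_top volume volume _ ρ σ
  have hc : (ENNReal.ofReal (∫ t, ‖g t‖ ^ 2))⁻¹ ≠ ⊤ :=
    ENNReal.inv_ne_top.2 (ENNReal.ofReal_pos.2 (integral_norm_sq_pos hg)).ne'
  refine ⟨_, ENNReal.mul_ne_top hc hH, fun f => ?_⟩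
  let F : Rd d × Rd d → ℝ≥0∞ := fun z => ‖stft g f z.1 z.2‖ₑ
  rw [modulationNorm_eq_mixedNorm, modulationNorm_eq_mixedNorm]
  calc mixedNorm volume volume P Q (fun z : Rd d × Rd d => ‖stft φ f z.1 z.2‖ₑ)
      ≤ mixedNorm volume volume P Q fun w =>
          (ENNReal.ofReal (∫ t, ‖g t‖ ^ 2))⁻¹ * (F ⋆ₗ[volume] H) w :=
        mixedNorm_mono (enorm_stft_le_lconvolution hg φ f) P Q
    _ = (ENNReal.ofReal (∫ t, ‖g t‖ ^ 2))⁻¹ * mixedNorm volume volume P Q (F ⋆ₗ[volume] H) :=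
        mixedNorm_const_mul hc _ _ _
    _ ≤ (ENNReal.ofReal (∫ t, ‖g t‖ ^ 2))⁻¹ *
          (mixedNorm volume volume p q F * mixedNorm volume volume ρ σ H) := by
        gcongr
        exact mixedNorm_lconvolution_le (continuous_stft g f).enorm.measurable hHm
          hp hρ (hp.trans hpP) hpρ hq hσ hqσ
    _ = _ := by ring

end ModulationSpace

section GaussianAtoms

variable {d : ℕ}

/-- The character `w ↦ exp (-2 π i (x · α + ξ · τ))` of `ℝ²ᵈ`, for `w = (x, ξ)` and frequency
`ζ = (α, τ)`. -/
def character (ζ w : Rd d × Rd d) : ℂ :=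
  Complex.exp (↑(-2 * Real.pi * inner ℝ w.1 ζ.1) * Complex.I) *
    Complex.exp (↑(-2 * Real.pi * inner ℝ w.2 ζ.2) * Complex.I)

theorem hasTemperateGrowth_character_uncurry :
    Function.HasTemperateGrowth fun u : (Rd d × Rd d) × (Rd d × Rd d) => character u.1 u.2 :=
  let fst := ContinuousLinearMap.fst ℝ (Rd d) (Rd d)
  let snd := ContinuousLinearMap.snd ℝ (Rd d) (Rd d)
  let frequency := ContinuousLinearMap.fst ℝ (Rd d × Rd d) (Rd d × Rd d)
  let point := ContinuousLinearMap.snd ℝ (Rd d × Rd d) (Rd d × Rd d)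
  (hasTemperateGrowth_cexp_inner (fst ∘L point) (fst ∘L frequency) (-2 * Real.pi)).mul
    (hasTemperateGrowth_cexp_inner (snd ∘L point) (snd ∘L frequency) (-2 * Real.pi))

theorem hasTemperateGrowth_character (ζ : Rd d × Rd d) :
    Function.HasTemperateGrowth (character ζ) := by
  have hlin (L : Rd d × Rd d →L[ℝ] ℝ) :
      Function.HasTemperateGrowth fun w => Complex.exp (↑(L w) * Complex.I) :=
    hasTemperateGrowth_cexp.comp L.hasTemperateGrowth
  exact (hlin ((-2 * Real.pi) • (innerSL ℝ).flip ζ.1 ∘L .fst ℝ (Rd d) (Rd d))).mul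
    (hlin ((-2 * Real.pi) • (innerSL ℝ).flip ζ.2 ∘L .snd ℝ (Rd d) (Rd d)))

/-- The Gaussian `exp (-π |t|²)` on `ℝᵈ`, the window in which the ambiguity function factors. -/
def gauss1 : 𝓢(Rd d, ℂ) := gaussian Real.pi Real.pi_pos

/-- The Gaussian `exp (-π (|x|² + |ξ|²) / 2)` on `ℝ²ᵈ`. -/
def gauss2 : 𝓢(Rd d × Rd d, ℂ) :=
  tensor (gaussian (Real.pi / 2) (by positivity)) (gaussian (Real.pi / 2) (by positivity))

/-- The conjugated time-frequency shift of `gauss2` by `(z, ζ)`, against which the ambiguity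
function is tested to compute its short-time Fourier transform. -/
def gaussAtom (z ζ : Rd d × Rd d) : 𝓢(Rd d × Rd d, ℂ) :=
  smulLeftCLM ℂ (character ζ) (compSubConstCLM ℂ z gauss2)

theorem gaussAtom_apply (z ζ w : Rd d × Rd d) :
    gaussAtom z ζ w = character ζ w * gauss2 (w - z) := by
  rw [gaussAtom, smulLeftCLM_apply_apply (hasTemperateGrowth_character ζ),
    compSubConstCLM_apply, smul_eq_mul]

theorem integral_gaussian_mul_cexp_inner (y : Rd d) :
    ∫ η : Rd d, Complex.exp (-(Real.pi / 2) * ‖η‖ ^ 2 : ℝ) *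
      Complex.exp (↑(-2 * Real.pi * inner ℝ η y) * Complex.I) =
      2 ^ ((d : ℂ) / 2) * Complex.exp (-2 * Real.pi * ‖y‖ ^ 2 : ℝ) := by
  have hpi : (Real.pi : ℂ) ≠ 0 := mod_cast Real.pi_ne_zero
  convert GaussianFourier.integral_cexp_neg_mul_sq_norm_add (V := Rd d) (b := (Real.pi / 2 : ℝ))
    (by simpa using Real.pi_pos) (-2 * Real.pi * Complex.I) y using 2
  · ext η
    rw [← Complex.exp_add, real_inner_comm]
    push_cast
    ring_nf
  · rw [finrank_euclideanSpace_fin]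
    push_cast
    field_simp
  · congr 1
    rw [mul_pow, Complex.I_sq]
    push_cast
    field_simp
    ring

theorem gaussAtom_apply_add_mul_cexp (x ξ α τ y t η : Rd d) :
    Complex.exp (↑(-2 * Real.pi * inner ℝ (η + ξ) t) * Complex.I) *
        gaussAtom (x, ξ) (α, τ) (y, η + ξ) =
      Complex.exp (↑(-2 * Real.pi * (inner ℝ y α + inner ℝ ξ (t + τ))) * Complex.I) *
          Complex.exp (-(Real.pi / 2) * ‖y - x‖ ^ 2 : ℝ) *
        (Complex.exp (-(Real.pi / 2) * ‖η‖ ^ 2 : ℝ) *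
          Complex.exp (↑(-2 * Real.pi * inner ℝ η (t + τ)) * Complex.I)) := by
  simp only [gaussAtom_apply, character, gauss2, tensor_apply, gaussian_apply, Prod.fst_sub,
    Prod.snd_sub, add_sub_cancel_right, ← Complex.exp_add]
  congr 1
  simp only [inner_add_left, inner_add_right]
  push_cast
  ring

theorem fourier_slice_gaussAtom (x ξ α τ y t : Rd d) :
    𝓕 (slice y (gaussAtom (x, ξ) (α, τ))) t =
      2 ^ ((d : ℂ) / 2) *
        Complex.exp (↑(-2 * Real.pi * (inner ℝ y α + inner ℝ ξ (t + τ))) * Complex.I) *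
        Complex.exp (-(Real.pi / 2) * ‖y - x‖ ^ 2 + -2 * Real.pi * ‖t + τ‖ ^ 2 : ℝ) := by
  rw [SchwartzMap.fourier_coe, Real.fourier_eq', ← integral_add_right_eq_self _ ξ]
  simp only [slice_apply, smul_eq_mul, gaussAtom_apply_add_mul_cexp]
  rw [integral_const_mul, integral_gaussian_mul_cexp_inner, Complex.ofReal_add, Complex.exp_add]
  ring

theorem norm_sub_sq_add_norm_half_add_sq (a b : Rd d) :
    -(Real.pi / 2) * ‖a - b‖ ^ 2 + -2 * Real.pi * ‖(1 / 2 : ℝ) • (a + b)‖ ^ 2 =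
      -Real.pi * ‖a‖ ^ 2 + -Real.pi * ‖b‖ ^ 2 := by
  rw [norm_smul, mul_pow]
  norm_num
  linear_combination -(Real.pi / 2) * parallelogram_law_with_norm ℝ a b

theorem ambiguityKernel_gaussAtom (x ξ α τ u v : Rd d) :
    partialFourier (gaussAtom (x, ξ) (α, τ)) (changeVar (u, v)) =
      2 ^ ((d : ℂ) / 2) * Complex.exp (↑(-2 * Real.pi * inner ℝ ξ τ) * Complex.I) *
        (window gauss1 ((1 / 2 : ℝ) • x - τ, α + (1 / 2 : ℝ) • ξ) u *
        starRingEnd ℂ (window gauss1 (-((1 / 2 : ℝ) • x) - τ, α - (1 / 2 : ℝ) • ξ) v)) := by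
  have hmod : -(Real.pi / 2) * ‖u - v - x‖ ^ 2 +
      -2 * Real.pi * ‖(1 / 2 : ℝ) • (u + v) + τ‖ ^ 2 =
      -Real.pi * ‖u - ((1 / 2 : ℝ) • x - τ)‖ ^ 2 +
        -Real.pi * ‖v - (-((1 / 2 : ℝ) • x) - τ)‖ ^ 2 := by
    rw [← norm_sub_sq_add_norm_half_add_sq]
    congr 4 <;> module
  have hphase : inner ℝ (u - v) α + inner ℝ ξ ((1 / 2 : ℝ) • (u + v) + τ) =
      inner ℝ ξ τ + inner ℝ u (α + (1 / 2 : ℝ) • ξ) - inner ℝ v (α - (1 / 2 : ℝ) • ξ) := by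
    simp only [inner_add_right, inner_sub_left, inner_sub_right, inner_smul_right,
      real_inner_comm u ξ, real_inner_comm v ξ]
    ring
  have hker : partialFourier (gaussAtom (x, ξ) (α, τ)) (changeVar (u, v)) =
      𝓕 (slice (u - v) (gaussAtom (x, ξ) (α, τ))) ((1 / 2 : ℝ) • (u + v)) := rfl
  rw [hker, fourier_slice_gaussAtom, hmod, hphase]
  simp only [window_apply, gauss1, gaussian_apply, map_mul, ← Complex.exp_conj,
    Complex.conj_ofReal, Complex.conj_I]
  simp only [mul_assoc, ← Complex.exp_add]
  congr 2
  push_cast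
  ring

theorem conjDist_conjS (f : 𝓢'(Rd d, ℂ)) (φ : 𝓢(Rd d, ℂ)) :
    conjDist f (conjS φ) = starRingEnd ℂ (f φ) := by
  have h : conjS (conjS φ) = φ := by ext; simp
  change starRingEnd ℂ (f (conjS (conjS φ))) = _
  rw [h]

theorem ambiguity_gaussAtom (f₁ f₂ : 𝓢'(Rd d, ℂ)) (x ξ α τ : Rd d) :
    ambiguity f₁ f₂ (gaussAtom (x, ξ) (α, τ)) =
      2 ^ ((d : ℂ) / 2) * Complex.exp (↑(-2 * Real.pi * inner ℝ ξ τ) * Complex.I) *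
        (stft gauss1 f₁ ((1 / 2 : ℝ) • x - τ) (α + (1 / 2 : ℝ) • ξ) *
        starRingEnd ℂ (stft gauss1 f₂ (-((1 / 2 : ℝ) • x) - τ) (α - (1 / 2 : ℝ) • ξ))) := by
  set c := (2 : ℂ) ^ ((d : ℂ) / 2) * Complex.exp (↑(-2 * Real.pi * inner ℝ ξ τ) * Complex.I)
  set a : Rd d × Rd d := ((1 / 2 : ℝ) • x - τ, α + (1 / 2 : ℝ) • ξ)
  set b : Rd d × Rd d := (-((1 / 2 : ℝ) • x) - τ, α - (1 / 2 : ℝ) • ξ)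
  set K := compCLMOfContinuousLinearEquiv ℂ changeVar
    (partialFourier (gaussAtom (x, ξ) (α, τ))) with hK
  have hslice (u : Rd d) : slice u K = (c * window gauss1 a u) • conjS (window gauss1 b) := by
    ext v
    rw [slice_apply, hK, compCLMOfContinuousLinearEquiv_apply, Function.comp_apply,
      ambiguityKernel_gaussAtom, smul_apply, conjS_apply, smul_eq_mul, mul_assoc c]
  have hpair : partialPairing (conjDist f₂) K =
      (c * starRingEnd ℂ (f₂ (window gauss1 b))) • window gauss1 a := by
    ext u
    rw [partialPairing_apply, hslice, map_smul, conjDist_conjS, smul_apply, smul_eq_mul,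
      smul_eq_mul, mul_right_comm]
  rw [ambiguity_apply, hpair, map_smul, smul_eq_mul, stft_eq_apply_window gauss1 f₁ a,
    stft_eq_apply_window gauss1 f₂ b, mul_right_comm, mul_assoc]

end GaussianAtoms

section SchwartzPairing

variable {E : Type} [NormedAddCommGroup E] [NormedSpace ℝ E] [MeasurableSpace E] [BorelSpace E]
  {μ : Measure E}

theorem ae_eq_of_integral_schwartz_mul_eq [FiniteDimensional ℝ E] {u v : E → ℂ}
    (hu : LocallyIntegrable u μ) (hv : LocallyIntegrable v μ)
    (h : ∀ χ : 𝓢(E, ℂ), ∫ x, χ x * u x ∂μ = ∫ x, χ x * v x ∂μ) : u =ᵐ[μ] v := by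
  refine ae_eq_of_integral_contDiff_smul_eq hu hv fun g hg hc => ?_
  have hg' : ContDiff ℝ ∞ fun x => (g x : ℂ) := Complex.ofRealCLM.contDiff.comp hg
  have hc' : HasCompactSupport fun x => (g x : ℂ) := hc.comp_left Complex.ofReal_zero
  simpa using h (hc'.toSchwartzMap hg')

theorem integrable_schwartz_mul [μ.HasTemperateGrowth] {p : ℝ≥0∞} (hp : 1 ≤ p) {u : E → ℂ}
    (hu : MemLp u p μ) (χ : 𝓢(E, ℂ)) : Integrable (fun x => χ x * u x) μ := by
  have := (ENNReal.HolderConjugate.conjExponent hp).symm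
  exact (χ.memLp (ENNReal.conjExponent p) μ).integrable_mul hu

end SchwartzPairing

section FourierInverse

variable {V : Type} [NormedAddCommGroup V] [InnerProductSpace ℝ V] [FiniteDimensional ℝ V]
  [MeasurableSpace V] [BorelSpace V]

/-- The function `u` is the inverse Fourier transform of the function `h` in the sense of
distributions: both are paired with Schwartz functions by integration, which is meaningful when they
lie in `Lᵖ` spaces. -/
def IsFourierInv (h u : V → ℂ) : Prop :=
  ∀ χ : 𝓢(V, ℂ), ∫ x, χ x * u x = ∫ x, (𝓕⁻ χ) x * h x

theorem IsFourierInv.ae_eq {h u v : V → ℂ} (hu : IsFourierInv h u) (hv : IsFourierInv h v)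
    (hu' : LocallyIntegrable u) (hv' : LocallyIntegrable v) : u =ᵐ[volume] v :=
  ae_eq_of_integral_schwartz_mul_eq hu' hv' fun χ => (hu χ).trans (hv χ).symm

theorem IsFourierInv.add {h₁ h₂ u₁ u₂ : V → ℂ} (H₁ : IsFourierInv h₁ u₁) (H₂ : IsFourierInv h₂ u₂)
    {a₁ a₂ b₁ b₂ : ℝ≥0∞} (ha₁ : 1 ≤ a₁) (ha₂ : 1 ≤ a₂) (hb₁ : 1 ≤ b₁) (hb₂ : 1 ≤ b₂)
    (hh₁ : MemLp h₁ a₁) (hh₂ : MemLp h₂ a₂) (hu₁ : MemLp u₁ b₁) (hu₂ : MemLp u₂ b₂) :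
    IsFourierInv (h₁ + h₂) (u₁ + u₂) := fun χ => by
  simp only [Pi.add_apply, mul_add]
  rw [integral_add (integrable_schwartz_mul hb₁ hu₁ χ) (integrable_schwartz_mul hb₂ hu₂ χ),
    integral_add (integrable_schwartz_mul ha₁ hh₁ _) (integrable_schwartz_mul ha₂ hh₂ _), H₁, H₂]

theorem IsFourierInv.const_mul {h u : V → ℂ} (H : IsFourierInv h u) (c : ℂ) :
    IsFourierInv (fun x => c * h x) (fun x => c * u x) := fun χ => by
  simp only [mul_left_comm _ c, integral_const_mul, H χ]

theorem IsFourierInv.congr {h h' u : V → ℂ} (H : IsFourierInv h u) (hh : h =ᵐ[volume] h') :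
    IsFourierInv h' u := fun χ => by
  rw [H χ]
  refine integral_congr_ae ?_
  filter_upwards [hh] with x hx
  rw [hx]

theorem exists_isFourierInv_of_memLp_one {h : V → ℂ} (hh : MemLp h 1) :
    ∃ u : V → ℂ, AEStronglyMeasurable u ∧ (∀ x, ‖u x‖ₑ ≤ eLpNorm h 1) ∧ IsFourierInv h u := by
  have hint : Integrable h := memLp_one_iff_integrable.1 hh
  have hcont : Continuous fun p : V × V => (-innerₗ V) p.1 p.2 := continuous_inner.neg
  refine ⟨𝓕⁻ h, (VectorFourier.fourierIntegral_continuous Real.continuous_fourierChar hcont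
    hint).aestronglyMeasurable, fun x => ?_, fun χ => ?_⟩
  · rw [Real.fourierInv_eq, eLpNorm_one_eq_lintegral_enorm]
    refine (enorm_integral_le_lintegral_enorm _).trans_eq ?_
    congr with v
    rw [Circle.smul_def, enorm_smul, ← ofReal_norm, Circle.norm_coe, ENNReal.ofReal_one, one_mul]
  · have hflip : (-innerₗ V).flip = -innerₗ V := by
      ext x y
      simp [real_inner_comm]
    have hself := VectorFourier.integral_fourierIntegral_smul_eq_flip (μ := volume) (ν := volume)
      Real.continuous_fourierChar hcont (χ.integrable (μ := volume)) hint
    rw [hflip] at hself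
    rw [SchwartzMap.fourierInv_coe]
    exact hself.symm

theorem exists_isFourierInv_of_memLp_two {h : V → ℂ} (hh : MemLp h 2) :
    ∃ u : V → ℂ, MemLp u 2 ∧ eLpNorm u 2 = eLpNorm h 2 ∧ IsFourierInv h u := by
  let H := hh.toLp h
  let U : Lp ℂ 2 (volume : Measure V) := 𝓕⁻ H
  refine ⟨U, Lp.memLp U, ?_, fun χ => ?_⟩
  · have hnorm : ‖U‖ = ‖H‖ := (Lp.fourierTransformₗᵢ V ℂ).symm.norm_map H
    rw [← Lp.enorm_def, ← ofReal_norm, hnorm, ofReal_norm, Lp.enorm_def]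
    exact eLpNorm_congr_ae hh.coeFn_toLp
  · have hpair := congrArg (fun T : 𝓢'(V, ℂ) => T χ) (Lp.fourierInv_toTemperedDistribution_eq H)
    simp only [TemperedDistribution.fourierInv_apply, Lp.toTemperedDistribution_apply,
      smul_eq_mul] at hpair
    rw [← hpair]
    refine integral_congr_ae ?_
    filter_upwards [hh.coeFn_toLp] with x hx
    rw [hx]

end FourierInverse

section Truncation

variable {α F : Type*} [MeasurableSpace α] {μ : Measure α} [NormedAddCommGroup F]

theorem le_rpow_mul_rpow_of_le {κ r s : ℝ} (hκ : 0 < κ) (hr : κ ≤ r) (hs : 1 ≤ s) :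
    r ≤ κ ^ (1 - s) * r ^ s := by
  have hr₀ : 0 < r := hκ.trans_le hr
  calc r = r ^ (1 - s) * r ^ s := by rw [← Real.rpow_add hr₀, sub_add_cancel, Real.rpow_one]
    _ ≤ _ := mul_le_mul_of_nonneg_right (Real.rpow_le_rpow_of_nonpos hκ hr (by linarith))
      (by positivity)

theorem sq_le_rpow_mul_rpow_of_le {κ r s : ℝ} (hr₀ : 0 ≤ r) (hr : r ≤ κ) (hs : s ≤ 2) :
    r ^ 2 ≤ κ ^ (2 - s) * r ^ s := by
  rcases hr₀.eq_or_lt with rfl | hr₀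
  · rw [zero_pow two_ne_zero]
    positivity
  calc r ^ 2 = r ^ (2 - s) * r ^ s := by rw [← Real.rpow_add hr₀, sub_add_cancel, Real.rpow_two]
    _ ≤ _ := by gcongr

theorem eLpNorm_rpow_toReal_eq_lintegral_ofReal {p : ℝ≥0∞} (hp : p ≠ 0) (hpT : p ≠ ⊤) (f : α → F) :
    eLpNorm f p μ ^ p.toReal = ∫⁻ x, ENNReal.ofReal (‖f x‖ ^ p.toReal) ∂μ := by
  rw [← eLpNorm_enorm, eLpNorm_rpow_toReal hp hpT]
  simp only [← ofReal_norm, ENNReal.ofReal_rpow_of_nonneg (norm_nonneg _) ENNReal.toReal_nonneg]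

theorem eLpNorm_two_sq_eq_lintegral (f : α → F) :
    eLpNorm f 2 μ ^ 2 = ∫⁻ x, ENNReal.ofReal (‖f x‖ ^ 2) ∂μ := by
  simpa using eLpNorm_rpow_toReal_eq_lintegral_ofReal two_ne_zero ENNReal.ofNat_ne_top f

theorem eLpNorm_one_indicator_compl_le {h : α → F} {s : ℝ} (hs : 1 ≤ s)
    (hN : ∫⁻ x, ENNReal.ofReal (‖h x‖ ^ s) ∂μ ≤ 1) {κ : ℝ} (hκ : 0 < κ) :
    eLpNorm ({x | ‖h x‖ ≤ κ}ᶜ.indicator h) 1 μ ≤ ENNReal.ofReal (κ ^ (1 - s)) := by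
  rw [eLpNorm_one_eq_lintegral_enorm]
  calc _ ≤ ∫⁻ x, ENNReal.ofReal (κ ^ (1 - s)) * ENNReal.ofReal (‖h x‖ ^ s) ∂μ := by
        refine lintegral_mono fun x => ?_
        by_cases hx : ‖h x‖ ≤ κ
        · simp [hx]
        · rw [Set.indicator_of_mem (by exact hx), ← ofReal_norm,
            ← ENNReal.ofReal_mul (by positivity)]
          exact ENNReal.ofReal_le_ofReal (le_rpow_mul_rpow_of_le hκ (not_le.1 hx).le hs)
    _ ≤ _ := by
        rw [lintegral_const_mul' _ _ ENNReal.ofReal_ne_top]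
        exact mul_le_of_le_one_right zero_le hN

theorem eLpNorm_two_indicator_lt_top {h : α → F} {s : ℝ} (hs : s ≤ 2)
    (hN : ∫⁻ x, ENNReal.ofReal (‖h x‖ ^ s) ∂μ ≤ 1) (κ : ℝ) :
    eLpNorm ({x | ‖h x‖ ≤ κ}.indicator h) 2 μ < ⊤ := by
  refine (ENNReal.pow_lt_top_iff.1 ?_).resolve_right two_ne_zero
  rw [eLpNorm_two_sq_eq_lintegral]
  calc _ ≤ ∫⁻ x, ENNReal.ofReal (κ ^ (2 - s)) * ENNReal.ofReal (‖h x‖ ^ s) ∂μ := by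
        refine lintegral_mono fun x => ?_
        by_cases hx : ‖h x‖ ≤ κ
        · have hκ : 0 ≤ κ := (norm_nonneg _).trans hx
          rw [Set.indicator_of_mem (by exact hx), ← ENNReal.ofReal_mul (by positivity)]
          exact ENNReal.ofReal_le_ofReal (sq_le_rpow_mul_rpow_of_le (norm_nonneg _) hx hs)
        · simp [hx]
    _ < ⊤ := by
        rw [lintegral_const_mul' _ _ ENNReal.ofReal_ne_top]
        exact ENNReal.mul_lt_top ENNReal.ofReal_lt_top (hN.trans_lt ENNReal.one_lt_top)

theorem sq_mul_measure_lt_enorm_add_le {v w : α → F} {a : ℝ≥0∞} (hv : ∀ x, ‖v x‖ₑ ≤ a)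
    (hw : AEStronglyMeasurable w μ) :
    a ^ 2 * μ {x | 2 * a < ‖v x + w x‖ₑ} ≤ eLpNorm w 2 μ ^ 2 := by
  have hsub : {x | 2 * a < ‖v x + w x‖ₑ} ⊆ {x | a ≤ ‖w x‖ₑ} := fun x hx => by
    by_contra hwx
    refine (hx : 2 * a < _).not_ge ((enorm_add_le _ _).trans ?_)
    rw [two_mul]
    exact add_le_add (hv x) (not_le.1 hwx).le
  calc _ ≤ a ^ 2 * μ {x | a ≤ ‖w x‖ₑ} := by gcongr
    _ ≤ _ := by simpa using mul_meas_ge_le_pow_eLpNorm' μ two_ne_zero ENNReal.ofNat_ne_top hw a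

theorem setLIntegral_Ioc_const_mul_rpow {c b e : ℝ} (hc : 0 ≤ c) (hb : 0 ≤ b) (he : -1 < e) :
    ∫⁻ l in Set.Ioc 0 b, ENNReal.ofReal (c * l ^ e) =
      ENNReal.ofReal (c * (b ^ (e + 1) / (e + 1))) := by
  have hint : IntegrableOn (fun l : ℝ => c * l ^ e) (Set.Ioc 0 b) :=
    ((intervalIntegrable_iff_integrableOn_Ioc_of_le hb).1
      (intervalIntegral.intervalIntegrable_rpow' he)).const_mul c
  rw [← ofReal_integral_eq_lintegral_ofReal hint, integral_const_mul,
    ← intervalIntegral.integral_of_le hb, integral_rpow (.inl he), Real.zero_rpow (by linarith),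
    sub_zero]
  refine (ae_restrict_iff' measurableSet_Ioc).2 (.of_forall fun l hl => ?_)
  exact mul_nonneg hc (Real.rpow_nonneg hl.1.le e)

theorem le_two_mul_rpow_of_le_rpow {s t r l : ℝ} (hst : s.HolderConjugate t) (hr : 0 < r)
    (hl : 0 < l) (h : r ≤ (2 / l) ^ (t - 1)) : l ≤ 2 * r ^ (1 - s) := by
  have hroot : r ^ (s - 1) ≤ 2 / l :=
    calc r ^ (s - 1) ≤ ((2 / l) ^ (t - 1)) ^ (s - 1) := by
          have := hst.sub_one_pos
          gcongr
      _ = 2 / l := by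
          rw [← Real.rpow_mul (by positivity),
            show (t - 1) * (s - 1) = 1 by linear_combination hst.mul_eq_add, Real.rpow_one]
  rw [le_div_iff₀ hl] at hroot
  rw [← neg_sub, Real.rpow_neg hr.le, ← div_eq_mul_inv, le_div_iff₀ (by positivity)]
  linarith

theorem lintegral_truncated_rpow_le {s t r : ℝ} (hst : s.HolderConjugate t) (ht : 2 < t)
    (hr : 0 ≤ r) :
    ∫⁻ l in Set.Ioi (0 : ℝ), {l : ℝ | r ≤ (2 / l) ^ (t - 1)}.indicator
      (fun l => ENNReal.ofReal (4 * r ^ 2 * l ^ (t - 3))) l ≤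
    ENNReal.ofReal (4 * 2 ^ (t - 2) / (t - 2)) * ENNReal.ofReal (r ^ s) := by
  rcases hr.eq_or_lt with rfl | hr
  · simp
  have hsub : {l : ℝ | r ≤ (2 / l) ^ (t - 1)} ∩ Set.Ioi 0 ⊆ Set.Ioc 0 (2 * r ^ (1 - s)) :=
    fun l ⟨hl, hl₀⟩ => ⟨hl₀, le_two_mul_rpow_of_le_rpow hst hr hl₀ hl⟩
  calc _ ≤ ∫⁻ l in {l : ℝ | r ≤ (2 / l) ^ (t - 1)}, ENNReal.ofReal (4 * r ^ 2 * l ^ (t - 3))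
          ∂(volume.restrict (Set.Ioi 0)) := lintegral_indicator_le _ _
    _ ≤ ∫⁻ l in Set.Ioc 0 (2 * r ^ (1 - s)), ENNReal.ofReal (4 * r ^ 2 * l ^ (t - 3)) := by
        rw [Measure.restrict_restrict' measurableSet_Ioi]
        exact lintegral_mono_set hsub
    _ = ENNReal.ofReal (4 * r ^ 2 * ((2 * r ^ (1 - s)) ^ (t - 2) / (t - 2))) := by
        rw [setLIntegral_Ioc_const_mul_rpow (by positivity) (by positivity) (by linarith),
          show t - 3 + 1 = t - 2 by ring]
    _ = _ := by
        rw [← ENNReal.ofReal_mul (div_nonneg (by positivity) (by linarith)),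
          Real.mul_rpow (by norm_num) (by positivity), ← Real.rpow_mul hr.le,
          show (1 - s) * (t - 2) = s - 2 by linear_combination -hst.mul_eq_add,
          Real.rpow_sub hr, Real.rpow_two]
        congr 1
        field_simp

end Truncation

section HausdorffYoung

variable {V : Type} [NormedAddCommGroup V] [InnerProductSpace ℝ V] [FiniteDimensional ℝ V]
  [MeasurableSpace V] [BorelSpace V]

theorem exists_isFourierInv_add {h : V → ℂ} (hm : StronglyMeasurable h) {s : ℝ} (hs1 : 1 ≤ s)
    (hs2 : s ≤ 2) (hN : ∫⁻ x, ENNReal.ofReal (‖h x‖ ^ s) ≤ 1) {κ : ℝ} (hκ : 0 < κ) :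
    ∃ v w : V → ℂ, MemLp v ⊤ ∧ MemLp w 2 ∧ (∀ x, ‖v x‖ₑ ≤ ENNReal.ofReal (κ ^ (1 - s))) ∧
      eLpNorm w 2 = eLpNorm ({x | ‖h x‖ ≤ κ}.indicator h) 2 ∧ IsFourierInv h (v + w) := by
  have hS : MeasurableSet {x | ‖h x‖ ≤ κ} := measurableSet_le hm.norm.measurable measurable_const
  have hlarge := eLpNorm_one_indicator_compl_le hs1 hN hκ
  have hlarge' : MemLp ({x | ‖h x‖ ≤ κ}ᶜ.indicator h) 1 :=
    ⟨(hm.indicator hS.compl).aestronglyMeasurable, hlarge.trans_lt ENNReal.ofReal_lt_top⟩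
  have hsmall : MemLp ({x | ‖h x‖ ≤ κ}.indicator h) 2 :=
    ⟨(hm.indicator hS).aestronglyMeasurable, eLpNorm_two_indicator_lt_top hs2 hN κ⟩
  obtain ⟨v, hvm, hv, hvF⟩ := exists_isFourierInv_of_memLp_one hlarge'
  obtain ⟨w, hw, hwn, hwF⟩ := exists_isFourierInv_of_memLp_two hsmall
  have hvL : MemLp v ⊤ := ⟨hvm, eLpNorm_exponent_top.trans_lt
    ((eLpNormEssSup_le_of_ae_enorm_bound (.of_forall hv)).trans_lt hlarge'.2)⟩
  refine ⟨v, w, hvL, hw, fun x => (hv x).trans hlarge, hwn, ?_⟩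
  simpa only [Set.indicator_compl_add_self] using
    hvF.add hwF le_rfl one_le_two le_top one_le_two hlarge' hsmall hvL hw

theorem exists_isFourierInv_measure_le {h : V → ℂ} (hm : StronglyMeasurable h) {s : ℝ}
    (hs1 : 1 ≤ s) (hs2 : s ≤ 2) (hN : ∫⁻ x, ENNReal.ofReal (‖h x‖ ^ s) ≤ 1) :
    ∃ u : V → ℂ, AEStronglyMeasurable u ∧ IsFourierInv h u ∧ ∀ κ : ℝ, 0 < κ →
      ENNReal.ofReal (κ ^ (1 - s)) ^ 2 *
          volume {x | 2 * ENNReal.ofReal (κ ^ (1 - s)) < ‖u x‖ₑ} ≤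
        eLpNorm ({x | ‖h x‖ ≤ κ}.indicator h) 2 ^ 2 := by
  obtain ⟨v₁, w₁, hv₁, hw₁, -, -, hF₁⟩ := exists_isFourierInv_add hm hs1 hs2 hN one_pos
  refine ⟨v₁ + w₁, hv₁.1.add hw₁.1, hF₁, fun κ hκ => ?_⟩
  obtain ⟨v, w, hv, hw, hvb, hwn, hF⟩ := exists_isFourierInv_add hm hs1 hs2 hN hκ
  have hae : v₁ + w₁ =ᵐ[volume] v + w := hF₁.ae_eq hF
    ((hv₁.locallyIntegrable le_top).add (hw₁.locallyIntegrable one_le_two))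
    ((hv.locallyIntegrable le_top).add (hw.locallyIntegrable one_le_two))
  rw [← hwn]
  refine (mul_le_mul_right (measure_mono_ae ?_) _).trans (sq_mul_measure_lt_enorm_add_le hvb hw.1)
  filter_upwards [hae] with x hx hlt
  have hlt' : _ < ‖(v₁ + w₁) x‖ₑ := hlt
  rwa [hx] at hlt'

theorem measure_lt_norm_mul_rpow_le {h u : V → ℂ} {s t l : ℝ} (hst : s.HolderConjugate t)
    (hl : 0 < l)
    (hu : ∀ κ : ℝ, 0 < κ → ENNReal.ofReal (κ ^ (1 - s)) ^ 2 *
        volume {x | 2 * ENNReal.ofReal (κ ^ (1 - s)) < ‖u x‖ₑ} ≤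
      eLpNorm ({x | ‖h x‖ ≤ κ}.indicator h) 2 ^ 2) :
    volume {x | l < ‖u x‖} * ENNReal.ofReal (l ^ (t - 1)) ≤
      ∫⁻ x, {l : ℝ | ‖h x‖ ≤ (2 / l) ^ (t - 1)}.indicator
        (fun l => ENNReal.ofReal (4 * ‖h x‖ ^ 2 * l ^ (t - 3))) l := by
  set κ := (2 / l) ^ (t - 1)
  have hheight : κ ^ (1 - s) = l / 2 := by
    rw [← Real.rpow_mul (by positivity),
      show (t - 1) * (1 - s) = -1 by linear_combination -hst.mul_eq_add, Real.rpow_neg_one, inv_div]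
  have hpow : ENNReal.ofReal (l ^ (t - 1)) =
      ENNReal.ofReal (4 * l ^ (t - 3)) * ENNReal.ofReal (l / 2) ^ 2 := by
    rw [← ENNReal.ofReal_pow (by positivity), ← ENNReal.ofReal_mul (by positivity),
      show t - 1 = (t - 3) + 2 by ring, Real.rpow_add hl, Real.rpow_two]
    ring_nf
  have hlevel : {x | 2 * ENNReal.ofReal (l / 2) < ‖u x‖ₑ} = {x | l < ‖u x‖} := by
    ext x
    rw [Set.mem_ofPred_eq, Set.mem_ofPred_eq, ← ENNReal.ofReal_ofNat 2,
      ← ENNReal.ofReal_mul (by norm_num), mul_div_cancel₀ l two_ne_zero, ← ofReal_norm,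
      ENNReal.ofReal_lt_ofReal_iff_of_nonneg hl.le]
  have hbound := hu κ (by positivity)
  rw [hheight, hlevel, eLpNorm_two_sq_eq_lintegral] at hbound
  rw [hpow, mul_comm, mul_assoc]
  refine (mul_le_mul_right hbound _).trans_eq ?_
  rw [← lintegral_const_mul' _ _ ENNReal.ofReal_ne_top]
  congr with x
  by_cases hx : ‖h x‖ ≤ κ
  · rw [Set.indicator_of_mem (by exact hx), Set.indicator_of_mem (by exact hx),
      ← ENNReal.ofReal_mul (by positivity), mul_right_comm]
  · rw [Set.indicator_of_notMem (by exact hx), Set.indicator_of_notMem (by exact hx)]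
    simp

/-- Marcinkiewicz interpolation between the `L¹` and the `L²` bounds: the layer-cake formula, with
the truncation height of `h` adapted to each level of `u`. -/
theorem exists_isFourierInv_lintegral_le {h : V → ℂ} (hm : StronglyMeasurable h) {s t : ℝ}
    (hst : s.HolderConjugate t) (hs : s < 2) (hN : ∫⁻ x, ENNReal.ofReal (‖h x‖ ^ s) ≤ 1) :
    ∃ u : V → ℂ, AEStronglyMeasurable u ∧ IsFourierInv h u ∧
      ∫⁻ x, ENNReal.ofReal (‖u x‖ ^ t) ≤ ENNReal.ofReal (t * (4 * 2 ^ (t - 2) / (t - 2))) := by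
  have ht : 2 < t := by nlinarith [hst.mul_eq_add, hst.lt]
  obtain ⟨u, hum, hF, hu⟩ := exists_isFourierInv_measure_le hm hst.lt.le hs.le hN
  refine ⟨u, hum, hF, ?_⟩
  let G : ℝ → V → ℝ≥0∞ := fun l x => {l : ℝ | ‖h x‖ ≤ (2 / l) ^ (t - 1)}.indicator
    (fun l => ENNReal.ofReal (4 * ‖h x‖ ^ 2 * l ^ (t - 3))) l
  have hG : Measurable (Function.uncurry G) := by
    have := hm.norm.measurable
    exact Measurable.indicator (s := {p : ℝ × V | ‖h p.2‖ ≤ (2 / p.1) ^ (t - 1)})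
      (f := fun p => ENNReal.ofReal (4 * ‖h p.2‖ ^ 2 * p.1 ^ (t - 3))) (by fun_prop)
      (measurableSet_le (by fun_prop) (by fun_prop))
  rw [lintegral_rpow_eq_lintegral_meas_lt_mul volume (.of_forall fun x => norm_nonneg _)
    hum.norm.aemeasurable (by linarith), ENNReal.ofReal_mul (by linarith)]
  gcongr
  calc _ ≤ ∫⁻ l in Set.Ioi (0 : ℝ), ∫⁻ x, G l x :=
        setLIntegral_mono' measurableSet_Ioi fun l hl => measure_lt_norm_mul_rpow_le hst hl hu
    _ = ∫⁻ x, ∫⁻ l in Set.Ioi (0 : ℝ), G l x := lintegral_lintegral_swap hG.aemeasurable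
    _ ≤ ∫⁻ x, ENNReal.ofReal (4 * 2 ^ (t - 2) / (t - 2)) * ENNReal.ofReal (‖h x‖ ^ s) :=
        lintegral_mono fun x => lintegral_truncated_rpow_le hst ht (norm_nonneg _)
    _ ≤ _ := by
        rw [lintegral_const_mul' _ _ ENNReal.ofReal_ne_top]
        exact mul_le_of_le_one_right zero_le hN

theorem exists_isFourierInv_of_eLpNorm_le_one {s t : ℝ≥0∞} [s.HolderConjugate t] (hs : s ≤ 2) :
    ∃ C ≠ (⊤ : ℝ≥0∞), ∀ h : V → ℂ, StronglyMeasurable h → eLpNorm h s ≤ 1 →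
      ∃ u : V → ℂ, AEStronglyMeasurable u ∧ IsFourierInv h u ∧ eLpNorm u t ≤ C := by
  rcases (ENNReal.HolderConjugate.one_le s t).eq_or_lt with rfl | hs1
  · obtain rfl : t = ⊤ := ENNReal.HolderConjugate.unique 1 t ⊤
    refine ⟨1, ENNReal.one_ne_top, fun h hm hh => ?_⟩
    obtain ⟨u, hum, hu, hF⟩ :=
      exists_isFourierInv_of_memLp_one ⟨hm.aestronglyMeasurable, hh.trans_lt ENNReal.one_lt_top⟩
    exact ⟨u, hum, hF, eLpNorm_exponent_top.trans_le
      (eLpNormEssSup_le_of_ae_enorm_bound (.of_forall fun x => (hu x).trans hh))⟩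
  rcases hs.eq_or_lt with rfl | hs2
  · obtain rfl : t = 2 := ENNReal.HolderConjugate.unique 2 t 2
    refine ⟨1, ENNReal.one_ne_top, fun h hm hh => ?_⟩
    obtain ⟨u, hu, hn, hF⟩ :=
      exists_isFourierInv_of_memLp_two ⟨hm.aestronglyMeasurable, hh.trans_lt ENNReal.one_lt_top⟩
    exact ⟨u, hu.1, hF, hn.trans_le hh⟩
  have hsT : s ≠ ⊤ := (hs2.trans ENNReal.ofNat_lt_top).ne
  have hs0 : s ≠ 0 := (zero_lt_one.trans hs1).ne'
  have htT : t ≠ ⊤ := (ENNReal.HolderConjugate.lt_top_iff_one_lt t s).2 hs1 |>.ne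
  have ht0 : t ≠ 0 := ENNReal.HolderConjugate.ne_zero t s
  have hst : s.toReal.HolderConjugate t.toReal :=
    ENNReal.HolderConjugate.toReal_of_ne_top hsT htT
  have hs2' : s.toReal < 2 := ENNReal.toReal_lt_of_lt_ofReal (by simpa using hs2)
  set t' := t.toReal
  refine ⟨ENNReal.ofReal (t' * (4 * 2 ^ (t' - 2) / (t' - 2))) ^ t'⁻¹,
    ENNReal.rpow_ne_top_of_nonneg (by positivity) ENNReal.ofReal_ne_top, fun h hm hh => ?_⟩
  have hN : ∫⁻ x, ENNReal.ofReal (‖h x‖ ^ s.toReal) ≤ 1 := by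
    rw [← eLpNorm_rpow_toReal_eq_lintegral_ofReal hs0 hsT]
    exact ENNReal.rpow_le_one hh ENNReal.toReal_nonneg
  obtain ⟨u, hum, hF, hu⟩ := exists_isFourierInv_lintegral_le hm hst hs2' hN
  rw [← eLpNorm_rpow_toReal_eq_lintegral_ofReal ht0 htT] at hu
  exact ⟨u, hum, hF, (ENNReal.le_rpow_inv_iff hst.symm.pos).2 hu⟩

theorem hausdorff_young {s t : ℝ≥0∞} [s.HolderConjugate t] (hs : s ≤ 2) :
    ∃ C ≠ (⊤ : ℝ≥0∞), ∀ h : V → ℂ, MemLp h s → ∃ u : V → ℂ, MemLp u t ∧ IsFourierInv h u ∧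
      eLpNorm u t ≤ C * eLpNorm h s := by
  obtain ⟨C, hC, hnormalized⟩ := exists_isFourierInv_of_eLpNorm_le_one (V := V) (t := t) hs
  refine ⟨C, hC, fun h hh => ?_⟩
  rcases eq_or_ne (eLpNorm h s) 0 with h₀ | h₀
  · have hz : h =ᵐ[volume] 0 :=
      (eLpNorm_eq_zero_iff hh.1 (ENNReal.HolderConjugate.ne_zero s t)).1 h₀
    have hF : IsFourierInv (0 : V → ℂ) 0 := fun χ => by simp
    exact ⟨0, MemLp.zero, hF.congr hz.symm, by simp⟩
  set c : ℂ := ((eLpNorm h s).toReal : ℂ)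
  have hc : ‖c‖ₑ = eLpNorm h s := by
    rw [← ofReal_norm, Complex.norm_of_nonneg ENNReal.toReal_nonneg,
      ENNReal.ofReal_toReal hh.2.ne]
  have hc₀ : c ≠ 0 := enorm_ne_zero.1 (hc ▸ h₀)
  obtain ⟨h', hm, hae⟩ := hh.1
  have hone : eLpNorm (c⁻¹ • h') s = 1 := by
    rw [eLpNorm_const_smul, enorm_inv hc₀, hc, eLpNorm_congr_ae hae]
    exact ENNReal.inv_mul_cancel (eLpNorm_congr_ae hae ▸ h₀) (eLpNorm_congr_ae hae ▸ hh.2.ne)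
  obtain ⟨u, hum, hF, hu⟩ := hnormalized _ (hm.const_smul c⁻¹) hone.le
  have hcu : eLpNorm (c • u) t ≤ C * eLpNorm h s := by
    rw [eLpNorm_const_smul, hc, mul_comm]
    gcongr
  refine ⟨c • u, ⟨hum.const_smul c, hcu.trans_lt (ENNReal.mul_lt_top hC.lt_top hh.2)⟩,
    (hF.const_mul c).congr ?_, hcu⟩
  filter_upwards [hae] with x hx
  rw [Pi.smul_apply, smul_eq_mul, mul_inv_cancel_left₀ hc₀, hx]

end HausdorffYoung

section Localization

variable {E : Type} [NormedAddCommGroup E] [NormedSpace ℝ E]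

/-- Multiplication of Schwartz functions by the translate of the window `G` to `z`, which by duality
localizes distributions near `z`. -/
def localize (G : 𝓢(E, ℂ)) (z : E) : 𝓢(E, ℂ) →L[ℂ] 𝓢(E, ℂ) :=
  smulLeftCLM ℂ (compSubConstCLM ℂ z G)

theorem localize_apply (G : 𝓢(E, ℂ)) (z : E) (χ : 𝓢(E, ℂ)) (w : E) :
    localize G z χ w = G (w - z) * χ w := by
  rw [localize, smulLeftCLM_apply_apply (SchwartzMap.hasTemperateGrowth _),
    compSubConstCLM_apply, smul_eq_mul]

theorem localize_comm (G : 𝓢(E, ℂ)) (z z' : E) (χ : 𝓢(E, ℂ)) :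
    localize G z (localize G z' χ) = localize G z' (localize G z χ) := by
  ext w
  simp only [localize_apply]
  ring

variable [FiniteDimensional ℝ E] [MeasurableSpace E] [BorelSpace E] {μ : Measure E}
  [μ.IsAddHaarMeasure]

theorem integral_apply_localize (T : 𝓢(E, ℂ) →L[ℂ] ℂ) (G Φ : 𝓢(E, ℂ)) :
    ∫ z, T (localize G z Φ) ∂μ = (∫ w, G w ∂μ) * T Φ := by
  have := Measure.IsAddHaarMeasure.isNegInvariant_of_regular μ
  let shear : (E × E) ≃L[ℝ] E × E := (ContinuousLinearEquiv.prodComm ℝ E E).trans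
    ((ContinuousLinearEquiv.refl ℝ E).skewProd (.neg ℝ) (.id ℝ E))
  let K : 𝓢(E × E, ℂ) := compCLMOfContinuousLinearEquiv ℂ shear (tensor Φ G)
  have hK (z w) : K (z, w) = G (w - z) * Φ w := by
    simp [K, shear, mul_comm, neg_add_eq_sub]
  have hintegral : integralFst μ K = (∫ w, G w ∂μ) • Φ := by
    ext w
    simp only [integralFst_apply, hK, smul_apply, smul_eq_mul, integral_mul_const,
      integral_sub_left_eq_self (fun z => G z) μ w]
  have hslice (z) : slice z K = localize G z Φ := by
    ext w
    rw [slice_apply, hK, localize_apply]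
  have h := distribution_integralFst μ T K
  simp only [hintegral, hslice, map_smul, smul_eq_mul] at h
  exact h.symm

theorem ae_eq_of_localize {T : 𝓢(E, ℂ) →L[ℂ] ℂ} {G : 𝓢(E, ℂ)} {q : ℝ≥0∞} (hq : 1 ≤ q) {z z' : E}
    {u u' : E → ℂ} (hu : MemLp u q μ) (hu' : MemLp u' q μ)
    (hT : ∀ χ, T (localize G z χ) = ∫ w, χ w * u w ∂μ)
    (hT' : ∀ χ, T (localize G z' χ) = ∫ w, χ w * u' w ∂μ) :
    (fun w => G (w - z') * u w) =ᵐ[μ] fun w => G (w - z) * u' w := by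
  have hloc (z : E) {u : E → ℂ} (hu : MemLp u q μ) :
      LocallyIntegrable (fun w => G (w - z) * u w) μ := by
    simpa only [compSubConstCLM_apply] using
      (integrable_schwartz_mul hq hu (compSubConstCLM ℂ z G)).locallyIntegrable
  refine ae_eq_of_integral_schwartz_mul_eq (hloc z' hu) (hloc z hu') fun χ => ?_
  have h := hT' (localize G z χ)
  rw [localize_comm, hT] at h
  simp only [localize_apply] at h
  simpa only [mul_assoc, mul_left_comm (χ _)] using h

theorem exists_forall_ae_eq_mul_comp_sub {T : 𝓢(E, ℂ) →L[ℂ] ℂ} {G : 𝓢(E, ℂ)} (hG : ∀ w, G w ≠ 0)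
    {q : ℝ≥0∞} (hq : 1 ≤ q) {z₀ : E} {u₀ : E → ℂ} (hu₀ : MemLp u₀ q μ)
    (hT₀ : ∀ χ, T (localize G z₀ χ) = ∫ w, χ w * u₀ w ∂μ) :
    ∃ A : E → ℂ, StronglyMeasurable A ∧ ∀ (z : E) (u : E → ℂ), MemLp u q μ →
      (∀ χ, T (localize G z χ) = ∫ w, χ w * u w ∂μ) → u =ᵐ[μ] fun w => A w * G (w - z) := by
  obtain ⟨v₀, hv₀, hae₀⟩ := hu₀.1
  refine ⟨fun w => v₀ w / G (w - z₀),
    hv₀.div (G.continuous.comp (continuous_sub_right z₀)).stronglyMeasurable, fun z u hu hT => ?_⟩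
  filter_upwards [ae_eq_of_localize hq hu hu₀ hT hT₀, hae₀] with w hw hw₀
  rw [← hw₀, div_mul_eq_mul_div, eq_div_iff (hG _)]
  linear_combination hw

theorem eLpNorm_eLpNorm_mul_comp_sub_eq {A G : E → ℂ} (hA : StronglyMeasurable A)
    (hG : Continuous G) {q : ℝ≥0∞} (hq : q ≠ 0) (hGq : eLpNorm G q μ ≠ ⊤) :
    eLpNorm (fun z => eLpNorm (fun w => A w * G (w - z)) q μ) q μ =
      eLpNorm A q μ * eLpNorm G q μ := by
  have := Measure.IsAddHaarMeasure.isNegInvariant_of_regular μ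
  let K : E × E → ℝ≥0∞ := fun u => ‖A u.2‖ₑ * ‖G (u.2 - u.1)‖ₑ
  have hK : Measurable K := (hA.measurable.comp measurable_snd).enorm.mul
    (hG.comp (continuous_snd.sub continuous_fst)).enorm.measurable
  have htranslate (w : E) : eLpNorm (fun z => ‖G (w - z)‖ₑ) q μ = eLpNorm G q μ := by
    rw [eLpNorm_enorm]
    exact eLpNorm_comp_measurePreserving (f := fun z => w - z) hG.aestronglyMeasurable
      (Measure.measurePreserving_sub_left μ w)
  calc eLpNorm (fun z => eLpNorm (fun w => A w * G (w - z)) q μ) q μ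
      = eLpNorm (fun z => eLpNorm (fun w => K (z, w)) q μ) q μ := by
        congr with z
        rw [← eLpNorm_enorm]
        simp only [enorm_mul, K]
    _ = eLpNorm (fun w => eLpNorm (fun z => K (z, w)) q μ) q μ :=
        eLpNorm_eLpNorm_comm hK hq
    _ = eLpNorm (fun w => eLpNorm G q μ * ‖A w‖ₑ) q μ := by
        congr with w
        simp only [K]
        rw [eLpNorm_const_mul enorm_ne_top, htranslate, mul_comm]
    _ = eLpNorm A q μ * eLpNorm G q μ := by
        rw [eLpNorm_const_mul hGq, eLpNorm_enorm, mul_comm]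

theorem apply_eq_integral_of_localize {T : 𝓢(E, ℂ) →L[ℂ] ℂ} {G : 𝓢(E, ℂ)}
    (hG : ∫ w, G w ∂μ ≠ 0) {A : E → ℂ} {Φ : 𝓢(E, ℂ)} (hA : Integrable (fun w => Φ w * A w) μ)
    (hT : ∀ᵐ z ∂μ, T (localize G z Φ) = ∫ w, Φ w * (A w * G (w - z)) ∂μ) :
    T Φ = ∫ w, Φ w * A w ∂μ := by
  have := Measure.IsAddHaarMeasure.isNegInvariant_of_regular μ
  have hint : Integrable (fun p : E × E => Φ p.2 * (A p.2 * G (p.2 - p.1))) (μ.prod μ) := by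
    simpa only [ContinuousLinearMap.mul_apply', neg_sub, mul_assoc] using
      hA.convolution_integrand (ContinuousLinearMap.mul ℂ ℂ) (G.integrable (μ := μ)).comp_neg
  refine mul_left_cancel₀ hG ?_
  calc (∫ w, G w ∂μ) * T Φ = ∫ z, T (localize G z Φ) ∂μ := (integral_apply_localize T G Φ).symm
    _ = ∫ z, ∫ w, Φ w * (A w * G (w - z)) ∂μ ∂μ := integral_congr_ae hT
    _ = ∫ w, ∫ z, Φ w * (A w * G (w - z)) ∂μ ∂μ := integral_integral_swap hint
    _ = (∫ w, G w ∂μ) * ∫ w, Φ w * A w ∂μ := by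
        simp only [← mul_assoc, integral_const_mul, integral_mul_const,
          integral_sub_left_eq_self (fun z => G z) μ]
        rw [mul_comm]

theorem exists_memLp_of_localize {T : 𝓢(E, ℂ) →L[ℂ] ℂ} {G : 𝓢(E, ℂ)} (hG : ∀ w, G w ≠ 0)
    (hGint : ∫ w, G w ∂μ ≠ 0) {q : ℝ≥0∞} (hq : 1 ≤ q) {N : E → ℝ≥0∞} (hN : eLpNorm N q μ ≠ ⊤)
    (hT : ∀ᵐ z ∂μ, ∃ u : E → ℂ, MemLp u q μ ∧
      (∀ χ, T (localize G z χ) = ∫ w, χ w * u w ∂μ) ∧ eLpNorm u q μ ≤ N z) :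
    ∃ A : E → ℂ, MemLp A q μ ∧ (∀ Φ, T Φ = ∫ w, Φ w * A w ∂μ) ∧
      eLpNorm A q μ * eLpNorm G q μ ≤ eLpNorm N q μ := by
  have hq₀ : q ≠ 0 := (zero_lt_one.trans_le hq).ne'
  obtain ⟨z₀, u₀, hu₀, hT₀, -⟩ := hT.exists
  obtain ⟨A, hA, huA⟩ := exists_forall_ae_eq_mul_comp_sub hG hq hu₀ hT₀
  have hnorm : eLpNorm A q μ * eLpNorm G q μ ≤ eLpNorm N q μ := by
    rw [← eLpNorm_eLpNorm_mul_comp_sub_eq hA G.continuous hq₀ (G.memLp q μ).2.ne]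
    refine eLpNorm_mono_enorm_ae ?_
    filter_upwards [hT] with z ⟨u, hu, hTu, hle⟩
    simpa only [enorm_eq_self, eLpNorm_congr_ae (huA z u hu hTu)] using hle
  have hAq : MemLp A q μ := by
    refine ⟨hA.aestronglyMeasurable, lt_top_iff_ne_top.2 fun h => hN (top_le_iff.1 ?_)⟩
    rwa [h, ENNReal.top_mul (eLpNorm_ne_zero_of_continuous G.continuous (hG 0) hq₀)] at hnorm
  refine ⟨A, hAq, fun Φ => ?_, hnorm⟩
  refine apply_eq_integral_of_localize hGint (integrable_schwartz_mul hq hAq Φ) ?_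
  filter_upwards [hT] with z ⟨u, hu, hTu, _⟩
  rw [hTu]
  refine integral_congr_ae ?_
  filter_upwards [huA z u hu hTu] with w hw
  rw [hw]

end Localization

section ProductFourier

variable {d : ℕ}

/-- The identity from the `ℓ²` product of `ℝᵈ` with itself, on which the Fourier transform is
defined, to the plain product, whose norm is the maximum norm. -/
def euclideanEquiv : WithLp 2 (Rd d × Rd d) ≃L[ℝ] Rd d × Rd d :=
  WithLp.prodContinuousLinearEquiv 2 ℝ (Rd d) (Rd d)

theorem measurePreserving_euclideanEquiv :
    MeasurePreserving (euclideanEquiv (d := d)) volume volume :=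
  WithLp.volume_preserving_ofLp (Rd d) (Rd d)

theorem measurePreserving_euclideanEquiv_symm :
    MeasurePreserving (euclideanEquiv (d := d)).symm volume volume :=
  WithLp.volume_preserving_toLp (Rd d) (Rd d)

theorem measurableEmbedding_euclideanEquiv : MeasurableEmbedding (euclideanEquiv (d := d)) :=
  (euclideanEquiv (d := d)).toHomeomorph.measurableEmbedding

/-- The inverse Fourier transform of Schwartz functions on `ℝᵈ × ℝᵈ`. -/
def prodFourierInv (χ : 𝓢(Rd d × Rd d, ℂ)) : 𝓢(Rd d × Rd d, ℂ) :=
  compCLMOfContinuousLinearEquiv ℂ euclideanEquiv.symm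
    (𝓕⁻ (compCLMOfContinuousLinearEquiv ℂ euclideanEquiv χ))

theorem prodFourierInv_euclideanEquiv (χ : 𝓢(Rd d × Rd d, ℂ)) (v : WithLp 2 (Rd d × Rd d)) :
    prodFourierInv χ (euclideanEquiv v) =
      (𝓕⁻ (compCLMOfContinuousLinearEquiv ℂ euclideanEquiv χ)) v := by
  simp [prodFourierInv]

theorem integral_prodFourierInv_mul_character (χ : 𝓢(Rd d × Rd d, ℂ)) (w : Rd d × Rd d) :
    ∫ ζ, prodFourierInv χ ζ * character ζ w = χ w := by
  set X := compCLMOfContinuousLinearEquiv ℂ (euclideanEquiv (d := d)) χ with hX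
  have hinv : (𝓕 (𝓕⁻ X)) (euclideanEquiv.symm w) = χ w := by
    rw [FourierTransform.fourier_fourierInv_eq]
    simp [X]
  rw [← hinv, SchwartzMap.fourier_coe, Real.fourier_eq',
    ← measurePreserving_euclideanEquiv.integral_comp measurableEmbedding_euclideanEquiv]
  congr 1 with v
  rw [prodFourierInv_euclideanEquiv, smul_eq_mul, mul_comm, ← hX, character, ← Complex.exp_add,
    ← add_mul, ← Complex.ofReal_add, ← mul_add]
  congr 5
  rw [WithLp.prod_inner_apply, real_inner_comm, real_inner_comm _ w.2]
  rfl

theorem hausdorff_young_prod {s t : ℝ≥0∞} [s.HolderConjugate t] (hs : s ≤ 2) :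
    ∃ C ≠ (⊤ : ℝ≥0∞), ∀ h : Rd d × Rd d → ℂ, MemLp h s → ∃ u : Rd d × Rd d → ℂ, MemLp u t ∧
      (∀ χ : 𝓢(Rd d × Rd d, ℂ), ∫ w, χ w * u w = ∫ ζ, prodFourierInv χ ζ * h ζ) ∧
      eLpNorm u t ≤ C * eLpNorm h s := by
  obtain ⟨C, hC, H⟩ := hausdorff_young (V := WithLp 2 (Rd d × Rd d)) (t := t) hs
  have hmp := measurePreserving_euclideanEquiv (d := d)
  have hmp' := measurePreserving_euclideanEquiv_symm (d := d)
  have hme := measurableEmbedding_euclideanEquiv (d := d)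
  refine ⟨C, hC, fun h hh => ?_⟩
  obtain ⟨u, hu, hF, hb⟩ := H (h ∘ euclideanEquiv) (hh.comp_measurePreserving hmp)
  refine ⟨u ∘ euclideanEquiv.symm, hu.comp_measurePreserving hmp', fun χ => ?_, ?_⟩
  · rw [← hmp.integral_comp hme, ← hmp.integral_comp hme]
    simpa only [prodFourierInv_euclideanEquiv, Function.comp_apply,
      ContinuousLinearEquiv.symm_apply_apply, compCLMOfContinuousLinearEquiv_apply] using
      hF (compCLMOfContinuousLinearEquiv ℂ euclideanEquiv χ)
  · rw [eLpNorm_comp_measurePreserving hu.1 hmp']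
    rwa [eLpNorm_comp_measurePreserving hh.1 hmp] at hb

theorem apply_localize_gauss2_eq_integral (T : 𝓢'(Rd d × Rd d, ℂ)) (z : Rd d × Rd d)
    (χ : 𝓢(Rd d × Rd d, ℂ)) :
    T (localize gauss2 z χ) = ∫ ζ, prodFourierInv χ ζ * T (gaussAtom z ζ) := by
  let Φ : 𝓢((Rd d × Rd d) × (Rd d × Rd d), ℂ) :=
    smulLeftCLM ℂ (fun u : (Rd d × Rd d) × (Rd d × Rd d) => character u.1 u.2)
      (tensor (prodFourierInv χ) (compSubConstCLM ℂ z gauss2))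
  have hΦ (ζ w) : Φ (ζ, w) = prodFourierInv χ ζ * (character ζ w * gauss2 (w - z)) := by
    simp only [Φ]
    rw [smulLeftCLM_apply_apply hasTemperateGrowth_character_uncurry, tensor_apply,
      compSubConstCLM_apply, smul_eq_mul]
    ring
  have hintegral : integralFst volume Φ = localize gauss2 z χ := by
    ext w
    rw [integralFst_apply, localize_apply, ← integral_prodFourierInv_mul_character χ w,
      ← integral_const_mul]
    congr with ζ
    rw [hΦ]
    ring
  have hslice (ζ) : slice ζ Φ = prodFourierInv χ ζ • gaussAtom z ζ := by
    ext w
    rw [slice_apply, hΦ, smul_apply, gaussAtom_apply, smul_eq_mul]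
  simpa only [hintegral, hslice, map_smul, smul_eq_mul, toCLM_apply] using
    distribution_integralFst volume (toCLM T) Φ

end ProductFourier

section ConjugateExponents

theorem one_sub_inv_eq_inv (s q : ℝ≥0∞) [s.HolderConjugate q] : 1 - s⁻¹ = q⁻¹ := by
  rw [← ENNReal.HolderConjugate.inv_add_inv_eq_one s q]
  exact ENNReal.add_sub_cancel_left
    (ENNReal.inv_ne_top.2 (ENNReal.HolderConjugate.ne_zero s q))

theorem le_two_iff_two_le (s q : ℝ≥0∞) [s.HolderConjugate q] : s ≤ 2 ↔ 2 ≤ q := by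
  rw [← ENNReal.inv_le_inv, ← ENNReal.inv_le_inv (a := q), ← one_sub_inv_eq_inv s q,
    tsub_le_iff_left, ← tsub_le_iff_right, ENNReal.one_sub_inv_two]

theorem exists_holderConjugate_ge {s q p₁ p₂ : ℝ≥0∞} [s.HolderConjugate q] (hsq : s ≤ q)
    (h₁ : p₁ ≤ q) (h₂ : p₂ ≤ q) (hp : 1 ≤ p₁⁻¹ + p₂⁻¹) :
    ∃ P₁ P₂ : ℝ≥0∞, P₁.HolderConjugate P₂ ∧ p₁ ≤ P₁ ∧ p₂ ≤ P₂ ∧ s ≤ P₁ ∧ s ≤ P₂ := by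
  have hone : 1 ≤ max p₁ s := (ENNReal.HolderConjugate.one_le s q).trans (le_max_right _ _)
  refine ⟨max p₁ s, (1 - (max p₁ s)⁻¹)⁻¹, .inv_one_sub_inv' hone, le_max_left _ _, ?_,
    le_max_right _ _, ?_⟩
  · rw [ENNReal.le_inv_iff_le_inv]
    rcases le_total p₁ s with h | h
    · rw [max_eq_right h, one_sub_inv_eq_inv s q]
      exact ENNReal.inv_le_inv.2 h₂
    · rw [max_eq_left h]
      exact tsub_le_iff_left.2 hp
  · have : q.HolderConjugate s := .symm
    rw [ENNReal.le_inv_iff_le_inv, ← one_sub_inv_eq_inv q s]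
    exact tsub_le_tsub_left (ENNReal.inv_le_inv.2 (max_le h₁ hsq)) _

theorem inv_div_add_inv_div_eq {s : ℝ≥0∞} (q : ℝ≥0∞) [s.HolderConjugate q] (hs : s ≠ ⊤)
    (P₁ P₂ : ℝ≥0∞) [P₁.HolderConjugate P₂] : (P₁ / s)⁻¹ + (P₂ / s)⁻¹ = 1 + (q / s)⁻¹ := by
  have hs₀ : s ≠ 0 := ENNReal.HolderConjugate.ne_zero s q
  have hinv (P : ℝ≥0∞) : (P / s)⁻¹ = s * P⁻¹ := by
    rw [ENNReal.inv_div (.inl hs) (.inl hs₀), div_eq_mul_inv]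
  calc _ = s * (P₁⁻¹ + P₂⁻¹) := by rw [hinv, hinv, mul_add]
    _ = s * (s⁻¹ + q⁻¹) := by
      rw [ENNReal.HolderConjugate.inv_add_inv_eq_one, ENNReal.HolderConjugate.inv_add_inv_eq_one]
    _ = _ := by rw [mul_add, ENNReal.mul_inv_cancel hs₀ hs, hinv]

end ConjugateExponents

section Correlation

variable {G H : Type*} [AddCommGroup G] [MeasurableSpace G] [AddCommGroup H] [MeasurableSpace H]

theorem eLpNorm_mul_comp_sub_eq_lconvolution {μ : Measure G} (F₁ F₂ : G → ℝ≥0∞) {s : ℝ≥0∞}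
    (hs₀ : s ≠ 0) (hs : s ≠ ⊤) (z : G) :
    eLpNorm (fun w => F₁ w * F₂ (w - z)) s μ =
      ((fun w => F₁ w ^ s.toReal) ⋆ₗ[μ] fun w => F₂ (-w) ^ s.toReal) z ^ s.toReal⁻¹ := by
  rw [eLpNorm_eq_lintegral_rpow hs₀ hs]
  simp only [lconvolution_def, ENNReal.mul_rpow_of_nonneg _ _ ENNReal.toReal_nonneg,
    neg_add_eq_sub, neg_sub]

variable [MeasurableAdd₂ G] [MeasurableNeg G] [MeasurableAdd₂ H] [MeasurableNeg H]
  {κ : Measure G} [SigmaFinite κ] [κ.IsAddLeftInvariant] [κ.IsNegInvariant]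
  {η : Measure H} [SigmaFinite η] [η.IsAddLeftInvariant] [η.IsNegInvariant]

theorem eLpNorm_eLpNorm_mul_comp_sub_le {F₁ F₂ : G × H → ℝ≥0∞} (hF₁ : Measurable F₁)
    (hF₂ : Measurable F₂) {s q P₁ P₂ Q₁ Q₂ : ℝ≥0∞} [s.HolderConjugate q] [P₁.HolderConjugate P₂]
    [Q₁.HolderConjugate Q₂] (hs : s ≤ 2)
    (hP₁ : s ≤ P₁) (hP₂ : s ≤ P₂) (hQ₁ : s ≤ Q₁) (hQ₂ : s ≤ Q₂) :
    eLpNorm (fun z => eLpNorm (fun w => F₁ w * F₂ (w - z)) s (κ.prod η)) q (κ.prod η) ≤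
      mixedNorm κ η P₁ Q₁ F₁ * mixedNorm κ η P₂ Q₂ F₂ := by
  have hsq : s ≤ q := hs.trans ((le_two_iff_two_le s q).1 hs)
  have hs₀ : s ≠ 0 := ENNReal.HolderConjugate.ne_zero s q
  have hs' : s ≠ ⊤ := (hs.trans_lt ENNReal.ofNat_lt_top).ne
  have hr : 0 < s.toReal := ENNReal.toReal_pos hs₀ hs'
  have hmul (P : ℝ≥0∞) : P / s * ENNReal.ofReal s.toReal = P := by
    rw [ENNReal.ofReal_toReal hs', ENNReal.div_mul_cancel hs₀ hs']
  have hdiv : q * ENNReal.ofReal s.toReal⁻¹ = q / s := by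
    rw [ENNReal.ofReal_inv_of_pos hr, ENNReal.ofReal_toReal hs', div_eq_mul_inv]
  have hone {P : ℝ≥0∞} (hP : s ≤ P) : 1 ≤ P / s := by
    rwa [ENNReal.le_div_iff_mul_le (.inl hs₀) (.inl hs'), one_mul]
  have : MeasurableAdd₂ (G × H) :=
    ⟨(by fun_prop : Measurable fun p : (G × H) × (G × H) => (p.1.1 + p.2.1, p.1.2 + p.2.2))⟩
  have : MeasurableNeg (G × H) := ⟨measurable_fst.neg.prodMk measurable_snd.neg⟩
  have hE : Measurable fun w => F₁ w ^ s.toReal := hF₁.pow_const _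
  have hF : Measurable fun w => F₂ (-w) ^ s.toReal := (hF₂.comp measurable_neg).pow_const _
  have hyoung := mixedNorm_lconvolution_le (κ := κ) (η := η) hE hF (hone hP₁) (hone hP₂)
    (hone hsq) (inv_div_add_inv_div_eq q hs' P₁ P₂) (hone hQ₁) (hone hQ₂)
    (inv_div_add_inv_div_eq q hs' Q₁ Q₂)
  rw [mixedNorm_comp_neg (F := fun w => F₂ w ^ s.toReal) (hF₂.pow_const _),
    mixedNorm_rpow _ _ _ hr, mixedNorm_rpow _ _ _ hr, hmul, hmul, hmul, hmul,
    ← ENNReal.mul_rpow_of_nonneg _ _ hr.le] at hyoung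
  simp only [eLpNorm_mul_comp_sub_eq_lconvolution F₁ F₂ hs₀ hs']
  rw [eLpNorm_rpow _ _ (inv_pos.2 hr), hdiv,
    eLpNorm_prod_eq_mixedNorm (measurable_lconvolution _ hE hF)
      (zero_lt_one.trans_le (hone hsq)).ne']
  exact (ENNReal.rpow_inv_le_iff hr).2 hyoung

end Correlation

section AmbiguityGabor

variable {d : ℕ}

/-- The measure-preserving change of frequency variables `ζ ↦ w` for which the short-time Fourier
transform of the ambiguity function of `f₁` and `f₂` at `(z, ζ)` is, up to a factor of constant
modulus, the product of those of `f₁` at `w` and of the conjugate of `f₂` at `w - z`. -/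
def ambiguityShear (z ζ : Rd d × Rd d) : Rd d × Rd d :=
  ((1 / 2 : ℝ) • z.1 - ζ.2, ζ.1 + (1 / 2 : ℝ) • z.2)

theorem measurePreserving_ambiguityShear (z : Rd d × Rd d) :
    MeasurePreserving (ambiguityShear z) volume volume :=
  ((Measure.measurePreserving_sub_left volume ((1 / 2 : ℝ) • z.1)).prod
    (measurePreserving_add_right volume ((1 / 2 : ℝ) • z.2))).comp Measure.measurePreserving_swap

theorem ambiguity_gaussAtom_eq_stft_mul_stft (f₁ f₂ : 𝓢'(Rd d, ℂ)) (z ζ : Rd d × Rd d) :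
    ambiguity f₁ f₂ (gaussAtom z ζ) =
      2 ^ ((d : ℂ) / 2) * Complex.exp (↑(-2 * Real.pi * inner ℝ z.2 ζ.2) * Complex.I) *
        (stft gauss1 f₁ (ambiguityShear z ζ).1 (ambiguityShear z ζ).2 *
          starRingEnd ℂ
            (stft gauss1 f₂ (ambiguityShear z ζ - z).1 (ambiguityShear z ζ - z).2)) := by
  have hfst : (ambiguityShear z ζ - z).1 = -((1 / 2 : ℝ) • z.1) - ζ.2 := by
    simp only [ambiguityShear, Prod.fst_sub]
    module
  have hsnd : (ambiguityShear z ζ - z).2 = ζ.1 - (1 / 2 : ℝ) • z.2 := by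
    simp only [ambiguityShear, Prod.snd_sub]
    module
  rw [hfst, hsnd]
  exact ambiguity_gaussAtom f₁ f₂ z.1 z.2 ζ.1 ζ.2

theorem enorm_ambiguity_gaussAtom (f₁ f₂ : 𝓢'(Rd d, ℂ)) (z ζ : Rd d × Rd d) :
    ‖ambiguity f₁ f₂ (gaussAtom z ζ)‖ₑ = ‖(2 : ℂ) ^ ((d : ℂ) / 2)‖ₑ *
      (‖stft gauss1 f₁ (ambiguityShear z ζ).1 (ambiguityShear z ζ).2‖ₑ *
        ‖stft gauss1 f₂ (ambiguityShear z ζ - z).1 (ambiguityShear z ζ - z).2‖ₑ) := by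
  have hphase : ‖Complex.exp (↑(-2 * Real.pi * inner ℝ z.2 ζ.2) * Complex.I)‖ₑ = 1 := by
    rw [← ofReal_norm, Complex.norm_exp_ofReal_mul_I, ENNReal.ofReal_one]
  rw [ambiguity_gaussAtom_eq_stft_mul_stft, enorm_mul, enorm_mul, enorm_mul, hphase, mul_one,
    RCLike.enorm_conj]

theorem continuous_ambiguity_gaussAtom (f₁ f₂ : 𝓢'(Rd d, ℂ)) :
    Continuous fun p : (Rd d × Rd d) × (Rd d × Rd d) =>
      ambiguity f₁ f₂ (gaussAtom p.1 p.2) := by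
  have hshear : Continuous fun p : (Rd d × Rd d) × (Rd d × Rd d) => ambiguityShear p.1 p.2 := by
    unfold ambiguityShear
    fun_prop
  simp only [ambiguity_gaussAtom_eq_stft_mul_stft]
  refine Continuous.mul (by fun_prop) (Continuous.mul ((continuous_stft gauss1 f₁).comp hshear) ?_)
  exact Complex.continuous_conj.comp
    ((continuous_stft gauss1 f₂).comp (hshear.sub continuous_fst))

theorem eLpNorm_ambiguity_gaussAtom (f₁ f₂ : 𝓢'(Rd d, ℂ)) (s : ℝ≥0∞) (z : Rd d × Rd d) :
    eLpNorm (fun ζ => ambiguity f₁ f₂ (gaussAtom z ζ)) s =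
      ‖(2 : ℂ) ^ ((d : ℂ) / 2)‖ₑ * eLpNorm (fun w : Rd d × Rd d =>
        ‖stft gauss1 f₁ w.1 w.2‖ₑ * ‖stft gauss1 f₂ (w - z).1 (w - z).2‖ₑ) s := by
  have hcont : Measurable fun w : Rd d × Rd d =>
      ‖stft gauss1 f₁ w.1 w.2‖ₑ * ‖stft gauss1 f₂ (w - z).1 (w - z).2‖ₑ :=
    (continuous_stft gauss1 f₁).enorm.measurable.mul
      ((continuous_stft gauss1 f₂).comp (continuous_sub_right z)).enorm.measurable
  rw [← eLpNorm_enorm]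
  simp only [enorm_ambiguity_gaussAtom]
  rw [eLpNorm_const_mul enorm_ne_top]
  exact congrArg _ (eLpNorm_comp_measurePreserving hcont.aestronglyMeasurable
    (measurePreserving_ambiguityShear z))

theorem exists_eLpNorm_eLpNorm_ambiguity_le {g₁ g₂ : 𝓢(Rd d, ℂ)} (hg₁ : g₁ ≠ 0) (hg₂ : g₂ ≠ 0)
    {p₁ p₂ q₁ q₂ q s : ℝ≥0∞} [s.HolderConjugate q] (hs : s ≤ 2)
    (hp₁ : 1 ≤ p₁) (hp₂ : 1 ≤ p₂) (hq₁ : 1 ≤ q₁) (hq₂ : 1 ≤ q₂)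
    (hp₁q : p₁ ≤ q) (hp₂q : p₂ ≤ q) (hq₁q : q₁ ≤ q) (hq₂q : q₂ ≤ q)
    (hp : 1 ≤ p₁⁻¹ + p₂⁻¹) (hqq : 1 ≤ q₁⁻¹ + q₂⁻¹) :
    ∃ C ≠ (⊤ : ℝ≥0∞), ∀ f₁ f₂ : 𝓢'(Rd d, ℂ),
      eLpNorm (fun z => eLpNorm (fun ζ => ambiguity f₁ f₂ (gaussAtom z ζ)) s) q ≤
        C * modulationNorm g₁ p₁ q₁ f₁ * modulationNorm g₂ p₂ q₂ f₂ := by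
  have hsq : s ≤ q := hs.trans ((le_two_iff_two_le s q).1 hs)
  obtain ⟨P₁, P₂, hP, hpP₁, hpP₂, hsP₁, hsP₂⟩ := exists_holderConjugate_ge hsq hp₁q hp₂q hp
  obtain ⟨Q₁, Q₂, hQ, hqQ₁, hqQ₂, hsQ₁, hsQ₂⟩ := exists_holderConjugate_ge hsq hq₁q hq₂q hqq
  obtain ⟨C₁, hC₁, h₁⟩ := exists_modulationNorm_le hg₁ gauss1 hp₁ hq₁ hpP₁ hqQ₁
  obtain ⟨C₂, hC₂, h₂⟩ := exists_modulationNorm_le hg₂ gauss1 hp₂ hq₂ hpP₂ hqQ₂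
  refine ⟨‖(2 : ℂ) ^ ((d : ℂ) / 2)‖ₑ * (C₁ * C₂),
    ENNReal.mul_ne_top enorm_ne_top (ENNReal.mul_ne_top hC₁ hC₂), fun f₁ f₂ => ?_⟩
  simp only [eLpNorm_ambiguity_gaussAtom]
  rw [eLpNorm_const_mul enorm_ne_top]
  calc _ ≤ ‖(2 : ℂ) ^ ((d : ℂ) / 2)‖ₑ *
        (modulationNorm gauss1 P₁ Q₁ f₁ * modulationNorm gauss1 P₂ Q₂ f₂) := by
        gcongr
        rw [modulationNorm_eq_mixedNorm, modulationNorm_eq_mixedNorm]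
        exact eLpNorm_eLpNorm_mul_comp_sub_le (continuous_stft gauss1 f₁).enorm.measurable
          (continuous_stft gauss1 f₂).enorm.measurable hs hsP₁ hsP₂ hsQ₁ hsQ₂
    _ ≤ ‖(2 : ℂ) ^ ((d : ℂ) / 2)‖ₑ *
        ((C₁ * modulationNorm g₁ p₁ q₁ f₁) * (C₂ * modulationNorm g₂ p₂ q₂ f₂)) := by
        gcongr
        · exact h₁ f₁
        · exact h₂ f₂
    _ = _ := by ring

end AmbiguityGabor

section AmbiguityFunction

variable {d : ℕ}

theorem gauss2_ne_zero (w : Rd d × Rd d) : gauss2 w ≠ 0 := by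
  simp [gauss2]

theorem integral_gauss2_ne_zero : ∫ w : Rd d × Rd d, gauss2 w ≠ 0 := by
  have hgaussian : ∫ η : Rd d, gaussian (Real.pi / 2) (by positivity) η = 2 ^ ((d : ℂ) / 2) := by
    simpa using integral_gaussian_mul_cexp_inner (0 : Rd d)
  simp only [gauss2, tensor_apply]
  rw [Measure.volume_eq_prod, integral_prod_mul, hgaussian]
  simp [Complex.cpow_eq_zero_iff]

theorem exists_memLp_ambiguity {s q : ℝ≥0∞} [s.HolderConjugate q] (hs : s ≤ 2) :
    ∃ C ≠ (⊤ : ℝ≥0∞), ∀ f₁ f₂ : 𝓢'(Rd d, ℂ),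
      eLpNorm (fun z => eLpNorm (fun ζ => ambiguity f₁ f₂ (gaussAtom z ζ)) s) q ≠ ⊤ →
      ∃ A : Rd d × Rd d → ℂ, MemLp A q ∧
        (∀ Φ : 𝓢(Rd d × Rd d, ℂ), ambiguity f₁ f₂ Φ = ∫ z, Φ z * A z) ∧
        eLpNorm A q ≤
          C * eLpNorm (fun z => eLpNorm (fun ζ => ambiguity f₁ f₂ (gaussAtom z ζ)) s) q := by
  have hq : 2 ≤ q := (le_two_iff_two_le s q).1 hs
  have hq₀ : q ≠ 0 := (two_pos.trans_le hq).ne'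
  obtain ⟨C, hC, hausdorffYoung⟩ := hausdorff_young_prod (d := d) (t := q) hs
  have hG₀ : eLpNorm (gauss2 (d := d)) q volume ≠ 0 :=
    eLpNorm_ne_zero_of_continuous gauss2.continuous (gauss2_ne_zero 0) hq₀
  have hGtop : eLpNorm (gauss2 (d := d)) q volume ≠ ⊤ :=
    (gauss2.memLp q volume).2.ne
  refine ⟨C / eLpNorm (gauss2 (d := d)) q volume, ENNReal.div_ne_top hC hG₀, fun f₁ f₂ hfin => ?_⟩
  set N := fun z => eLpNorm (fun ζ => ambiguity f₁ f₂ (gaussAtom z ζ)) s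
  have hcont := continuous_ambiguity_gaussAtom f₁ f₂
  have hN : Measurable N := by
    simpa only [eLpNorm_enorm] using measurable_eLpNorm_prodMk_left hcont.enorm.measurable s
  have hloc : ∀ᵐ z, ∃ u : Rd d × Rd d → ℂ, MemLp u q ∧
      (∀ χ, toCLM (ambiguity f₁ f₂) (localize gauss2 z χ) = ∫ w, χ w * u w) ∧
      eLpNorm u q ≤ C * N z := by
    filter_upwards [ae_lt_top_of_eLpNorm_ne_top hN hq₀ hfin] with z hz
    obtain ⟨u, hu, hpair, hle⟩ := hausdorffYoung
      (fun ζ => ambiguity f₁ f₂ (gaussAtom z ζ))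
      ⟨(hcont.comp (Continuous.prodMk_right z)).aestronglyMeasurable, hz⟩
    refine ⟨u, hu, fun χ => ?_, hle⟩
    rw [hpair, toCLM_apply, apply_localize_gauss2_eq_integral]
  obtain ⟨A, hA, hpair, hle⟩ := exists_memLp_of_localize gauss2_ne_zero integral_gauss2_ne_zero
    (one_le_two.trans hq) ((eLpNorm_const_mul hC N q).trans_ne (ENNReal.mul_ne_top hC hfin)) hloc
  refine ⟨A, hA, hpair, ?_⟩
  rwa [eLpNorm_const_mul hC, ← ENNReal.le_div_iff_mul_le (.inl hG₀) (.inl hGtop),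
    ENNReal.mul_div_right_comm] at hle

end AmbiguityFunction

end TimeFreq

end

theorem corollary4p4 (d : ℕ) (p₁ p₂ q₁ q₂ q : ℝ≥0∞)
    (hp₁ : 1 ≤ p₁) (hp₂ : 1 ≤ p₂) (hq₁ : 1 ≤ q₁) (hq₂ : 1 ≤ q₂) (hq : 2 ≤ q)
    (hp₁q : p₁ ≤ q) (hp₂q : p₂ ≤ q) (hq₁q : q₁ ≤ q) (hq₂q : q₂ ≤ q)
    (hp : 1 ≤ 1 / p₁ + 1 / p₂) (hqq : 1 ≤ 1 / q₁ + 1 / q₂)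
    (g₁ g₂ : 𝓢(Rd d, ℂ)) (hg₁ : g₁ ≠ 0) (hg₂ : g₂ ≠ 0) :
    ∃ C : ℝ≥0, ∀ f₁ ∈ modulationSpace g₁ p₁ q₁, ∀ f₂ ∈ modulationSpace g₂ p₂ q₂,
      ∃ A : Rd d × Rd d → ℂ, MemLp A q volume ∧
        (∀ Φ : 𝓢(Rd d × Rd d, ℂ), ambiguity f₁ f₂ Φ = ∫ z, Φ z * A z) ∧
        eLpNorm A q volume ≤ C * modulationNorm g₁ p₁ q₁ f₁ * modulationNorm g₂ p₂ q₂ f₂ := by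
  simp only [one_div] at hp hqq
  have : (1 - q⁻¹)⁻¹.HolderConjugate q :=
    have := ENNReal.HolderConjugate.inv_one_sub_inv' (one_le_two.trans hq)
    .symm
  have hs : (1 - q⁻¹)⁻¹ ≤ 2 := (le_two_iff_two_le _ q).2 hq
  obtain ⟨C₁, hC₁, gabor_le⟩ := exists_eLpNorm_eLpNorm_ambiguity_le hg₁ hg₂ hs hp₁ hp₂ hq₁ hq₂
    hp₁q hp₂q hq₁q hq₂q hp hqq
  obtain ⟨C₂, hC₂, exists_memLp⟩ := exists_memLp_ambiguity (d := d) (q := q) hs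
  refine ⟨(C₂ * C₁).toNNReal, fun f₁ hf₁ f₂ hf₂ => ?_⟩
  have hfin : C₁ * modulationNorm g₁ p₁ q₁ f₁ * modulationNorm g₂ p₂ q₂ f₂ < ⊤ :=
    ENNReal.mul_lt_top (ENNReal.mul_lt_top hC₁.lt_top hf₁) hf₂
  obtain ⟨A, hA, hpair, hle⟩ := exists_memLp f₁ f₂ ((gabor_le f₁ f₂).trans_lt hfin).ne
  refine ⟨A, hA, hpair, hle.trans ?_⟩
  rw [ENNReal.coe_toNNReal (ENNReal.mul_ne_top hC₂ hC₁), mul_assoc, mul_assoc, ← mul_assoc C₁]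
  gcongr
  exact gabor_le f₁ f₂
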